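/- **Theorem 5.4.** Let $G$ be a compact Lie group and let $(\mathcal A,G,\alpha)$ be a free C$^*$-dynamical system: $\mathcal A$ is a unital C$^*$-algebra, $(g,x)\mapsto\alpha_g(x)$ is a continuous action of $G$ by $^*$-automorphisms, and the linear span of the functions $g\mapsto x\,\alpha_g(y)$, $x,y\in\mathcal A$, is dense in $C(G,\mathcal A)$. Let $\mathcal B=\mathcal A^G$ be the fixed point algebra and $\operatorname{Irr}(G)$ the set of classes of irreducible representations of $G$, with unitary representatives $(\sigma,V_\sigma)$. For each $\sigma\in\operatorname{Irr}(G)$ let $\mathfrak H_\sigma$ be a finite-dimensional Hilbert space and $s(\sigma)\in\mathcal A\otimes\mathcal L(V_\sigma,\mathfrak H_\sigma)$ an isometry with $\alpha_g(s(\sigma))=s(\sigma)(1\otimes\sigma_g)$ for all $g\in G$, where $\mathfrak H_1=\mathbb C$ and $s(1)=1_{\mathcal A}$ for the trivial class. For $\sigma,\tau\in\operatorname{Irr}(G)$ fix a decomposition $\sigma\otimes\tau=\kappa_1\oplus\dots\oplus\kappa_N$ into irreducible representations and put $\mathfrak H_{\sigma\otimes\tau}=\bigoplus_r\mathfrak H_{\kappa_r}$,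 $s(\sigma\otimes\tau)=\bigoplus_r s(\kappa_r)$. Define $$\gamma_\sigma(b)=s(\sigma)(b\otimes 1)s(\sigma)^*\in\mathcal B\otimes\mathcal L(\mathfrak H_\sigma)\quad(b\in\mathcal B),$$ $$\omega(\sigma,\tau)=s(\sigma\otimes\tau)s(\sigma)^*s(\tau)^*\in\mathcal B\otimes\mathcal L(\mathfrak H_\sigma\otimes\mathfrak H_\tau,\mathfrak H_{\sigma\otimes\tau}),\qquad p(\sigma)=s(\sigma)s(\sigma)^*,$$ where $s(\sigma)^*$ and $s(\tau)^*$ act trivially on $V_\tau$ and $\mathfrak H_\sigma$, respectively. Let $(\mathcal B_0,\pi_{\mathcal B},\mathfrak H_{\mathcal B},D_{\mathcal B})$ be a spectral triple on $\mathcal B$: $\mathcal B_0\subseteq\mathcal B$ is a dense unital $^*$-subalgebra, $\pi_{\mathcal B}$ is a faithful unital $^*$-representation of $\mathcal B$ on the Hilbert space $\mathfrak H_{\mathcal B}$, and $D_{\mathcal B}$ is a self-adjoint operator on $\mathfrak H_{\mathcal B}$ with compact resolvent such that, for each $b\in\mathcal B_0$, $\pi_{\mathcal B}(b)$ preserves $\operatorname{dom}D_{\mathcal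 B}$ and $[D_{\mathcal B},\pi_{\mathcal B}(b)]$ is bounded. Assume that $\gamma_\sigma(\mathcal B_0)\subseteq\mathcal B_0\otimes\mathcal L(\mathfrak H_\sigma)$ and $\omega(\sigma,\tau)\in\mathcal B_0\otimes\mathcal L(\mathfrak H_\sigma\otimes\mathfrak H_\tau,\mathfrak H_{\sigma\otimes\tau})$ for all $\sigma,\tau\in\operatorname{Irr}(G)$. Elements of $\mathcal B\otimes\mathcal L(\cdot,\cdot)$ are regarded as operators via $\pi_{\mathcal B}\otimes\mathrm{id}$. Let $\mathcal A_0\subseteq\mathcal A$ be the linear span of the elements $a_\sigma(b\otimes\eta\otimes\bar v)=(\mathrm{id}\otimes\langle v,\cdot\rangle)\bigl(s(\sigma)^*(b\otimes\eta)\bigr)$ with $\sigma\in\operatorname{Irr}(G)$, $b\in\mathcal B_0$, $\eta\in\mathfrak H_\sigma$, $v\in V_\sigma$. Let $\mathfrak H_p=\bigoplus_\sigma p(\sigma)(\mathfrak H_{\mathcal B}\otimes\mathfrak H_\sigma)\otimes\bar V_\sigma$ (Hilbert space direct sum), and let $\mathcal A$ be represented on $\mathfrak H_p$ by $\pi_{\mathcal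 A}(x)=(\pi_{\mathcal B}\otimes\mathrm{id})\bigl(s\,j_\alpha(x)\,s^*\bigr)$. Here $s=\bigoplus_\sigma s(\sigma)\otimes 1_{\bar V_\sigma}$, the space $L^2(G)=\bigoplus_\sigma V_\sigma\otimes\bar V_\sigma$ is decomposed by the unitary identification of $v\otimes\bar w$ with $h\mapsto(\dim V_\sigma)^{1/2}\langle w,\sigma_h v\rangle$, and $j_\alpha(x)$ is multiplication by the function $h\mapsto\alpha_{h^{-1}}(x)$. Let the horizontal lift be the self-adjoint operator $D_h=\bigoplus_\sigma D_\sigma\otimes 1_{\bar V_\sigma}$ on $\mathfrak H_p$, where $D_\sigma=p(\sigma)(D_{\mathcal B}\otimes 1_{\mathfrak H_\sigma})p(\sigma)$ with domain $p(\sigma)(\operatorname{dom}D_{\mathcal B}\otimes\mathfrak H_\sigma)$. Suppose that there are constants $C(b)>0$, $b\in\mathcal B_0$, and $C(\sigma)>0$, $\sigma\in\operatorname{Irr}(G)$, such that $$\sup_{\tau\in\operatorname{Irr}(G)}\bigl\|[D_{\mathcal B}\otimes 1_{\mathfrak H_\tau},\gamma_\tau(b)]\bigr\|<C(b)\quad\text{for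 all }b\in\mathcal B_0,$$ $$\sup_{\tau\in\operatorname{Irr}(G)}\bigl\|[D_{\mathcal B}\otimes 1,\omega(\sigma,\tau)]\bigr\|<C(\sigma)\quad\text{for all }\sigma\in\operatorname{Irr}(G),$$ where $[D_{\mathcal B}\otimes 1,\omega(\sigma,\tau)]=(D_{\mathcal B}\otimes 1_{\mathfrak H_{\sigma\otimes\tau}})\omega(\sigma,\tau)-\omega(\sigma,\tau)(D_{\mathcal B}\otimes 1_{\mathfrak H_\sigma\otimes\mathfrak H_\tau})$. Then $D_h$ has bounded commutators with $\mathcal A_0$: for each $x\in\mathcal A_0$, the bounded operator $\pi_{\mathcal A}(x)$ maps $\operatorname{dom}D_h$ into itself and $[D_h,\pi_{\mathcal A}(x)]$ is bounded on $\operatorname{dom}D_h$. -/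

import Mathlib

open scoped Manifold ContDiff Matrix ENNReal Kronecker

namespace HorizontalLift

noncomputable section

/-! ### Irreducible unitary representations of a topological group -/

/-- The linear representation on `ℂⁿ` given by a homomorphism into the unitary `n × n`-matrices. -/
def matrixRep {G : Type*} [Group G] {n : ℕ} (ρ : G →* Matrix.unitaryGroup (Fin n) ℂ) :
    Representation ℂ G (Fin n → ℂ) :=
  (Matrix.toLinAlgEquiv' : Matrix (Fin n) (Fin n) ℂ ≃ₐ[ℂ] _).toAlgHom.toMonoidHom.comp
    ((Matrix.unitaryGroup (Fin n) ℂ).subtype.comp ρ)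

/-- A finite-dimensional continuous irreducible unitary representation, written as unitary
matrices with respect to an orthonormal basis of the representation space. -/
structure UnitaryIrrep (G : Type*) [Group G] [TopologicalSpace G] where
  dim : ℕ
  hom : G →* Matrix.unitaryGroup (Fin dim) ℂ
  continuous_hom : Continuous hom
  irreducible : (matrixRep hom).IsIrreducible

/-- Unitary equivalence of irreducible representations. -/
instance UnitaryIrrep.setoid (G : Type*) [Group G] [TopologicalSpace G] :
    Setoid (UnitaryIrrep G) where
  r ρ ρ' := ∃ U : Matrix (Fin ρ.dim) (Fin ρ'.dim) ℂ, U * Uᴴ = 1 ∧ Uᴴ * U = 1 ∧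
    ∀ g, (ρ.hom g : Matrix (Fin ρ.dim) (Fin ρ.dim) ℂ) * U =
      U * (ρ'.hom g : Matrix (Fin ρ'.dim) (Fin ρ'.dim) ℂ)
  iseqv :=
    { refl := fun _ => ⟨1, by simp, by simp, fun _ => by simp⟩
      symm := by
        rintro ρ ρ' ⟨U, h1, h2, h3⟩
        refine ⟨Uᴴ, by simpa using h2, by simpa using h1, fun g => ?_⟩
        calc (ρ'.hom g : Matrix (Fin ρ'.dim) (Fin ρ'.dim) ℂ) * Uᴴ
            = Uᴴ * (U * (ρ'.hom g : Matrix (Fin ρ'.dim) (Fin ρ'.dim) ℂ)) * Uᴴ := by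
              rw [← Matrix.mul_assoc, h2, Matrix.one_mul]
          _ = Uᴴ * (ρ.hom g : Matrix (Fin ρ.dim) (Fin ρ.dim) ℂ) := by
              rw [← h3, Matrix.mul_assoc, Matrix.mul_assoc, h1, Matrix.mul_one]
      trans := by
        rintro ρ ρ' ρ'' ⟨U, h1, h2, h3⟩ ⟨V, k1, k2, k3⟩
        refine ⟨U * V, ?_, ?_, fun g => ?_⟩
        · rw [Matrix.conjTranspose_mul, Matrix.mul_assoc, ← Matrix.mul_assoc V, k1,
            Matrix.one_mul, h1]
        · rw [Matrix.conjTranspose_mul, Matrix.mul_assoc, ← Matrix.mul_assoc Uᴴ, h2,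
            Matrix.one_mul, k2]
        · rw [← Matrix.mul_assoc, h3, Matrix.mul_assoc, k3, Matrix.mul_assoc] }

/-- `Irrep G`: the set of equivalence classes of irreducible representations. -/
def Irrep (G : Type*) [Group G] [TopologicalSpace G] : Type _ := Quotient (UnitaryIrrep.setoid G)

/-- The one-dimensional trivial representation. -/
def UnitaryIrrep.trivial (G : Type*) [Group G] [TopologicalSpace G] : UnitaryIrrep G where
  dim := 1
  hom := 1
  continuous_hom := continuous_const
  irreducible :=
    { exists_pair_ne := by
        refine ⟨⊥, ⊤, fun h => ?_⟩
        have h1 : (fun _ : Fin 1 => (1 : ℂ)) ∈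
            (⊤ : Subrepresentation (matrixRep (1 : G →* Matrix.unitaryGroup (Fin 1) ℂ))) :=
          Submodule.mem_top (R := ℂ)
        rw [← h] at h1
        have h2 : (fun _ : Fin 1 => (1 : ℂ)) = 0 := (Submodule.mem_bot ℂ).1 h1
        exact one_ne_zero (congrFun h2 0)
      eq_bot_or_eq_top := fun W => by
        have hs : IsSimpleModule ℂ (Fin 1 → ℂ) :=
          isSimpleModule_iff_finrank_eq_one.2 (by simp)
        rcases eq_bot_or_eq_top W.toSubmodule with h | h
        · exact Or.inl (Subrepresentation.toSubmodule_injective h)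
        · exact Or.inr (Subrepresentation.toSubmodule_injective h) }

namespace Irrep

variable {G : Type*} [Group G] [TopologicalSpace G]

/-- The class of the trivial representation. -/
def trivial (G : Type*) [Group G] [TopologicalSpace G] : Irrep G :=
  Quotient.mk _ (UnitaryIrrep.trivial G)

/-- The chosen representative of a class. -/
def rep (σ : Irrep G) : UnitaryIrrep G := Quotient.out σ

/-- The dimension of the representation space `V_σ`. -/
def dim (σ : Irrep G) : ℕ := σ.rep.dim

/-- The unitary matrix `σ_g` on `V_σ = ℂ ^ dim σ`. -/
def mat (σ : Irrep G) (g : G) : Matrix (Fin σ.dim) (Fin σ.dim) ℂ := (σ.rep.hom g).1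

lemma mat_mul (σ : Irrep G) (g h : G) : σ.mat (g * h) = σ.mat g * σ.mat h := by
  simp only [mat, map_mul]
  rfl

lemma mat_mul_conjTranspose (σ : Irrep G) (g : G) : σ.mat g * (σ.mat g)ᴴ = 1 :=
  Matrix.mem_unitaryGroup_iff.1 (σ.rep.hom g).2

lemma continuous_mat_apply (σ : Irrep G) (i j : Fin σ.dim) :
    Continuous fun g => σ.mat g i j :=
  (continuous_subtype_val.comp σ.rep.continuous_hom).matrix_elem i j

/-- The function in `L²(G)` corresponding to `e_i ⊗ ē_j ∈ V_σ ⊗ V̄_σ` under the decomposition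
`L²(G) = ⨁ V_σ ⊗ V̄_σ`, for which `λ_g = ⨁ 1 ⊗ σ̄_g` and `r_g = ⨁ σ_g ⊗ 1`;
it is the normalized coefficient `h ↦ (dim σ)^{1/2} ⟨e_j, σ_h e_i⟩`. -/
def coeff (σ : Irrep G) (i j : Fin σ.dim) (h : G) : ℂ :=
  (Real.sqrt σ.dim : ℂ) * σ.mat h j i

lemma continuous_coeff (σ : Irrep G) (i j : Fin σ.dim) : Continuous (σ.coeff i j) :=
  continuous_const.mul (σ.continuous_mat_apply j i)

lemma coeff_mul (σ : Irrep G) (i j : Fin σ.dim) (h g : G) :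
    σ.coeff i j (h * g) = ∑ i', σ.mat g i' i * σ.coeff i' j h := by
  simp only [coeff, mat_mul, Matrix.mul_apply, Finset.mul_sum]
  exact Finset.sum_congr rfl fun _ _ => by ring

end Irrep

/-- A decomposition of `σ ⊗ τ` into irreducible representations, i.e. a unitary
`V_σ ⊗ V_τ → ⨁ᵣ V_{κ r}` intertwining `σ ⊗ τ` with `⨁ᵣ κ r`. -/
structure TensorDecomp {G : Type*} [Group G] [TopologicalSpace G] (σ τ : Irrep G) where
  num : ℕ
  comp : Fin num → Irrep G
  U : Matrix (Σ r, Fin (comp r).dim) (Fin σ.dim × Fin τ.dim) ℂ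
  mul_conjTranspose_U : U * Uᴴ = 1
  conjTranspose_U_mul : Uᴴ * U = 1
  intertwines : ∀ g, U * (σ.mat g ⊗ₖ τ.mat g) =
    Matrix.blockDiagonal' (fun r => (comp r).mat g) * U

/-- Every invariant subspace for a unitary matrix representation gives a block decomposition. -/
lemma exists_blocks {G : Type*} [Group G] {n : ℕ} (W : Submodule ℂ (EuclideanSpace ℂ (Fin n)))
    (X : G → Matrix (Fin n) (Fin n) ℂ) (hinv : ∀ g, (X g)ᴴ = X g⁻¹)
    (hW : ∀ g, ∀ v ∈ W, Matrix.toEuclideanLin (X g) v ∈ W) :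
    ∃ (d e : ℕ) (P : Matrix (Fin n) (Fin d) ℂ) (Q : Matrix (Fin n) (Fin e) ℂ),
      d = Module.finrank ℂ W ∧ d + e = n ∧ Pᴴ * P = 1 ∧ Qᴴ * Q = 1 ∧ Pᴴ * Q = 0 ∧
      P * Pᴴ + Q * Qᴴ = 1 ∧ (∀ m, WithLp.toLp 2 (fun i => P i m) ∈ W) ∧
      (∀ g, X g * P = P * (Pᴴ * X g * P)) ∧ ∀ g, X g * Q = Q * (Qᴴ * X g * Q) := by
  let b := stdOrthonormalBasis ℂ W
  let c := stdOrthonormalBasis ℂ Wᗮ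
  let P : Matrix (Fin n) (Fin (Module.finrank ℂ W)) ℂ := Matrix.of fun i m => (b m).1 i
  let Q : Matrix (Fin n) (Fin (Module.finrank ℂ Wᗮ)) ℂ := Matrix.of fun i m => (c m).1 i
  have hin : ∀ u v : EuclideanSpace ℂ (Fin n), ∑ i, star (u i) * v i = inner ℂ u v := by
    intro u v
    simp [PiLp.inner_apply, mul_comm]
  have hP : Pᴴ * P = 1 := by
    ext m m'
    have h := orthonormal_iff_ite.1 b.orthonormal m m'
    rw [Submodule.coe_inner] at h
    simp only [Matrix.mul_apply, Matrix.conjTranspose_apply, P, Matrix.of_apply, hin, h,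
      Matrix.one_apply]
  have hQ : Qᴴ * Q = 1 := by
    ext m m'
    have h := orthonormal_iff_ite.1 c.orthonormal m m'
    rw [Submodule.coe_inner] at h
    simp only [Matrix.mul_apply, Matrix.conjTranspose_apply, Q, Matrix.of_apply, hin, h,
      Matrix.one_apply]
  have hPQ : Pᴴ * Q = 0 := by
    ext m m'
    simp only [Matrix.mul_apply, Matrix.conjTranspose_apply, P, Q, Matrix.of_apply, hin,
      Matrix.zero_apply]
    exact (c m').2 _ (b m).2
  have hsum : P * Pᴴ + Q * Qᴴ = 1 := by
    ext i j
    let v : EuclideanSpace ℂ (Fin n) := EuclideanSpace.single j 1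
    have h1 : W.starProjection v + Wᗮ.starProjection v = v :=
      W.starProjection_add_starProjection_orthogonal v
    rw [b.starProjection_eq_sum_rankOne, c.starProjection_eq_sum_rankOne] at h1
    have h2 := congrFun (congrArg WithLp.ofLp h1) i
    have hv : ∀ u : EuclideanSpace ℂ (Fin n), inner ℂ u v = star (u j) := by
      intro u
      rw [EuclideanSpace.inner_single_right, one_mul]
      rfl
    simp only [PiLp.add_apply, _root_.sum_apply, InnerProductSpace.rankOne_apply,
      hv, WithLp.ofLp_sum, Finset.sum_apply, PiLp.smul_apply, smul_eq_mul] at h2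
    rw [Matrix.add_apply, Matrix.mul_apply, Matrix.mul_apply]
    simp only [Matrix.conjTranspose_apply, P, Q, Matrix.of_apply]
    have h3 : v i = (1 : Matrix (Fin n) (Fin n) ℂ) i j := by
      simp [v, Matrix.one_apply]
    rw [← h3, ← h2]
    simp [mul_comm]
  have hcard : Module.finrank ℂ W + Module.finrank ℂ Wᗮ = n := by
    simpa using W.finrank_add_finrank_orthogonal
  have hQP : ∀ g, Qᴴ * (X g * P) = 0 := by
    intro g
    ext m m'
    have h : (Qᴴ * (X g * P)) m m' =
        inner ℂ (c m).1 (Matrix.toEuclideanLin (X g) (b m').1) := by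
      rw [← hin]
      simp [Matrix.mul_apply, P, Q, Matrix.toLpLin_apply, Matrix.mulVec, dotProduct]
    rw [h]
    exact Submodule.inner_left_of_mem_orthogonal (hW g _ (b m').2) (c m).2
  have hPQ' : ∀ g, Pᴴ * (X g * Q) = 0 := by
    intro g
    have h := congrArg Matrix.conjTranspose (hQP g⁻¹)
    rw [Matrix.conjTranspose_mul, Matrix.conjTranspose_mul, ← hinv,
      Matrix.conjTranspose_conjTranspose, Matrix.conjTranspose_conjTranspose,
      Matrix.conjTranspose_zero, Matrix.mul_assoc] at h
    exact h
  refine ⟨_, _, P, Q, rfl, hcard, hP, hQ, hPQ, hsum, fun m => (b m).2, fun g => ?_, fun g => ?_⟩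
  · calc X g * P = (P * Pᴴ + Q * Qᴴ) * (X g * P) := by rw [hsum, Matrix.one_mul]
      _ = P * (Pᴴ * X g * P) := by
        rw [Matrix.add_mul, Matrix.mul_assoc Q, hQP, Matrix.mul_zero, add_zero]
        simp only [Matrix.mul_assoc]
  · calc X g * Q = (P * Pᴴ + Q * Qᴴ) * (X g * Q) := by rw [hsum, Matrix.one_mul]
      _ = Q * (Qᴴ * X g * Q) := by
        rw [Matrix.add_mul, Matrix.mul_assoc P, hPQ', Matrix.mul_zero, zero_add]
        simp only [Matrix.mul_assoc]

/-- Compressing a unitary representation to an invariant block. -/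
lemma block_mul {G : Type*} [Group G] {n d : ℕ} {X : G → Matrix (Fin n) (Fin n) ℂ}
    (hmul : ∀ g h, X (g * h) = X g * X h) {P : Matrix (Fin n) (Fin d) ℂ}
    (hXP : ∀ g, X g * P = P * (Pᴴ * X g * P)) (g h : G) :
    Pᴴ * X (g * h) * P = (Pᴴ * X g * P) * (Pᴴ * X h * P) := by
  calc Pᴴ * X (g * h) * P = Pᴴ * X g * (X h * P) := by
        rw [hmul]; simp only [Matrix.mul_assoc]
    _ = Pᴴ * X g * (P * (Pᴴ * X h * P)) := by rw [← hXP]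
    _ = _ := by simp only [Matrix.mul_assoc]

/-- Complete reducibility, in matrix form. -/
lemma exists_decomp {G : Type*} [Group G] [TopologicalSpace G] (n : ℕ) : ∀ (X : G → Matrix (Fin n) (Fin n) ℂ), X 1 = 1 →
    (∀ g h, X (g * h) = X g * X h) → (∀ g, (X g)ᴴ = X g⁻¹) → Continuous X →
    ∃ (ι : Type) (_ : Fintype ι) (comp : ι → Irrep G)
      (C : ∀ r, Matrix (Fin n) (Fin (comp r).dim) ℂ),
      (∀ r, (C r)ᴴ * C r = 1) ∧ (∀ r s, r ≠ s → (C r)ᴴ * C s = 0) ∧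
      ∑ r, C r * (C r)ᴴ = 1 ∧ ∀ g r, X g * C r = C r * (comp r).mat g := by
  induction n using Nat.strong_induction_on with
  | _ n ih =>
  intro X h1 hmul hinv hcont
  rcases Nat.eq_zero_or_pos n with rfl | hn
  · exact ⟨Empty, inferInstance, Empty.elim, fun r => r.elim, fun r => r.elim,
      fun r => r.elim, Subsingleton.elim _ _, fun _ r => r.elim⟩
  have hlin : ∀ (M : Matrix (Fin n) (Fin n) ℂ) (v : EuclideanSpace ℂ (Fin n)),
      Matrix.toEuclideanLin M v = WithLp.toLp 2 (M *ᵥ v.ofLp) := fun _ _ => rfl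
  have : Nontrivial (EuclideanSpace ℂ (Fin n)) :=
    Module.nontrivial_of_finrank_pos (R := ℂ) (by simpa using hn)
  obtain ⟨W, ⟨hW0, hW⟩, hmin⟩ := (wellFounded_lt (α := Submodule ℂ (EuclideanSpace ℂ (Fin n)))).has_min
    {W | W ≠ ⊥ ∧ ∀ g, ∀ v ∈ W, Matrix.toEuclideanLin (X g) v ∈ W}
    ⟨⊤, top_ne_bot, fun _ _ _ => Submodule.mem_top⟩
  obtain ⟨d, e, P, Q, hd, hde, hP, hQ, hPQ, hsum, hPW, hXP, hXQ⟩ := exists_blocks W X hinv hW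
  have hdpos : 0 < d := by
    rw [hd]
    have := (Submodule.nontrivial_iff_ne_bot).2 hW0
    exact Module.finrank_pos
  -- the irreducible block
  have hR1 : Pᴴ * X 1 * P = 1 := by rw [h1, Matrix.mul_one, hP]
  have hRu : ∀ g, (Pᴴ * X g * P) ∈ Matrix.unitaryGroup (Fin d) ℂ := by
    intro g
    rw [Matrix.mem_unitaryGroup_iff, Matrix.star_eq_conjTranspose, Matrix.conjTranspose_mul,
      Matrix.conjTranspose_mul, Matrix.conjTranspose_conjTranspose, hinv, ← Matrix.mul_assoc Pᴴ,
      ← block_mul hmul hXP, mul_inv_cancel, hR1]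
  let R : G →* Matrix.unitaryGroup (Fin d) ℂ :=
    { toFun := fun g => ⟨Pᴴ * X g * P, hRu g⟩
      map_one' := Subtype.ext hR1
      map_mul' := fun g h => Subtype.ext (block_mul hmul hXP g h) }
  let f : (Fin d → ℂ) →ₗ[ℂ] EuclideanSpace ℂ (Fin n) :=
    (WithLp.linearEquiv 2 ℂ (Fin n → ℂ)).symm.toLinearMap ∘ₗ P.mulVecLin
  have hf : ∀ v, f v = WithLp.toLp 2 (P *ᵥ v) := fun _ => rfl
  have hfinj : ∀ v, f v = 0 → v = 0 := by
    intro v hv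
    have hv' : P *ᵥ v = 0 := congrArg WithLp.ofLp hv
    have := congrArg (Pᴴ *ᵥ ·) hv'
    simpa [Matrix.mulVec_mulVec, hP] using this
  have hfW : ∀ v, f v ∈ W := by
    intro v
    have : f v = ∑ m, v m • WithLp.toLp 2 (fun i => P i m) := by
      ext i
      simp [hf, Matrix.mulVec, dotProduct, mul_comm]
    rw [this]
    exact Submodule.sum_mem _ fun m _ => W.smul_mem _ (hPW m)
  have hfX : ∀ g v, Matrix.toEuclideanLin (X g) (f v) = f ((Pᴴ * X g * P) *ᵥ v) := by
    intro g v
    rw [hlin, hf, hf]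
    simp only [Matrix.mulVec_mulVec, ← hXP]
  have hirr : (matrixRep R).IsIrreducible := by
    refine { exists_pair_ne := ⟨⊥, ⊤, fun h => ?_⟩, eq_bot_or_eq_top := fun K => ?_ }
    · have k1 : (fun _ : Fin d => (1 : ℂ)) ∈ (⊤ : Subrepresentation (matrixRep R)) :=
        Submodule.mem_top (R := ℂ)
      rw [← h] at k1
      have k2 : (fun _ : Fin d => (1 : ℂ)) = 0 := (Submodule.mem_bot ℂ).1 k1
      exact one_ne_zero (congrFun k2 ⟨0, hdpos⟩)
    · have hK : ∀ g, ∀ v ∈ K.toSubmodule.map f,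
          Matrix.toEuclideanLin (X g) v ∈ K.toSubmodule.map f := by
        rintro g _ ⟨v, hv, rfl⟩
        exact ⟨(Pᴴ * X g * P) *ᵥ v, K.apply_mem_toSubmodule g hv, (hfX g v).symm⟩
      have hle : K.toSubmodule.map f ≤ W := by
        rintro _ ⟨v, _, rfl⟩
        exact hfW v
      by_cases hb : K.toSubmodule.map f = ⊥
      · left
        apply Subrepresentation.toSubmodule_injective
        refine (Submodule.eq_bot_iff _).2 fun v hv => hfinj v ?_
        exact (Submodule.eq_bot_iff _).1 hb _ ⟨v, hv, rfl⟩
      · right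
        apply Subrepresentation.toSubmodule_injective
        have heq : K.toSubmodule.map f = W :=
          (eq_or_lt_of_le hle).resolve_right (hmin _ ⟨hb, hK⟩)
        refine (Submodule.eq_top_iff').2 fun v => ?_
        have : f v ∈ K.toSubmodule.map f := heq ▸ hfW v
        obtain ⟨w, hw, hwv⟩ := this
        have : w = v := sub_eq_zero.1 (hfinj _ (by rw [map_sub, hwv, sub_self]))
        exact this ▸ hw
  let ρ : UnitaryIrrep G :=
    { dim := d
      hom := R
      continuous_hom := Continuous.subtype_mk
        ((continuous_const.matrix_mul hcont).matrix_mul continuous_const) _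
      irreducible := hirr }
  let κ : Irrep G := Quotient.mk _ ρ
  obtain ⟨U, hU1, hU2, hU3⟩ := Quotient.exact (Quotient.out_eq κ)
  -- the complement
  have hS1 : Qᴴ * X 1 * Q = 1 := by rw [h1, Matrix.mul_one, hQ]
  obtain ⟨ι, _, comp, C, hC1, hC2, hC3, hC4⟩ := ih e (by omega) (fun g => Qᴴ * X g * Q) hS1
    (block_mul hmul hXQ) (fun g => by
      simp only [Matrix.conjTranspose_mul, Matrix.conjTranspose_conjTranspose, hinv,
        Matrix.mul_assoc])
    ((continuous_const.matrix_mul hcont).matrix_mul continuous_const)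
  have hQP : Qᴴ * P = 0 := by
    simpa using congrArg Matrix.conjTranspose hPQ
  let comp' : Option ι → Irrep G := fun r => r.elim κ comp
  let U' : Matrix (Fin κ.dim) (Fin d) ℂ := U
  have hU1' : U' * U'ᴴ = 1 := hU1
  have hU2' : U'ᴴ * U' = 1 := hU2
  have hU3' : ∀ g, κ.mat g * U' = U' * (Pᴴ * X g * P) := hU3
  let C' : ∀ r, Matrix (Fin n) (Fin (comp' r).dim) ℂ := fun r =>
    match r with
    | none => P * U'ᴴ
    | some r => Q * C r
  have hn' : C' none = P * U'ᴴ := rfl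
  have hs' : ∀ r, C' (some r) = Q * C r := fun _ => rfl
  have orth : ∀ r, (P * U'ᴴ)ᴴ * (Q * C r) = 0 := by
    intro r
    rw [Matrix.conjTranspose_mul, Matrix.mul_assoc, ← Matrix.mul_assoc Pᴴ, hPQ, Matrix.zero_mul,
      Matrix.mul_zero]
  refine ⟨Option ι, inferInstance, comp', C', ?_, ?_, ?_, ?_⟩
  · rintro (_ | r)
    · change (P * U'ᴴ)ᴴ * (P * U'ᴴ) = 1
      rw [Matrix.conjTranspose_mul, Matrix.mul_assoc, ← Matrix.mul_assoc Pᴴ, hP, Matrix.one_mul,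
        Matrix.conjTranspose_conjTranspose, hU1']
    · change (Q * C r)ᴴ * (Q * C r) = 1
      rw [Matrix.conjTranspose_mul, Matrix.mul_assoc, ← Matrix.mul_assoc Qᴴ, hQ, Matrix.one_mul,
        hC1]
  · rintro (_ | r) (_ | s) hrs
    · exact absurd rfl hrs
    · exact orth s
    · change (Q * C r)ᴴ * (P * U'ᴴ) = 0
      simpa [Matrix.conjTranspose_mul] using congrArg Matrix.conjTranspose (orth r)
    · change (Q * C r)ᴴ * (Q * C s) = 0
      rw [Matrix.conjTranspose_mul, Matrix.mul_assoc, ← Matrix.mul_assoc Qᴴ, hQ, Matrix.one_mul,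
        hC2 r s fun h => hrs (congrArg some h)]
  · rw [Fintype.sum_option]
    have e1 : C' none * (C' none)ᴴ = P * Pᴴ := by
      change P * U'ᴴ * (P * U'ᴴ)ᴴ = _
      rw [Matrix.conjTranspose_mul, Matrix.mul_assoc, ← Matrix.mul_assoc U'ᴴ,
        Matrix.conjTranspose_conjTranspose, hU2', Matrix.one_mul]
    have e2 : ∑ r, C' (some r) * (C' (some r))ᴴ = Q * Qᴴ := by
      change ∑ r, Q * C r * (Q * C r)ᴴ = _
      calc ∑ r, Q * C r * (Q * C r)ᴴ = ∑ r, Q * (C r * (C r)ᴴ) * Qᴴ := by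
            refine Finset.sum_congr rfl fun r _ => ?_
            rw [Matrix.conjTranspose_mul]
            simp only [Matrix.mul_assoc]
        _ = Q * Qᴴ := by
            rw [← Matrix.sum_mul, ← Matrix.mul_sum, hC3, Matrix.mul_one]
    rw [e1, e2, hsum]
  · rintro g (_ | r)
    · change X g * (P * U'ᴴ) = P * U'ᴴ * κ.mat g
      calc X g * (P * U'ᴴ) = P * ((Pᴴ * X g * P) * U'ᴴ) := by
            rw [← Matrix.mul_assoc, hXP, Matrix.mul_assoc]
        _ = P * (U'ᴴ * (U' * (Pᴴ * X g * P)) * U'ᴴ) := by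
            rw [← Matrix.mul_assoc U'ᴴ, hU2', Matrix.one_mul]
        _ = P * U'ᴴ * κ.mat g := by
            rw [← hU3', Matrix.mul_assoc U'ᴴ, Matrix.mul_assoc (κ.mat g), hU1', Matrix.mul_one,
              Matrix.mul_assoc]
    · change X g * (Q * C r) = Q * C r * (comp r).mat g
      rw [← Matrix.mul_assoc, hXQ, Matrix.mul_assoc, hC4, Matrix.mul_assoc]

/-- The tensor product of two irreducible representations can be decomposed. -/
instance TensorDecomp.nonempty {G : Type*} [Group G] [TopologicalSpace G] (σ τ : Irrep G) : Nonempty (TensorDecomp σ τ) := by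
  have hkk : ∀ g h, σ.mat (g * h) ⊗ₖ τ.mat (g * h) =
      (σ.mat g ⊗ₖ τ.mat g) * (σ.mat h ⊗ₖ τ.mat h) := fun g h => by
    rw [Irrep.mat_mul, Irrep.mat_mul, Matrix.mul_kronecker_mul]
  have hstar : ∀ (κ : Irrep G) g, (κ.mat g)ᴴ = κ.mat g⁻¹ := by
    intro κ g
    simp only [Irrep.mat, map_inv]
    rfl
  let E := (finProdFinEquiv : Fin σ.dim × Fin τ.dim ≃ _)
  obtain ⟨ι, _, comp, C, hC1, hC2, hC3, hC4⟩ := exists_decomp (σ.dim * τ.dim)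
    (fun g => (σ.mat g ⊗ₖ τ.mat g).submatrix E.symm E.symm)
    (by
      have : ∀ κ : Irrep G, κ.mat 1 = 1 := fun κ => by simp only [Irrep.mat, map_one]; rfl
      rw [this, this, Matrix.one_kronecker_one, Matrix.submatrix_one_equiv])
    (fun g h => by rw [hkk, Matrix.submatrix_mul_equiv])
    (fun g => by
      rw [Matrix.conjTranspose_submatrix, Matrix.conjTranspose_kronecker, hstar, hstar])
    (continuous_matrix fun i j =>
      (σ.continuous_mat_apply _ _).mul (τ.continuous_mat_apply _ _))
  let F := (Fintype.equivFin ι).symm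
  let U : Matrix (Σ r, Fin (comp (F r)).dim) (Fin σ.dim × Fin τ.dim) ℂ :=
    Matrix.of fun q i => star (C (F q.1) (E i) q.2)
  have hUU : U * Uᴴ = 1 := by
    ext ⟨r, m⟩ ⟨s, m'⟩
    have : (U * Uᴴ) ⟨r, m⟩ ⟨s, m'⟩ = ((C (F r))ᴴ * C (F s)) m m' := by
      simp only [Matrix.mul_apply, Matrix.conjTranspose_apply, U, Matrix.of_apply, star_star]
      exact Fintype.sum_equiv E _ _ fun _ => rfl
    rw [this]
    by_cases h : r = s
    · subst h
      rw [hC1]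
      simp [Matrix.one_apply]
    · rw [hC2 _ _ fun h' => h (F.injective h')]
      simp [h]
  have hUU' : Uᴴ * U = 1 := by
    ext i j
    have : (Uᴴ * U) i j = (∑ r, C r * (C r)ᴴ) (E i) (E j) := by
      rw [← F.sum_comp]
      simp only [Matrix.mul_apply, Matrix.conjTranspose_apply, U, Matrix.of_apply, star_star,
        Fintype.sum_sigma, Matrix.sum_apply]
    rw [this, hC3]
    simp [Matrix.one_apply]
  refine ⟨⟨_, fun r => comp (F r), U, hUU, hUU', fun g => ?_⟩⟩
  have hV : (σ.mat g ⊗ₖ τ.mat g) * Uᴴ =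
      Uᴴ * Matrix.blockDiagonal' (fun r => (comp (F r)).mat g) := by
    ext i ⟨r, m⟩
    have h := congrFun (congrFun (hC4 g (F r)) (E i)) m
    simp only [Matrix.mul_apply, Matrix.submatrix_apply, Equiv.symm_apply_apply] at h
    simp only [Matrix.mul_apply, Matrix.conjTranspose_apply, U, Matrix.of_apply, star_star,
      Fintype.sum_sigma]
    rw [Finset.sum_eq_single r]
    · simp only [Matrix.blockDiagonal'_apply_eq]
      rw [← h]
      exact Fintype.sum_equiv E _ _ fun _ => by simp
    · intro s _ hs
      exact Finset.sum_eq_zero fun k _ => by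
        rw [Matrix.blockDiagonal'_apply_ne _ _ _ hs, mul_zero]
    · simp
  calc U * (σ.mat g ⊗ₖ τ.mat g) = U * ((σ.mat g ⊗ₖ τ.mat g) * Uᴴ) * U := by
        rw [Matrix.mul_assoc, Matrix.mul_assoc, hUU', Matrix.mul_one]
    _ = Matrix.blockDiagonal' (fun r => (comp (F r)).mat g) * U := by
        rw [hV, ← Matrix.mul_assoc, hUU, Matrix.one_mul]

/-! ### C*-dynamical systems -/

/-- An action of `G` on the unital C*-algebra `A` by *-automorphisms,
such that `(g, x) ↦ α_g(x)` is continuous. -/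
structure CStarSystem (G A : Type*) [Group G] [TopologicalSpace G] [CStarAlgebra A] where
  act : G →* (A ≃⋆ₐ[ℂ] A)
  continuous_act : Continuous fun q : G × A => act q.1 q.2

namespace CStarSystem

variable {G A : Type*} [Group G] [TopologicalSpace G] [CStarAlgebra A] (α : CStarSystem G A)

lemma continuous_act_apply (x : A) : Continuous fun g => α.act g x :=
  α.continuous_act.comp (continuous_id.prodMk continuous_const)

lemma continuous_act_right (g : G) : Continuous fun x => α.act g x :=
  α.continuous_act.comp (continuous_const.prodMk continuous_id)

lemma integral_act [MeasurableSpace G] {μ : MeasureTheory.Measure G} (f : G → A)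
    (hf : MeasureTheory.Integrable f μ) (g : G) :
    ∫ h, α.act g (f h) ∂μ = α.act g (∫ h, f h ∂μ) :=
  ContinuousLinearMap.integral_comp_comm
    ({ toFun := α.act g
       map_add' := map_add _
       map_smul' := fun c y => map_smul (α.act g) c y
       cont := α.continuous_act_right g } : A →L[ℂ] A) hf

/-- The fixed point algebra `B = A^G`. -/
def fixedAlg : StarSubalgebra ℂ A where
  carrier := {x | ∀ g, α.act g x = x}
  mul_mem' hx hy g := by rw [map_mul, hx g, hy g]
  one_mem' g := map_one _
  add_mem' hx hy g := by rw [map_add, hx g, hy g]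
  zero_mem' g := map_zero _
  algebraMap_mem' r g := by
    rw [Algebra.algebraMap_eq_smul_one, map_smul, map_one]
  star_mem' hx g := by rw [map_star, hx g]

lemma mem_fixedAlg {x : A} : x ∈ α.fixedAlg ↔ ∀ g, α.act g x = x := Iff.rfl

instance isClosed_fixedAlg : IsClosed (α.fixedAlg : Set A) := by
  have : (α.fixedAlg : Set A) = ⋂ g, {x | α.act g x = x} := by
    ext x; simp [mem_fixedAlg]
  rw [this]
  exact isClosed_iInter fun g => isClosed_eq (α.continuous_act_right g) continuous_id

/-- The system is free: the Ellwood map `x ⊗ y ↦ (g ↦ x α_g(y))` from `A ⊗_alg A` to `C(G, A)`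
has dense range. -/
def IsFree [CompactSpace G] : Prop :=
  Dense (Submodule.span ℂ (Set.range fun q : A × A =>
    (⟨fun g => q.1 * α.act g q.2, continuous_const.mul (α.continuous_act_apply q.2)⟩ :
      C(G, A))) : Set C(G, A))

end CStarSystem

/-- Complex matrices as matrices with entries in `A`, i.e. `X ↦ 1 ⊗ X`. -/
def scalarMat (A : Type*) [CStarAlgebra A] {I J : Type*} (X : Matrix I J ℂ) : Matrix I J A :=
  X.map (algebraMap ℂ A)

/-- Equivariant isometries `s(σ) ∈ A ⊗ Hom(V_σ, H_σ)`, one for each class `σ`, where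
`H_σ = ℂ ^ mult σ`. They satisfy `α_g(s(σ)) = s(σ) (1 ⊗ σ_g)`, and for the trivial class
`H_1 = ℂ` and `s(1) = 1`. -/
structure IsometryFamily {G A : Type*} [Group G] [TopologicalSpace G] [CStarAlgebra A]
    (α : CStarSystem G A) where
  mult : Irrep G → ℕ
  s : ∀ σ : Irrep G, Matrix (Fin (mult σ)) (Fin σ.dim) A
  isometry : ∀ σ, (s σ)ᴴ * s σ = 1
  equivariant : ∀ σ g, (s σ).map (α.act g) = s σ * scalarMat A (σ.mat g)
  mult_trivial : mult (Irrep.trivial G) = 1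
  s_trivial : ∀ a i, s (Irrep.trivial G) a i = 1

/-! ### Auxiliary computations with matrices over `A` -/

section Aux

variable {G A : Type*} [Group G] [TopologicalSpace G] [CStarAlgebra A]

lemma scalarMat_mul {I J K : Type*} [Fintype J] (X : Matrix I J ℂ) (Y : Matrix J K ℂ) :
    scalarMat A (X * Y) = scalarMat A X * scalarMat A Y := by
  simp [scalarMat, Matrix.map_mul]

lemma scalarMat_one {I : Type*} [DecidableEq I] : scalarMat A (1 : Matrix I I ℂ) = 1 := by
  simp [scalarMat]

lemma scalarMat_conjTranspose {I J : Type*} (X : Matrix I J ℂ) :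
    scalarMat A Xᴴ = (scalarMat A X)ᴴ := by
  ext i j
  simpa [scalarMat] using algebraMap_star_comm (A := A) (X j i)

lemma scalarMat_map_act (α : CStarSystem G A) (g : G) {I J : Type*} (X : Matrix I J ℂ) :
    (scalarMat A X).map (α.act g) = scalarMat A X := by
  ext i j
  simp [scalarMat, Algebra.algebraMap_eq_smul_one]

lemma map_act_mul (α : CStarSystem G A) (g : G) {I J K : Type*} [Fintype J] (X : Matrix I J A)
    (Y : Matrix J K A) : (X * Y).map (α.act g) = X.map (α.act g) * Y.map (α.act g) := by
  ext i j
  simp [Matrix.mul_apply, map_sum]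

lemma map_act_conjTranspose (α : CStarSystem G A) (g : G) {I J : Type*} (X : Matrix I J A) :
    Xᴴ.map (α.act g) = (X.map (α.act g))ᴴ := by
  ext i j
  simp [map_star]

lemma mul_kronecker_one {I J K L : Type*} [Fintype J] [Fintype L] [DecidableEq L]
    (X : Matrix I J A) (Y : Matrix J K A) :
    (X * Y) ⊗ₖ (1 : Matrix L L A) = (X ⊗ₖ (1 : Matrix L L A)) * (Y ⊗ₖ (1 : Matrix L L A)) := by
  ext ⟨i, l⟩ ⟨k, l'⟩
  simp [Matrix.mul_apply, Fintype.sum_prod_type, Matrix.one_apply]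

lemma one_kronecker_mul {I J K L : Type*} [Fintype J] [Fintype L] [DecidableEq L]
    (X : Matrix I J A) (Y : Matrix J K A) :
    (1 : Matrix L L A) ⊗ₖ (X * Y) = ((1 : Matrix L L A) ⊗ₖ X) * ((1 : Matrix L L A) ⊗ₖ Y) := by
  ext ⟨l, i⟩ ⟨l', k⟩
  simp [Matrix.mul_apply, Fintype.sum_prod_type, Matrix.one_apply]

lemma kronecker_scalarMat_comm {I J K L : Type*} [Fintype I] [Fintype J] [Fintype K] [Fintype L]
    [DecidableEq I] [DecidableEq J] [DecidableEq K] [DecidableEq L]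
    (X : Matrix I J A) (Y : Matrix K L ℂ) :
    (X ⊗ₖ (1 : Matrix K K A)) * ((1 : Matrix J J A) ⊗ₖ scalarMat A Y) =
      ((1 : Matrix I I A) ⊗ₖ scalarMat A Y) * (X ⊗ₖ (1 : Matrix L L A)) := by
  ext ⟨i, k⟩ ⟨j, l⟩
  simp [Matrix.mul_apply, Fintype.sum_prod_type, Matrix.one_apply, scalarMat,
    Algebra.commutes (Y k l)]

end Aux

/-! ### The factor system -/

namespace IsometryFamily

variable {G A : Type*} [Group G] [TopologicalSpace G] [CStarAlgebra A] {α : CStarSystem G A}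
  (S : IsometryFamily α)

lemma equivariant_conjTranspose (σ : Irrep G) (g : G) :
    (S.s σ)ᴴ.map (α.act g) = scalarMat A (σ.mat g)ᴴ * (S.s σ)ᴴ := by
  rw [map_act_conjTranspose, S.equivariant, Matrix.conjTranspose_mul, scalarMat_conjTranspose]

/-- `s(σ) (b ⊗ 1) s(σ)*`, as a matrix over `A`. -/
def coactionMat (σ : Irrep G) (b : A) : Matrix (Fin (S.mult σ)) (Fin (S.mult σ)) A :=
  S.s σ * (Matrix.diagonal (fun _ => b) : Matrix (Fin σ.dim) (Fin σ.dim) A) * (S.s σ)ᴴ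

lemma coactionMat_mem (σ : Irrep G) {b : A} (hb : b ∈ α.fixedAlg) (a c : Fin (S.mult σ)) :
    S.coactionMat σ b a c ∈ α.fixedAlg := by
  intro g
  have hd : (Matrix.diagonal fun _ : Fin σ.dim => b).map (α.act g) =
      Matrix.diagonal fun _ => b := by
    ext i j
    by_cases h : i = j
    · subst h; simpa using hb g
    · simp [h]
  have hc : scalarMat A (σ.mat g) *
        (Matrix.diagonal (fun _ => b) : Matrix (Fin σ.dim) (Fin σ.dim) A) =
      (Matrix.diagonal (fun _ => b) : Matrix (Fin σ.dim) (Fin σ.dim) A) *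
        scalarMat A (σ.mat g) := by
    ext i j
    simp [scalarMat, Algebra.commutes (σ.mat g i j) b]
  have key : (S.coactionMat σ b).map (α.act g) = S.coactionMat σ b := by
    rw [coactionMat, map_act_mul, map_act_mul, S.equivariant, S.equivariant_conjTranspose, hd,
      Matrix.mul_assoc (S.s σ), hc, Matrix.mul_assoc, Matrix.mul_assoc,
      ← Matrix.mul_assoc (scalarMat A (σ.mat g)), ← scalarMat_mul, σ.mat_mul_conjTranspose,
      scalarMat_one, Matrix.one_mul, Matrix.mul_assoc]
  simpa using congrFun (congrFun key a) c

/-- The coaction `γ_σ : B → B ⊗ End(H_σ)`, `γ_σ(b) = s(σ) (b ⊗ 1) s(σ)*`. -/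
def coaction (σ : Irrep G) (b : α.fixedAlg) :
    Matrix (Fin (S.mult σ)) (Fin (S.mult σ)) α.fixedAlg :=
  Matrix.of fun a c => ⟨S.coactionMat σ b a c, S.coactionMat_mem σ b.2 a c⟩

/-- The projection `p(σ) = s(σ) s(σ)* = γ_σ(1) ∈ B ⊗ End(H_σ)`. -/
def proj (σ : Irrep G) : Matrix (Fin (S.mult σ)) (Fin (S.mult σ)) α.fixedAlg :=
  S.coaction σ 1

/-- The isometry `s(σ ⊗ τ) ∈ A ⊗ Hom(V_σ ⊗ V_τ, H_{σ ⊗ τ})` obtained by summing up the isometries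
`s(κ r)` along a decomposition `σ ⊗ τ = ⨁ᵣ κ r`, where `H_{σ ⊗ τ} = ⨁ᵣ H_{κ r}`. -/
def sTensor {σ τ : Irrep G} (δ : TensorDecomp σ τ) :
    Matrix (Σ r, Fin (S.mult (δ.comp r))) (Fin σ.dim × Fin τ.dim) A :=
  Matrix.blockDiagonal' (fun r => S.s (δ.comp r)) * scalarMat A δ.U

/-- `s(σ ⊗ τ) s(σ)* s(τ)*`, as a matrix over `A`; here `s(σ)*` and `s(τ)*` are amplified so as to
act trivially on `V_τ` and `H_σ`, respectively. -/
def cocycleMat {σ τ : Irrep G} (δ : TensorDecomp σ τ) :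
    Matrix (Σ r, Fin (S.mult (δ.comp r))) (Fin (S.mult σ) × Fin (S.mult τ)) A :=
  S.sTensor δ * ((S.s σ)ᴴ ⊗ₖ (1 : Matrix (Fin τ.dim) (Fin τ.dim) A)) *
    ((1 : Matrix (Fin (S.mult σ)) (Fin (S.mult σ)) A) ⊗ₖ (S.s τ)ᴴ)

lemma sTensor_equivariant {σ τ : Irrep G} (δ : TensorDecomp σ τ) (g : G) :
    (S.sTensor δ).map (α.act g) = S.sTensor δ *
      ((scalarMat A (σ.mat g) ⊗ₖ (1 : Matrix (Fin τ.dim) (Fin τ.dim) A)) *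
        ((1 : Matrix (Fin σ.dim) (Fin σ.dim) A) ⊗ₖ scalarMat A (τ.mat g))) := by
  have h1 : (Matrix.blockDiagonal' fun r => S.s (δ.comp r)).map (α.act g) =
      (Matrix.blockDiagonal' fun r => S.s (δ.comp r)) *
        scalarMat A (Matrix.blockDiagonal' fun r => (δ.comp r).mat g) := by
    rw [scalarMat, Matrix.blockDiagonal'_map _ _ (map_zero _),
      Matrix.blockDiagonal'_map _ _ (map_zero _), ← Matrix.blockDiagonal'_mul]
    congr 1
    funext r
    exact S.equivariant _ g
  have h2 : (scalarMat A (σ.mat g) ⊗ₖ (1 : Matrix (Fin τ.dim) (Fin τ.dim) A)) *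
        ((1 : Matrix (Fin σ.dim) (Fin σ.dim) A) ⊗ₖ scalarMat A (τ.mat g)) =
      scalarMat A (σ.mat g ⊗ₖ τ.mat g) := by
    ext ⟨i, j⟩ ⟨i', j'⟩
    simp [Matrix.mul_apply, Fintype.sum_prod_type, Matrix.one_apply, scalarMat]
  rw [h2, sTensor, map_act_mul, scalarMat_map_act, h1, Matrix.mul_assoc, Matrix.mul_assoc,
    ← scalarMat_mul, ← scalarMat_mul, δ.intertwines]

lemma cocycleMat_mem {σ τ : Irrep G} (δ : TensorDecomp σ τ)
    (a : Σ r, Fin (S.mult (δ.comp r))) (c : Fin (S.mult σ) × Fin (S.mult τ)) :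
    S.cocycleMat δ a c ∈ α.fixedAlg := by
  intro g
  have k1 : ((S.s σ)ᴴ ⊗ₖ (1 : Matrix (Fin τ.dim) (Fin τ.dim) A)).map (α.act g) =
      ((S.s σ)ᴴ.map (α.act g)) ⊗ₖ (1 : Matrix (Fin τ.dim) (Fin τ.dim) A) := by
    ext ⟨i, j⟩ ⟨i', j'⟩
    by_cases h : j = j' <;> simp [h]
  have k2 : ((1 : Matrix (Fin (S.mult σ)) (Fin (S.mult σ)) A) ⊗ₖ (S.s τ)ᴴ).map (α.act g) =
      (1 : Matrix (Fin (S.mult σ)) (Fin (S.mult σ)) A) ⊗ₖ ((S.s τ)ᴴ.map (α.act g)) := by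
    ext ⟨i, j⟩ ⟨i', j'⟩
    by_cases h : i = i' <;> simp [h]
  have u1 : (scalarMat A (σ.mat g) ⊗ₖ (1 : Matrix (Fin τ.dim) (Fin τ.dim) A)) *
      (scalarMat A (σ.mat g)ᴴ ⊗ₖ (1 : Matrix (Fin τ.dim) (Fin τ.dim) A)) = 1 := by
    rw [← mul_kronecker_one, ← scalarMat_mul, σ.mat_mul_conjTranspose, scalarMat_one]
    exact Matrix.kroneckerMap_one_one _ (by simp) (by simp) (by simp)
  have u2 : ((1 : Matrix (Fin σ.dim) (Fin σ.dim) A) ⊗ₖ scalarMat A (τ.mat g)) *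
      ((1 : Matrix (Fin σ.dim) (Fin σ.dim) A) ⊗ₖ scalarMat A (τ.mat g)ᴴ) = 1 := by
    rw [← one_kronecker_mul, ← scalarMat_mul, τ.mat_mul_conjTranspose, scalarMat_one]
    exact Matrix.kroneckerMap_one_one _ (by simp) (by simp) (by simp)
  have c1 : ((1 : Matrix (Fin σ.dim) (Fin σ.dim) A) ⊗ₖ scalarMat A (τ.mat g)) *
      (scalarMat A (σ.mat g)ᴴ ⊗ₖ (1 : Matrix (Fin τ.dim) (Fin τ.dim) A)) =
      (scalarMat A (σ.mat g)ᴴ ⊗ₖ (1 : Matrix (Fin τ.dim) (Fin τ.dim) A)) *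
        ((1 : Matrix (Fin σ.dim) (Fin σ.dim) A) ⊗ₖ scalarMat A (τ.mat g)) :=
    (kronecker_scalarMat_comm _ _).symm
  have key : (S.cocycleMat δ).map (α.act g) = S.cocycleMat δ := by
    rw [cocycleMat, map_act_mul, map_act_mul, S.sTensor_equivariant, k1, k2,
      S.equivariant_conjTranspose, S.equivariant_conjTranspose, mul_kronecker_one,
      one_kronecker_mul]
    have c2 := kronecker_scalarMat_comm (S.s σ)ᴴ (τ.mat g)ᴴ
    generalize (S.s σ)ᴴ ⊗ₖ (1 : Matrix (Fin τ.dim) (Fin τ.dim) A) = R at c2 ⊢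
    generalize scalarMat A (σ.mat g) ⊗ₖ (1 : Matrix (Fin τ.dim) (Fin τ.dim) A) = P at u1 ⊢
    generalize scalarMat A (σ.mat g)ᴴ ⊗ₖ (1 : Matrix (Fin τ.dim) (Fin τ.dim) A) = P'
      at u1 c1 ⊢
    generalize (1 : Matrix (Fin σ.dim) (Fin σ.dim) A) ⊗ₖ scalarMat A (τ.mat g) = Q at u2 c1 ⊢
    generalize (1 : Matrix (Fin σ.dim) (Fin σ.dim) A) ⊗ₖ scalarMat A (τ.mat g)ᴴ = Q'
      at u2 c2 ⊢
    generalize (1 : Matrix (Fin (S.mult σ)) (Fin (S.mult σ)) A) ⊗ₖ scalarMat A (τ.mat g)ᴴ = W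
      at c2 ⊢
    generalize (1 : Matrix (Fin (S.mult σ)) (Fin (S.mult σ)) A) ⊗ₖ (S.s τ)ᴴ = V
    calc S.sTensor δ * (P * Q) * (P' * R) * (W * V)
        = S.sTensor δ * (P * (Q * P') * (R * W)) * V := by simp only [Matrix.mul_assoc]
      _ = S.sTensor δ * ((P * P') * (Q * Q') * R) * V := by
          rw [c1, c2]
          simp only [Matrix.mul_assoc]
      _ = S.sTensor δ * R * V := by rw [u1, u2, Matrix.one_mul, Matrix.one_mul]
  simpa using congrFun (congrFun key a) c

/-- The cocycle `ω(σ, τ) = s(σ ⊗ τ) s(σ)* s(τ)* ∈ B ⊗ Hom(H_σ ⊗ H_τ, H_{σ ⊗ τ})`. -/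
def cocycle {σ τ : Irrep G} (δ : TensorDecomp σ τ) :
    Matrix (Σ r, Fin (S.mult (δ.comp r))) (Fin (S.mult σ) × Fin (S.mult τ)) α.fixedAlg :=
  Matrix.of fun a c => ⟨S.cocycleMat δ a c, S.cocycleMat_mem δ a c⟩

/-- The element `a_σ(x) = Φ_σ(s(σ)* x)` of the `σ̄`-isotypic component of `A`, for
`x = ∑ x_{ai} ⊗ e_a ⊗ ē_i ∈ B ⊗ H_σ ⊗ V̄_σ`. Here `Φ_σ` is the map
`a ⊗ v ⊗ w̄ ↦ ⟨w, v⟩ a`. -/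
def isotypicElem (σ : Irrep G) (x : Matrix (Fin (S.mult σ)) (Fin σ.dim) α.fixedAlg) : A :=
  ∑ i, ∑ a, (S.s σ)ᴴ i a * (x a i : A)

/-- `A_0`, spanned by the elements `a_σ(x)` with `x ∈ B_0 ⊗ H_σ ⊗ V̄_σ`. (For a direct sum
`σ = σ_1 ⊕ ⋯ ⊕ σ_n` of irreducible representations, the elements `a_σ(x)` are precisely the sums
of elements `a_{σ_k}(x_k)`.) -/
def smoothAlg (B₀ : StarSubalgebra ℂ α.fixedAlg) : Submodule ℂ A :=
  Submodule.span ℂ {y | ∃ (σ : Irrep G) (x : Matrix (Fin (S.mult σ)) (Fin σ.dim) α.fixedAlg),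
    (∀ a i, x a i ∈ B₀) ∧ y = S.isotypicElem σ x}

end IsometryFamily

/-! ### The representation `π_s(x) = s j_α(x) s*` in matrix form -/

/-- The Haar probability measure of a compact group. -/
def haarProb (G : Type*) [Group G] [TopologicalSpace G] [IsTopologicalGroup G] [CompactSpace G]
    [MeasurableSpace G] [BorelSpace G] : MeasureTheory.Measure G :=
  MeasureTheory.Measure.haarMeasure ⊤

section Haar

variable {G : Type*} [Group G] [TopologicalSpace G] [IsTopologicalGroup G] [CompactSpace G]
  [MeasurableSpace G] [BorelSpace G]

instance : MeasureTheory.IsProbabilityMeasure (haarProb G) :=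
  ⟨by simpa [haarProb] using
    MeasureTheory.Measure.haarMeasure_self (K₀ := (⊤ : TopologicalSpace.PositiveCompacts G))⟩

instance : (haarProb G).IsHaarMeasure := by unfold haarProb; infer_instance

instance : (haarProb G).Regular := by unfold haarProb; infer_instance

instance : (haarProb G).IsMulRightInvariant where
  map_mul_right_eq_self g := by
    have hconj := (MonoidHom.measurePreserving (μ := haarProb G) (ν := haarProb G)
      (f := (MulAut.conj g⁻¹).toMonoidHom)
      (show Continuous fun h => g⁻¹ * h * g⁻¹⁻¹ by fun_prop)
      (MulAut.conj g⁻¹).surjective rfl).map_eq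
    have hleft := MeasureTheory.map_mul_left_eq_self (haarProb G) g
    have hc : Continuous fun h : G => (MulAut.conj g⁻¹).toMonoidHom h :=
      show Continuous fun h => g⁻¹ * h * g⁻¹⁻¹ by fun_prop
    calc MeasureTheory.Measure.map (· * g) (haarProb G)
        = MeasureTheory.Measure.map (g * ·) (MeasureTheory.Measure.map
            (fun h => (MulAut.conj g⁻¹).toMonoidHom h) (haarProb G)) := by
          rw [MeasureTheory.Measure.map_map (continuous_const_mul g).measurable hc.measurable]
          congr 1
          funext h
          simp [mul_assoc]
      _ = haarProb G := by rw [hconj, hleft]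

end Haar

namespace IsometryFamily

variable {G A : Type*} [Group G] [TopologicalSpace G] [IsTopologicalGroup G] [CompactSpace G]
  [MeasurableSpace G] [BorelSpace G] [CStarAlgebra A] {α : CStarSystem G A}

/-- The part of the operator `j_α(x)` on `L²(G)` with coefficients in `A` (multiplication by the
function `h ↦ α_{h⁻¹}(x)`) that maps `V_τ ⊗ ē_j` to `V_κ ⊗ ē_l`, with respect to the
orthonormal basis `Irrep.coeff` of `L²(G)`. -/
def multBlock (α : CStarSystem G A) (x : A) (κ : Irrep G) (l : Fin κ.dim) (τ : Irrep G)
    (j : Fin τ.dim) : Matrix (Fin κ.dim) (Fin τ.dim) A :=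
  Matrix.of fun k i =>
    ∫ h, (star (κ.coeff k l h) * τ.coeff i j h) • α.act h⁻¹ x ∂(haarProb G)

variable (S : IsometryFamily α)

/-- The part of `π_s(x) = s j_α(x) s*`, where `s = ⨁ s(σ) ⊗ 1`, that maps `H_τ ⊗ ē_j` to
`H_κ ⊗ ē_l`, as a matrix over `A`. -/
def repBlockMat (x : A) (κ : Irrep G) (l : Fin κ.dim) (τ : Irrep G) (j : Fin τ.dim) :
    Matrix (Fin (S.mult κ)) (Fin (S.mult τ)) A :=
  S.s κ * multBlock α x κ l τ j * (S.s τ)ᴴ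

lemma integrable_multBlock (α : CStarSystem G A) (x : A) (κ : Irrep G) (k l : Fin κ.dim)
    (τ : Irrep G) (i j : Fin τ.dim) :
    MeasureTheory.Integrable (fun h => (star (κ.coeff k l h) * τ.coeff i j h) • α.act h⁻¹ x)
      (haarProb G) :=
  Continuous.integrable_of_hasCompactSupport
    (((κ.continuous_coeff k l).star.mul (τ.continuous_coeff i j)).smul
      ((α.continuous_act_apply x).comp continuous_inv)) (HasCompactSupport.of_compactSpace _)

lemma multBlock_map_act (α : CStarSystem G A) (x : A) (κ : Irrep G) (l : Fin κ.dim) (τ : Irrep G)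
    (j : Fin τ.dim) (g : G) :
    (multBlock α x κ l τ j).map (α.act g) =
      scalarMat A (κ.mat g)ᴴ * multBlock α x κ l τ j * scalarMat A (τ.mat g) := by
  have h2 : ∀ k i h, (star (κ.coeff k l (h * g)) * τ.coeff i j (h * g)) •
      α.act (g * (h * g)⁻¹) x = ∑ i', ∑ k', (star (κ.mat g k' k) * τ.mat g i' i) •
        ((star (κ.coeff k' l h) * τ.coeff i' j h) • α.act h⁻¹ x) := by
    intro k i h
    rw [Irrep.coeff_mul, Irrep.coeff_mul, mul_inv_rev, mul_inv_cancel_left, star_sum,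
      Finset.sum_mul_sum, Finset.sum_comm, Finset.sum_smul]
    refine Finset.sum_congr rfl fun i' _ => ?_
    rw [Finset.sum_smul]
    refine Finset.sum_congr rfl fun k' _ => ?_
    rw [smul_smul, star_mul']
    congr 1
    ring
  have hint : ∀ k i k' i', MeasureTheory.Integrable (fun h =>
      (star (κ.mat g k' k) * τ.mat g i' i) •
        ((star (κ.coeff k' l h) * τ.coeff i' j h) • α.act h⁻¹ x)) (haarProb G) :=
    fun k i k' i' => MeasureTheory.Integrable.fun_smul (star (κ.mat g k' k) * τ.mat g i' i)
      (integrable_multBlock α x κ k' l τ i' j)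
  have h3 : ∀ k i, α.act g (multBlock α x κ l τ j k i) = ∑ i', ∑ k',
      (star (κ.mat g k' k) * τ.mat g i' i) • multBlock α x κ l τ j k' i' := by
    intro k i
    calc α.act g (multBlock α x κ l τ j k i)
        = ∫ h, α.act g ((star (κ.coeff k l h) * τ.coeff i j h) • α.act h⁻¹ x) ∂(haarProb G) :=
          (α.integral_act _ (integrable_multBlock α x κ k l τ i j) g).symm
      _ = ∫ h, (star (κ.coeff k l h) * τ.coeff i j h) • α.act (g * h⁻¹) x ∂(haarProb G) := by
          simp only [map_smul, map_mul, StarAlgEquiv.mul_apply]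
      _ = ∫ h, (star (κ.coeff k l (h * g)) * τ.coeff i j (h * g)) •
            α.act (g * (h * g)⁻¹) x ∂(haarProb G) :=
          (MeasureTheory.integral_mul_right_eq_self (fun h =>
            (star (κ.coeff k l h) * τ.coeff i j h) • α.act (g * h⁻¹) x) g).symm
      _ = ∑ i', ∑ k', (star (κ.mat g k' k) * τ.mat g i' i) • multBlock α x κ l τ j k' i' := by
          simp only [h2]
          rw [MeasureTheory.integral_finsetSum _ fun i' _ =>
            MeasureTheory.integrable_finsetSum _ fun k' _ => hint k i k' i']
          refine Finset.sum_congr rfl fun i' _ => ?_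
          rw [MeasureTheory.integral_finsetSum _ fun k' _ => hint k i k' i']
          refine Finset.sum_congr rfl fun k' _ => ?_
          rw [MeasureTheory.integral_smul, multBlock, Matrix.of_apply]
  generalize multBlock α x κ l τ j = M at h3 ⊢
  ext k i
  rw [Matrix.map_apply, h3]
  simp only [Matrix.mul_apply, Finset.sum_mul]
  refine Finset.sum_congr rfl fun i' _ => Finset.sum_congr rfl fun k' _ => ?_
  simp only [scalarMat, Matrix.map_apply, Matrix.conjTranspose_apply]
  rw [← Algebra.commutes, ← Algebra.smul_def, ← Algebra.smul_def, smul_smul, mul_comm]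

lemma repBlockMat_mem (x : A) (κ : Irrep G) (l : Fin κ.dim) (τ : Irrep G) (j : Fin τ.dim)
    (a : Fin (S.mult κ)) (c : Fin (S.mult τ)) : S.repBlockMat x κ l τ j a c ∈ α.fixedAlg := by
  intro g
  have key : (S.repBlockMat x κ l τ j).map (α.act g) = S.repBlockMat x κ l τ j := by
    rw [repBlockMat, map_act_mul, map_act_mul, S.equivariant, S.equivariant_conjTranspose,
      multBlock_map_act]
    calc S.s κ * scalarMat A (κ.mat g) *
          (scalarMat A (κ.mat g)ᴴ * multBlock α x κ l τ j * scalarMat A (τ.mat g)) *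
          (scalarMat A (τ.mat g)ᴴ * (S.s τ)ᴴ)
        = S.s κ * (scalarMat A (κ.mat g) * scalarMat A (κ.mat g)ᴴ) * multBlock α x κ l τ j *
          ((scalarMat A (τ.mat g) * scalarMat A (τ.mat g)ᴴ) * (S.s τ)ᴴ) := by
          simp only [Matrix.mul_assoc]
      _ = S.s κ * multBlock α x κ l τ j * (S.s τ)ᴴ := by
          rw [← scalarMat_mul, ← scalarMat_mul, κ.mat_mul_conjTranspose, τ.mat_mul_conjTranspose,
            scalarMat_one, scalarMat_one, Matrix.mul_one, Matrix.one_mul]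
  simpa using congrFun (congrFun key a) c

/-- The part of `π_s(x)` that maps `H_τ ⊗ ē_j` to `H_κ ⊗ ē_l`; its entries lie in `B`. -/
def repBlock (x : A) (κ : Irrep G) (l : Fin κ.dim) (τ : Irrep G) (j : Fin τ.dim) :
    Matrix (Fin (S.mult κ)) (Fin (S.mult τ)) α.fixedAlg :=
  Matrix.of fun a c => ⟨S.repBlockMat x κ l τ j a c, S.repBlockMat_mem x κ l τ j a c⟩

end IsometryFamily

/-! ### Unbounded operators -/

section Operators

variable {E F : Type*} [NormedAddCommGroup E] [InnerProductSpace ℂ E]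
  [NormedAddCommGroup F] [InnerProductSpace ℂ F]

/-- `D` has compact resolvent: `(D - z)⁻¹` exists and is compact for some `z`. -/
def HasCompactResolvent (D : E →ₗ.[ℂ] E) : Prop :=
  ∃ (z : ℂ) (R : E →L[ℂ] E), IsCompactOperator R ∧
    (∀ y, ∃ h : R y ∈ D.domain, D ⟨R y, h⟩ - z • R y = y) ∧
    ∀ ξ : D.domain, R (D ξ - z • (ξ : E)) = ξ

/-- The bounded operator `T` maps `dom D` into `dom D'`, and the commutator `D' T - T D` is bounded
on `dom D` with norm at most `C`. -/
def CommutatorBound (D : E →ₗ.[ℂ] E) (D' : F →ₗ.[ℂ] F) (T : E →L[ℂ] F) (C : ℝ) : Prop :=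
  ∀ ξ : D.domain, ∃ h : T ξ ∈ D'.domain, ‖D' ⟨T ξ, h⟩ - T (D ξ)‖ ≤ C * ‖(ξ : E)‖

/-- `T` preserves `dom D` and `[D, T]` is bounded. -/
def HasBoundedCommutator (D : E →ₗ.[ℂ] E) (T : E →L[ℂ] E) : Prop :=
  ∃ C : ℝ, CommutatorBound D D T C

/-- The operator `D ⊗ 1` on `E ⊗ ℂ^I`, with domain `dom(D) ⊗ ℂ^I`. -/
def ampl (D : E →ₗ.[ℂ] E) (I : Type*) [Fintype I] :
    PiLp 2 (fun _ : I => E) →ₗ.[ℂ] PiLp 2 (fun _ : I => E) where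
  domain :=
    { carrier := {ξ | ∀ i, ξ i ∈ D.domain}
      add_mem' := fun hx hy i => D.domain.add_mem (hx i) (hy i)
      zero_mem' := fun _ => D.domain.zero_mem
      smul_mem' := fun c _ hx i => D.domain.smul_mem c (hx i) }
  toFun :=
    { toFun := fun ξ => WithLp.toLp 2 fun i => D ⟨(ξ : PiLp 2 fun _ : I => E) i, ξ.2 i⟩
      map_add' := fun ξ η => by
        ext i
        exact D.map_add ⟨(ξ : PiLp 2 fun _ : I => E) i, ξ.2 i⟩
          ⟨(η : PiLp 2 fun _ : I => E) i, η.2 i⟩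
      map_smul' := fun c ξ => by
        ext i
        exact D.map_smul c ⟨(ξ : PiLp 2 fun _ : I => E) i, ξ.2 i⟩ }

/-- The compression `p D p` to the range of a projection `p`, with domain `dom(D) ∩ ran(p)`;
this domain is `p (dom D)` as soon as `p` preserves `dom D`. -/
def compress (D : E →ₗ.[ℂ] E) (p : E →L[ℂ] E) :
    LinearMap.range p.toLinearMap →ₗ.[ℂ] LinearMap.range p.toLinearMap where
  domain := D.domain.comap (LinearMap.range p.toLinearMap).subtype
  toFun :=
    { toFun := fun ξ => ⟨p (D ⟨(ξ : LinearMap.range p.toLinearMap), ξ.2⟩), ⟨_, rfl⟩⟩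
      map_add' := fun ξ η => by
        ext
        have := D.map_add ⟨((ξ : LinearMap.range p.toLinearMap) : E), ξ.2⟩
          ⟨((η : LinearMap.range p.toLinearMap) : E), η.2⟩
        exact (congrArg p this).trans (map_add p _ _)
      map_smul' := fun c ξ => by
        ext
        have := D.map_smul c ⟨((ξ : LinearMap.range p.toLinearMap) : E), ξ.2⟩
        exact (congrArg p this).trans (map_smul p _ _) }

lemma compress_domain_eq (D : E →ₗ.[ℂ] E) (p : E →L[ℂ] E) (hp : ∀ x, p (p x) = p x)
    (hD : ∀ x ∈ D.domain, p x ∈ D.domain) :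
    (compress D p).domain.map (LinearMap.range p.toLinearMap).subtype =
      D.domain.map p.toLinearMap := by
  ext x
  constructor
  · rintro ⟨⟨_, ⟨y, rfl⟩⟩, hy, rfl⟩
    exact ⟨p y, hy, hp y⟩
  · rintro ⟨y, hy, rfl⟩
    exact ⟨⟨p y, ⟨y, rfl⟩⟩, hD y hy, rfl⟩

/-- The Hilbert space direct sum of a family of unbounded operators. -/
def directSumOp {ι : Type*} {X : ι → Type*} [∀ i, NormedAddCommGroup (X i)]
    [∀ i, InnerProductSpace ℂ (X i)] (T : ∀ i, X i →ₗ.[ℂ] X i) :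
    lp X 2 →ₗ.[ℂ] lp X 2 where
  domain :=
    { carrier := {ζ | ∃ h : ∀ i, ζ i ∈ (T i).domain, Memℓp (fun i => T i ⟨ζ i, h i⟩) 2}
      add_mem' := by
        rintro ζ θ ⟨hζ, mζ⟩ ⟨hθ, mθ⟩
        refine ⟨fun i => (T i).domain.add_mem (hζ i) (hθ i), ?_⟩
        convert mζ.add mθ using 1
        funext i
        exact (T i).map_add ⟨ζ i, hζ i⟩ ⟨θ i, hθ i⟩
      zero_mem' := by
        refine ⟨fun i => (T i).domain.zero_mem, ?_⟩
        convert zero_memℓp (E := X) (p := 2) using 1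
        funext i
        exact (T i).map_zero
      smul_mem' := by
        rintro c ζ ⟨hζ, mζ⟩
        refine ⟨fun i => (T i).domain.smul_mem c (hζ i), ?_⟩
        convert mζ.const_smul c using 1
        funext i
        exact (T i).map_smul c ⟨ζ i, hζ i⟩ }
  toFun :=
    { toFun := fun ζ => ⟨fun i => T i ⟨(ζ : lp X 2) i, ζ.2.1 i⟩, ζ.2.2⟩
      map_add' := fun ζ θ => by
        ext i
        exact (T i).map_add ⟨(ζ : lp X 2) i, ζ.2.1 i⟩ ⟨(θ : lp X 2) i, θ.2.1 i⟩
      map_smul' := fun c ζ => by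
        ext i
        exact (T i).map_smul c ⟨(ζ : lp X 2) i, ζ.2.1 i⟩ }

/-- `(π ⊗ id)(M) : E ⊗ ℂ^J → E ⊗ ℂ^I` for `M ∈ B ⊗ Hom(ℂ^J, ℂ^I)`. -/
def matOp {B : Type*} (π : B → E →L[ℂ] E) {I J : Type*} [Fintype I] [Fintype J]
    (M : Matrix I J B) : PiLp 2 (fun _ : J => E) →L[ℂ] PiLp 2 (fun _ : I => E) :=
  (PiLp.continuousLinearEquiv 2 ℂ (fun _ : I => E)).symm.toContinuousLinearMap ∘L
    ContinuousLinearMap.pi fun i => ∑ j, π (M i j) ∘L PiLp.proj 2 (fun _ : J => E) j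

end Operators

/-! ### Spectral triples and the horizontal lift -/

/-- A spectral triple `(B_0, π, H, D)` on the unital C*-algebra `B`. -/
structure SpectralTriple (B H : Type*) [CStarAlgebra B] [NormedAddCommGroup H]
    [InnerProductSpace ℂ H] [CompleteSpace H] where
  alg : StarSubalgebra ℂ B
  dense_alg : Dense (alg : Set B)
  π : B →⋆ₐ[ℂ] (H →L[ℂ] H)
  faithful : Function.Injective π
  D : H →ₗ.[ℂ] H
  selfAdjoint : IsSelfAdjoint D
  compactResolvent : HasCompactResolvent D
  boundedCommutator : ∀ b ∈ alg, HasBoundedCommutator D (π b)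

section Lift

variable {G A H : Type*} [Group G] [TopologicalSpace G] [CStarAlgebra A]
  [NormedAddCommGroup H] [InnerProductSpace ℂ H] [CompleteSpace H]
  {α : CStarSystem G A} (S : IsometryFamily α) (𝒟 : SpectralTriple α.fixedAlg H)

/-- The Hilbert space `H_{p(σ)} = p(σ) (H_B ⊗ H_σ)`. -/
abbrev fiber (σ : Irrep G) : Submodule ℂ (PiLp 2 fun _ : Fin (S.mult σ) => H) :=
  LinearMap.range (matOp 𝒟.π (S.proj σ)).toLinearMap

/-- The Hilbert space `H_p = p (H_B ⊗ H) = ⨁_σ H_{p(σ)} ⊗ V̄_σ`; an orthonormal basis of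
`V̄_σ` splits the summand for `σ` into `dim σ` copies of `H_{p(σ)}`. -/
abbrev LiftSpace : Type _ :=
  lp (fun q : Σ σ : Irrep G, Fin σ.dim => fiber S 𝒟 q.1) 2

/-- The operator `D_σ = p(σ) (D_B ⊗ 1) p(σ)` on `H_{p(σ)}`. -/
def fiberDirac (σ : Irrep G) : fiber S 𝒟 σ →ₗ.[ℂ] fiber S 𝒟 σ :=
  compress (ampl 𝒟.D (Fin (S.mult σ))) (matOp 𝒟.π (S.proj σ))

/-- The horizontal lift `D_h = ⨁_σ D_σ ⊗ 1` on `H_p`. -/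
def horizontalDirac : LiftSpace S 𝒟 →ₗ.[ℂ] LiftSpace S 𝒟 :=
  directSumOp fun q : Σ σ : Irrep G, Fin σ.dim => fiberDirac S 𝒟 q.1

variable [IsTopologicalGroup G] [CompactSpace G] [MeasurableSpace G] [BorelSpace G]

open Classical in
/-- `T` is the operator `π_A(x) = (π_B ⊗ id)(π_s(x))` on `H_p`: its components with respect to
the decomposition of `H_p` are obtained by applying `π_B` to the entries of the components of
`π_s(x) = s j_α(x) s*`. -/
def IsLiftedOp (x : A) (T : LiftSpace S 𝒟 →L[ℂ] LiftSpace S 𝒟) : Prop :=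
  ∀ (q r : Σ σ : Irrep G, Fin σ.dim) (ξ : fiber S 𝒟 q.1),
    ((T (lp.single 2 q ξ) r : fiber S 𝒟 r.1) : PiLp 2 fun _ : Fin (S.mult r.1) => H) =
      matOp 𝒟.π (S.repBlock x r.1 r.2 q.1 q.2) ξ

/-- The operator `π_A(x)` is determined by its components. -/
lemma IsLiftedOp.unique {x : A} {T T' : LiftSpace S 𝒟 →L[ℂ] LiftSpace S 𝒟}
    (h : IsLiftedOp S 𝒟 x T) (h' : IsLiftedOp S 𝒟 x T') : T = T' := by
  classical
  refine lp.ext_continuousLinearMap ENNReal.ofNat_ne_top fun q => ?_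
  ext1 ξ
  apply lp.ext
  funext r
  exact Subtype.ext ((h q r ξ).trans (h' q r ξ).symm)

end Lift

end

end HorizontalLift

open HorizontalLift

/-! Bounded commutators of the horizontal lift with the generators of `A_0`.

By linearity it suffices to treat `x = s(σ)*_{ia} b` with `b ∈ B_0`. Since
`α_{h⁻¹}(x) = ∑ i', σ_h(i, i') s(σ)*_{ai'} b`, the operator `j_α(x)` is multiplication by matrix
coefficients of `σ`. Schur's orthogonality relations, which are derived from Schur's lemma and the
invariance of Haar measure (`Irrep.integral_star_coeff_mul_coeff`), and the decomposition
`σ ⊗ τ = ⨁ κ r` given by a unitary `U` then show (`IsometryFamily.repBlock_star_mul`) that the part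
of `π_A(x)` from the copy of `H_{p(τ)}` for `(τ, j)` to the copy of `H_{p(κ)}` for `(κ, l)` is
`∑ r, (dim τ / dim κ)^{1/2} star (U_{(r,l),(i,j)}) N_r`, summed over the `r` with `κ r = κ`. Here
`N = ω(σ, τ) (e_a ⊗ γ_τ(b))` is the matrix `IsometryFamily.shift`, and `N_r` consists of its rows
that belong to the `r`-th component.

The formal adjoint `T'` of `π_A(x)` is therefore a composition of two maps. The first one, `spread`,
has scalar coefficients `(dim τ / dim κ r)^{1/2} U_{(r,l),(i,j)}`, so that it commutes with `D_B` up
to the projections `p(κ)`, which `N*` absorbs; the second one acts on the summand for `(τ, j)` by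
`(π_B ⊗ id)(N*)`. The map `spread` is a contraction: its coefficients come from the inner products,
in `L²(G)`, of normalized coefficients with the functions
`star σ(i, i') f`, where `f` is a combination of coefficients of `κ`, and since
`∑ i', |σ_h(i, i')|² = 1` Bessel's inequality bounds their square sum by `‖f‖²`
(`sum_norm_sq_block_le`). The matrices `N*` are bounded by `‖b‖`, because `γ_τ` is a
*-homomorphism and `ω(σ, τ)` is a partial isometry, and their commutators with `D_B ⊗ 1` are bounded
uniformly in `τ` by the two hypotheses on suprema. Hence `T'` is a bounded operator and its
commutator with `D_h` is bounded (`commutatorBound_adjoint_liftedOp`).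

As each component of `T' ξ` is a finite sum, no convergence has to be discussed up to this point. The
passage to `π_A(x)`, the adjoint of `T'`, uses that `D_h` is self-adjoint: then the adjoint of an
operator with bounded commutator preserves the domain and has bounded commutator as well
(`CommutatorBound.adjoint`). Self-adjointness of `D_h` follows from that of `D_B`, because the
commutators `[D_B ⊗ 1, p(σ)]` are bounded (`SelfAdjointGraph.compress`). -/

namespace HorizontalLift

/-! ### Commutators with self-adjoint operators -/

section Commutators

open scoped InnerProductSpace

variable {E F K : Type*} [NormedAddCommGroup E] [InnerProductSpace ℂ E]
  [NormedAddCommGroup F] [InnerProductSpace ℂ F] [NormedAddCommGroup K] [InnerProductSpace ℂ K]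

/-- `D` coincides with its adjoint, in the sense of graphs: `(ξ, η)` lies in the graph of `D` if and
only if `⟪η, x⟫ = ⟪ξ, D x⟫` for all `x` in the domain. Unlike `IsSelfAdjoint D`, this makes sense
without completeness, and it involves no junk value for operators that are not densely defined. -/
structure SelfAdjointGraph (D : E →ₗ.[ℂ] E) : Prop where
  symm : ∀ x y : D.domain, ⟪D x, (y : E)⟫_ℂ = ⟪(x : E), D y⟫_ℂ
  maximal : ∀ ξ η : E, (∀ x : D.domain, ⟪η, (x : E)⟫_ℂ = ⟪ξ, D x⟫_ℂ) →
    ∃ h : ξ ∈ D.domain, D ⟨ξ, h⟩ = η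

lemma SelfAdjointGraph.of_isSelfAdjoint [CompleteSpace E] {D : E →ₗ.[ℂ] E}
    (hD : IsSelfAdjoint D) : SelfAdjointGraph D := by
  have hdense := hD.dense_domain
  have hadj : LinearPMap.adjoint D = D := hD
  constructor
  · have h := LinearPMap.adjoint_isFormalAdjoint (T := D) hdense
    rw [hadj] at h
    exact fun x y => h x y
  · intro ξ η h
    have h1 : ξ ∈ (LinearPMap.adjoint D).domain :=
      LinearPMap.mem_adjoint_domain_of_exists ξ ⟨η, h⟩
    have h2 := LinearPMap.adjoint_apply_eq hdense ⟨ξ, h1⟩ h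
    generalize LinearPMap.adjoint D = D' at hadj h1 h2
    subst hadj
    exact ⟨h1, h2⟩

lemma SelfAdjointGraph.eq_zero_of_orthogonal {D : E →ₗ.[ℂ] E} (hD : SelfAdjointGraph D) {v : E}
    (hv : ∀ x : D.domain, ⟪v, (x : E)⟫_ℂ = 0) : v = 0 := by
  obtain ⟨h, h'⟩ := hD.maximal 0 v fun x => by rw [hv, inner_zero_left]
  rw [← h']
  exact D.map_zero

/-- A functional that is bounded on a subspace of a Hilbert space is represented by a vector. -/
lemma exists_inner_eq_of_bound [CompleteSpace E] {p : Submodule ℂ E} (f : p →ₗ[ℂ] ℂ) {C : ℝ}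
    (hC : 0 ≤ C) (hf : ∀ x, ‖f x‖ ≤ C * ‖(x : E)‖) :
    ∃ η : E, ‖η‖ ≤ C ∧ ∀ x : p, ⟪η, (x : E)⟫_ℂ = f x := by
  obtain ⟨g, hg, hn⟩ := exists_extension_norm_eq p (f.mkContinuous C hf)
  refine ⟨(InnerProductSpace.toDual ℂ E).symm g, ?_, fun x => ?_⟩
  · rw [LinearIsometryEquiv.norm_map, hn]
    exact LinearMap.mkContinuous_norm_le _ hC _
  · rw [InnerProductSpace.toDual_symm_apply, hg]
    rfl

lemma CommutatorBound.mono {D : E →ₗ.[ℂ] E} {D' : F →ₗ.[ℂ] F} {T : E →L[ℂ] F} {C C' : ℝ}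
    (h : CommutatorBound D D' T C) (hC : C ≤ C') : CommutatorBound D D' T C' := fun ξ => by
  obtain ⟨h1, h2⟩ := h ξ
  exact ⟨h1, h2.trans (by gcongr)⟩

lemma CommutatorBound.comp {D : E →ₗ.[ℂ] E} {D' : F →ₗ.[ℂ] F} {D'' : K →ₗ.[ℂ] K}
    {T : E →L[ℂ] F} {T' : F →L[ℂ] K} {C C' : ℝ} (h' : CommutatorBound D' D'' T' C')
    (h : CommutatorBound D D' T C) (hC' : 0 ≤ C') :
    CommutatorBound D D'' (T' ∘L T) (C' * ‖T‖ + ‖T'‖ * C) := fun ξ => by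
  obtain ⟨h1, h2⟩ := h ξ
  obtain ⟨h3, h4⟩ := h' ⟨T ξ, h1⟩
  refine ⟨h3, ?_⟩
  calc ‖D'' ⟨T' (T ξ), h3⟩ - T' (T (D ξ))‖
      = ‖(D'' ⟨T' (T ξ), h3⟩ - T' (D' ⟨T ξ, h1⟩)) + T' (D' ⟨T ξ, h1⟩ - T (D ξ))‖ := by
        rw [map_sub]; congr 1; abel
    _ ≤ C' * ‖T ξ‖ + ‖T'‖ * (C * ‖(ξ : E)‖) :=
        (norm_add_le _ _).trans (add_le_add h4 (T'.le_opNorm_of_le h2))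
    _ ≤ C' * (‖T‖ * ‖(ξ : E)‖) + ‖T'‖ * (C * ‖(ξ : E)‖) := by
        gcongr
        exact T.le_opNorm _
    _ = _ := by ring

lemma HasBoundedCommutator.add {D : E →ₗ.[ℂ] E} {T T' : E →L[ℂ] E}
    (h : HasBoundedCommutator D T) (h' : HasBoundedCommutator D T') :
    HasBoundedCommutator D (T + T') := by
  obtain ⟨C, hC⟩ := h
  obtain ⟨C', hC'⟩ := h'
  refine ⟨C + C', fun ξ => ?_⟩
  obtain ⟨h1, h2⟩ := hC ξ
  obtain ⟨h3, h4⟩ := hC' ξ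
  refine ⟨D.domain.add_mem h1 h3, ?_⟩
  have h5 : D ⟨(T + T') ξ, D.domain.add_mem h1 h3⟩ = D ⟨T ξ, h1⟩ + D ⟨T' ξ, h3⟩ :=
    D.map_add ⟨T ξ, h1⟩ ⟨T' ξ, h3⟩
  rw [h5, _root_.add_apply, add_sub_add_comm, add_mul]
  exact (norm_add_le _ _).trans (add_le_add h2 h4)

lemma HasBoundedCommutator.smul {D : E →ₗ.[ℂ] E} {T : E →L[ℂ] E}
    (h : HasBoundedCommutator D T) (c : ℂ) : HasBoundedCommutator D (c • T) := by
  obtain ⟨C, hC⟩ := h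
  refine ⟨‖c‖ * C, fun ξ => ?_⟩
  obtain ⟨h1, h2⟩ := hC ξ
  refine ⟨D.domain.smul_mem c h1, ?_⟩
  have h5 : D ⟨(c • T) ξ, D.domain.smul_mem c h1⟩ = c • D ⟨T ξ, h1⟩ := D.map_smul c ⟨T ξ, h1⟩
  rw [h5, _root_.smul_apply, ← smul_sub, norm_smul, mul_assoc]
  gcongr

lemma HasBoundedCommutator.zero (D : E →ₗ.[ℂ] E) : HasBoundedCommutator D 0 :=
  ⟨0, fun ξ => ⟨D.domain.zero_mem, by
    have : D ⟨(0 : E →L[ℂ] E) ξ, D.domain.zero_mem⟩ = 0 := D.map_zero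
    rw [this]
    simp⟩⟩

/-- If `D` and `D'` are self-adjoint and `D' T - T D` is bounded, then so is `D T† - T† D'`: both
are adjoint to each other up to sign. -/
lemma CommutatorBound.adjoint [CompleteSpace E] [CompleteSpace F] {D : E →ₗ.[ℂ] E}
    {D' : F →ₗ.[ℂ] F} {T : E →L[ℂ] F} {C : ℝ} (hD : SelfAdjointGraph D)
    (hD' : SelfAdjointGraph D') (hC : 0 ≤ C) (h : CommutatorBound D D' T C) :
    CommutatorBound D' D (ContinuousLinearMap.adjoint T) C := by
  choose hmem hbound using h
  let L : D.domain →ₗ[ℂ] F :=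
    { toFun := fun x => D' ⟨T x, hmem x⟩ - T (D x)
      map_add' := fun x y => by
        have h1 : D' ⟨T (x + y : D.domain), hmem (x + y)⟩ =
            D' ⟨T x, hmem x⟩ + D' ⟨T y, hmem y⟩ := by
          rw [← D'.map_add]
          congr 1
          exact Subtype.ext (by simp)
        rw [h1, D.map_add, map_add]
        abel
      map_smul' := fun c x => by
        have h1 : D' ⟨T (c • x : D.domain), hmem (c • x)⟩ = c • D' ⟨T x, hmem x⟩ := by
          rw [← D'.map_smul]
          congr 1
          exact Subtype.ext (by simp)
        rw [h1, D.map_smul, map_smul, RingHom.id_apply, smul_sub] }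
  intro ζ
  obtain ⟨η, hη, hη'⟩ := exists_inner_eq_of_bound
    ((innerSL ℂ (ζ : F)).toLinearMap ∘ₗ L) (C := ‖(ζ : F)‖ * C) (by positivity) fun x => by
      calc ‖⟪(ζ : F), L x⟫_ℂ‖ ≤ ‖(ζ : F)‖ * ‖L x‖ := norm_inner_le_norm _ _
        _ ≤ ‖(ζ : F)‖ * (C * ‖(x : E)‖) := by gcongr; exact hbound x
        _ = _ := by ring
  obtain ⟨h1, h2⟩ := hD.maximal (ContinuousLinearMap.adjoint T ζ)
    (ContinuousLinearMap.adjoint T (D' ζ) - η) fun x => by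
      rw [inner_sub_left, hη', ContinuousLinearMap.adjoint_inner_left,
        ContinuousLinearMap.adjoint_inner_left, hD'.symm ζ ⟨T x, hmem x⟩]
      change _ - ⟪(ζ : F), D' ⟨T x, hmem x⟩ - T (D x)⟫_ℂ = _
      rw [inner_sub_right]
      abel
  refine ⟨h1, ?_⟩
  rw [h2, sub_sub_cancel_left, norm_neg, mul_comm]
  exact hη

lemma SelfAdjointGraph.ampl {D : E →ₗ.[ℂ] E} (hD : SelfAdjointGraph D) (I : Type*) [Fintype I] :
    SelfAdjointGraph (ampl D I) := by
  classical
  constructor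
  · intro x y
    simp only [PiLp.inner_apply]
    exact Finset.sum_congr rfl fun i _ => hD.symm ⟨(x : PiLp 2 fun _ : I => E) i, x.2 i⟩
      ⟨(y : PiLp 2 fun _ : I => E) i, y.2 i⟩
  · intro ξ η h
    have key : ∀ i, ∃ h : ξ i ∈ D.domain, D ⟨ξ i, h⟩ = η i := by
      intro i
      refine hD.maximal _ _ fun x => ?_
      have hx : ∀ k, (PiLp.single 2 i (x : E) : PiLp 2 fun _ : I => E) k ∈ D.domain := by
        intro k
        by_cases hk : k = i
        · subst hk; simp
        · simp [hk]
      have h1 := h ⟨PiLp.single 2 i (x : E), hx⟩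
      rw [PiLp.inner_apply, PiLp.inner_apply, Finset.sum_eq_single i, Finset.sum_eq_single i] at h1
      · have h2 : HorizontalLift.ampl D I ⟨PiLp.single 2 i (x : E), hx⟩ i = D x := by
          change D ⟨(PiLp.single 2 i (x : E) : PiLp 2 fun _ : I => E) i, hx i⟩ = D x
          congr 1
          exact Subtype.ext (by simp)
        rw [h2] at h1
        simpa using h1
      · intro k _ hk
        have h2 : HorizontalLift.ampl D I ⟨PiLp.single 2 i (x : E), hx⟩ k = 0 := by
          change D ⟨(PiLp.single 2 i (x : E) : PiLp 2 fun _ : I => E) k, hx k⟩ = 0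
          rw [← D.map_zero]
          congr 1
          exact Subtype.ext (by simp [hk])
        rw [h2, inner_zero_right]
      · simp
      · intro k _ hk
        simp [hk]
      · simp
    refine ⟨fun i => (key i).1, ?_⟩
    ext i
    exact (key i).2

/-- The compression of a self-adjoint operator `D` to the range of a projection `p` such that
`[D, p]` is bounded is self-adjoint. -/
lemma SelfAdjointGraph.compress [CompleteSpace E] {D : E →ₗ.[ℂ] E} (hD : SelfAdjointGraph D)
    {p : E →L[ℂ] E} (hp : ∀ x, p (p x) = p x) (hp' : ∀ x y, ⟪p x, y⟫_ℂ = ⟪x, p y⟫_ℂ) {C : ℝ}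
    (hC : 0 ≤ C) (h : CommutatorBound D D p C) : SelfAdjointGraph (compress D p) := by
  have hran : ∀ x : LinearMap.range p.toLinearMap, p (x : E) = x := by
    rintro ⟨_, ⟨y, rfl⟩⟩
    exact hp y
  choose hmem hbound using h
  constructor
  · intro x y
    change ⟪p (D ⟨(x : LinearMap.range p.toLinearMap), x.2⟩),
      ((y : LinearMap.range p.toLinearMap) : E)⟫_ℂ =
      ⟪((x : LinearMap.range p.toLinearMap) : E),
        p (D ⟨(y : LinearMap.range p.toLinearMap), y.2⟩)⟫_ℂ
    rw [hp', hran, ← hp', hran]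
    exact hD.symm ⟨_, x.2⟩ ⟨_, y.2⟩
  · intro ξ η hξ
    have hcomp : ∀ y : D.domain, ⟪(η : E), (y : E)⟫_ℂ = ⟪(ξ : E), D ⟨p y, hmem y⟩⟫_ℂ := by
      intro y
      have h1 := hξ ⟨⟨p y, ⟨y, rfl⟩⟩, hmem y⟩
      change ⟪(η : E), p y⟫_ℂ = ⟪(ξ : E), p (D ⟨p y, hmem y⟩)⟫_ℂ at h1
      rwa [← hp', hran, ← hp', hran] at h1
    let L : D.domain →ₗ[ℂ] E :=
      { toFun := fun x => D ⟨p x, hmem x⟩ - p (D x)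
        map_add' := fun x y => by
          have h1 : D ⟨p (x + y : D.domain), hmem (x + y)⟩ =
              D ⟨p x, hmem x⟩ + D ⟨p y, hmem y⟩ := by
            rw [← D.map_add]
            congr 1
            exact Subtype.ext (by simp)
          rw [h1, D.map_add, map_add]
          abel
        map_smul' := fun c x => by
          have h1 : D ⟨p (c • x : D.domain), hmem (c • x)⟩ = c • D ⟨p x, hmem x⟩ := by
            rw [← D.map_smul]
            congr 1
            exact Subtype.ext (by simp)
          rw [h1, D.map_smul, map_smul, RingHom.id_apply, smul_sub] }
    obtain ⟨θ, -, hθ⟩ := exists_inner_eq_of_bound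
      ((innerSL ℂ (ξ : E)).toLinearMap ∘ₗ L) (C := ‖(ξ : E)‖ * C) (by positivity) fun x => by
        calc ‖⟪(ξ : E), L x⟫_ℂ‖ ≤ ‖(ξ : E)‖ * ‖L x‖ := norm_inner_le_norm _ _
          _ ≤ ‖(ξ : E)‖ * (C * ‖(x : E)‖) := by gcongr; exact hbound x
          _ = _ := by ring
    obtain ⟨h1, -⟩ := hD.maximal ξ (η - θ) fun y => by
      rw [inner_sub_left, hθ, hcomp]
      change _ - ⟪(ξ : E), D ⟨p y, hmem y⟩ - p (D y)⟫_ℂ = _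
      rw [inner_sub_right, ← hp', hran]
      abel
    refine ⟨h1, Subtype.ext ?_⟩
    refine sub_eq_zero.1 (hD.eq_zero_of_orthogonal fun y => ?_)
    change ⟪p (D ⟨ξ, h1⟩) - (η : E), (y : E)⟫_ℂ = 0
    rw [inner_sub_left, hp', hcomp, sub_eq_zero]
    exact hD.symm ⟨ξ, h1⟩ ⟨p y, hmem y⟩

lemma SelfAdjointGraph.directSumOp {ι : Type*} {X : ι → Type*} [∀ i, NormedAddCommGroup (X i)]
    [∀ i, InnerProductSpace ℂ (X i)] {T : ∀ i, X i →ₗ.[ℂ] X i}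
    (hT : ∀ i, SelfAdjointGraph (T i)) : SelfAdjointGraph (directSumOp T) := by
  classical
  constructor
  · intro x y
    rw [lp.inner_eq_tsum, lp.inner_eq_tsum]
    exact tsum_congr fun i => (hT i).symm ⟨(x : lp X 2) i, x.2.1 i⟩ ⟨(y : lp X 2) i, y.2.1 i⟩
  · intro ξ η h
    have key : ∀ i, ∃ h : ξ i ∈ (T i).domain, T i ⟨ξ i, h⟩ = η i := by
      intro i
      refine (hT i).maximal _ _ fun x => ?_
      have hx : ∀ k, (lp.single 2 i (x : X i) : lp X 2) k ∈ (T k).domain := by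
        intro k
        by_cases hk : k = i
        · subst hk; simp
        · rw [lp.single_apply_ne _ _ _ hk]
          exact (T k).domain.zero_mem
      have hTx : (fun k => T k ⟨(lp.single 2 i (x : X i) : lp X 2) k, hx k⟩) =
          lp.single (E := X) 2 i (T i x) := by
        funext k
        by_cases hk : k = i
        · subst hk
          refine Eq.trans ?_ (lp.single_apply_self (E := X) 2 k (T k x)).symm
          congr 1
          exact Subtype.ext (lp.single_apply_self (E := X) 2 k (x : X k))
        · refine Eq.trans ?_ (lp.single_apply_ne (E := X) 2 i (T i x) hk).symm
          refine Eq.trans ?_ (T k).map_zero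
          congr 1
          exact Subtype.ext (lp.single_apply_ne (E := X) 2 i (x : X i) hk)
      have hdom : (lp.single 2 i (x : X i) : lp X 2) ∈ (HorizontalLift.directSumOp T).domain :=
        ⟨hx, hTx ▸ lp.memℓp _⟩
      have h1 := h ⟨_, hdom⟩
      have h2 : HorizontalLift.directSumOp T ⟨_, hdom⟩ = lp.single (E := X) 2 i (T i x) :=
        lp.ext hTx
      rw [h2] at h1
      simpa only [lp.inner_single_right] using h1
    refine ⟨⟨fun i => (key i).1, ?_⟩, ?_⟩
    · convert lp.memℓp η using 1
      funext i
      exact (key i).2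
    · exact lp.ext (funext fun i => (key i).2)

end Commutators

/-! ### Square-summable families -/

lemma memℓp_two_of_sum_sq_le {ι : Type*} {X : ι → Type*} [∀ i, NormedAddCommGroup (X i)]
    {f : ∀ i, X i} {M : ℝ} (hf : ∀ F : Finset ι, ∑ i ∈ F, ‖f i‖ ^ 2 ≤ M ^ 2) : Memℓp f 2 :=
  memℓp_gen' (C := M ^ 2) fun F => by simpa using hf F

lemma lp_norm_le_of_sum_sq_le {ι : Type*} {X : ι → Type*} [∀ i, NormedAddCommGroup (X i)]
    {f : lp X 2} {M : ℝ} (hM : 0 ≤ M) (hf : ∀ F : Finset ι, ∑ i ∈ F, ‖f i‖ ^ 2 ≤ M ^ 2) :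
    ‖f‖ ≤ M :=
  lp.norm_le_of_forall_sum_le (by simp) hM fun F => by simpa using hf F

lemma lp_sum_sq_le {ι : Type*} {X : ι → Type*} [∀ i, NormedAddCommGroup (X i)]
    (f : lp X 2) (F : Finset ι) : ∑ i ∈ F, ‖f i‖ ^ 2 ≤ ‖f‖ ^ 2 := by
  simpa using lp.sum_rpow_le_norm_rpow (by simp) f F

/-! ### Schur orthogonality -/

section Schur

variable {G : Type*} [Group G] [TopologicalSpace G]

namespace Irrep

lemma mat_one (σ : Irrep G) : σ.mat 1 = 1 := by
  simp only [mat, map_one]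
  rfl

lemma conjTranspose_mat_mul (σ : Irrep G) (g : G) : (σ.mat g)ᴴ * σ.mat g = 1 :=
  Matrix.mem_unitaryGroup_iff'.1 (σ.rep.hom g).2

/-- Schur's lemma for endomorphisms of an irreducible representation. -/
lemma exists_eq_smul_one_of_commute (σ : Irrep G) (M : Matrix (Fin σ.dim) (Fin σ.dim) ℂ)
    (hM : ∀ g, σ.mat g * M = M * σ.mat g) : ∃ c : ℂ, M = c • 1 := by
  have hirr : (matrixRep σ.rep.hom).IsIrreducible := σ.rep.irreducible
  let f : Representation.IntertwiningMap (matrixRep σ.rep.hom) (matrixRep σ.rep.hom) :=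
    { toLinearMap := Matrix.toLin' M
      isIntertwining' := fun g => by
        change Matrix.toLin' M ∘ₗ Matrix.toLin' (σ.mat g) =
          Matrix.toLin' (σ.mat g) ∘ₗ Matrix.toLin' M
        rw [← Matrix.toLin'_mul, ← Matrix.toLin'_mul, hM] }
  obtain ⟨c, hc⟩ :=
    (Representation.IsIrreducible.algebraMap_intertwiningMap_bijective_of_isAlgClosed
      (k := ℂ) (ρ := matrixRep σ.rep.hom)).2 f
  refine ⟨c, Matrix.toLin'.injective ?_⟩
  have h : Matrix.toLin' M = (c • (1 : Representation.IntertwiningMap (matrixRep σ.rep.hom)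
    (matrixRep σ.rep.hom))).toLinearMap := (congrArg (fun T => T.toLinearMap) hc).symm
  rw [h, map_smul, Matrix.toLin'_one]
  rfl

/-- Schur's lemma: a nonzero intertwiner between two irreducible representations is a multiple of a
unitary one, so the two representations belong to the same class. -/
lemma eq_zero_of_intertwines {κ κ' : Irrep G} (hne : κ ≠ κ')
    (Y : Matrix (Fin κ'.dim) (Fin κ.dim) ℂ) (hY : ∀ g, κ'.mat g * Y = Y * κ.mat g) : Y = 0 := by
  by_contra hY0
  have hY' : ∀ g, κ.mat g * Yᴴ = Yᴴ * κ'.mat g := by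
    intro g
    have h := congrArg Matrix.conjTranspose (hY g)
    rw [Matrix.conjTranspose_mul, Matrix.conjTranspose_mul] at h
    calc κ.mat g * Yᴴ = κ.mat g * (Yᴴ * (κ'.mat g)ᴴ) * κ'.mat g := by
          rw [Matrix.mul_assoc, Matrix.mul_assoc, conjTranspose_mat_mul, Matrix.mul_one]
      _ = Yᴴ * κ'.mat g := by
          rw [h, ← Matrix.mul_assoc, mat_mul_conjTranspose, Matrix.one_mul]
  obtain ⟨c, hc⟩ := exists_eq_smul_one_of_commute κ' (Y * Yᴴ) fun g => by
    rw [← Matrix.mul_assoc, hY, Matrix.mul_assoc, hY', Matrix.mul_assoc]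
  obtain ⟨c', hc'⟩ := exists_eq_smul_one_of_commute κ (Yᴴ * Y) fun g => by
    rw [← Matrix.mul_assoc, hY', Matrix.mul_assoc, hY, Matrix.mul_assoc]
  have hcc : c = c' := by
    have h : c • Y = c' • Y := by
      calc c • Y = Y * Yᴴ * Y := by rw [hc, Matrix.smul_mul, Matrix.one_mul]
        _ = c' • Y := by rw [Matrix.mul_assoc, hc', Matrix.mul_smul, Matrix.mul_one]
    rw [← sub_eq_zero, ← sub_smul] at h
    exact sub_eq_zero.1 ((smul_eq_zero.1 h).resolve_right hY0)
  subst hcc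
  obtain ⟨p, q, hpq⟩ : ∃ p q, Y p q ≠ 0 := by
    by_contra! h
    exact hY0 (Matrix.ext h)
  have hcr : c = ((∑ j, ‖Y p j‖ ^ 2 : ℝ) : ℂ) := by
    have h := congrFun (congrFun hc p) p
    simp only [Matrix.mul_apply, Matrix.conjTranspose_apply, Matrix.smul_apply, Matrix.one_apply_eq,
      smul_eq_mul, mul_one] at h
    rw [← h]
    push_cast
    exact Finset.sum_congr rfl fun j _ => by
      rw [Complex.star_def, Complex.mul_conj, Complex.normSq_eq_norm_sq]
      push_cast
      rfl
  have hpos : 0 < ∑ j, ‖Y p j‖ ^ 2 :=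
    Finset.sum_pos' (fun _ _ => by positivity) ⟨q, Finset.mem_univ _, by positivity⟩
  set t : ℝ := ∑ j, ‖Y p j‖ ^ 2
  have hs : (((Real.sqrt t)⁻¹ : ℝ) : ℂ) * (((Real.sqrt t)⁻¹ : ℝ) : ℂ) * c = 1 := by
    rw [hcr, ← Complex.ofReal_mul, ← Complex.ofReal_mul, ← mul_inv, Real.mul_self_sqrt hpos.le,
      inv_mul_cancel₀ hpos.ne', Complex.ofReal_one]
  set u : ℂ := (((Real.sqrt t)⁻¹ : ℝ) : ℂ)
  have hu : star u = u := Complex.conj_ofReal _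
  have h1 : (u • Y) * (u • Y)ᴴ = 1 := by
    rw [Matrix.conjTranspose_smul, hu, Matrix.smul_mul, Matrix.mul_smul, smul_smul, hc, smul_smul,
      hs, one_smul]
  have h2 : (u • Y)ᴴ * (u • Y) = 1 := by
    rw [Matrix.conjTranspose_smul, hu, Matrix.smul_mul, Matrix.mul_smul, smul_smul, hc', smul_smul,
      hs, one_smul]
  have h3 : ∀ g, κ'.mat g * (u • Y) = (u • Y) * κ.mat g := fun g => by
    rw [Matrix.mul_smul, Matrix.smul_mul, hY]
  refine hne ?_
  rw [← Quotient.out_eq κ, ← Quotient.out_eq κ']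
  exact (Quotient.sound (s := UnitaryIrrep.setoid G) (a := κ'.rep) (b := κ.rep)
    ⟨u • Y, h1, h2, h3⟩).symm

variable [IsTopologicalGroup G] [CompactSpace G] [MeasurableSpace G] [BorelSpace G]

lemma integrable_of_continuous {f : G → ℂ} (hf : Continuous f) :
    MeasureTheory.Integrable f (haarProb G) :=
  hf.integrable_of_hasCompactSupport (HasCompactSupport.of_compactSpace _)

/-- Averaging the matrix unit `e_{ab}` over `G` yields an intertwiner. -/
lemma integral_mat_intertwines (κ κ' : Irrep G) (a : Fin κ'.dim) (b : Fin κ.dim) (g : G) :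
    κ'.mat g * Matrix.of (fun p q => ∫ h, star (κ.mat h q b) * κ'.mat h p a ∂(haarProb G)) =
      Matrix.of (fun p q => ∫ h, star (κ.mat h q b) * κ'.mat h p a ∂(haarProb G)) * κ.mat g := by
  set Y : Matrix (Fin κ'.dim) (Fin κ.dim) ℂ :=
    Matrix.of (fun p q => ∫ h, star (κ.mat h q b) * κ'.mat h p a ∂(haarProb G)) with hYdef
  have hint : ∀ p q, MeasureTheory.Integrable (fun h => star (κ.mat h q b) * κ'.mat h p a)
      (haarProb G) := fun p q =>
    integrable_of_continuous ((κ.continuous_mat_apply q b).star.mul (κ'.continuous_mat_apply p a))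
  have hinv : κ'.mat g * Y * (κ.mat g)ᴴ = Y := by
    ext p q
    simp only [Matrix.mul_apply, Matrix.conjTranspose_apply, Finset.sum_mul]
    calc ∑ q', ∑ p', κ'.mat g p p' * Y p' q' * star (κ.mat g q q')
        = ∫ h, ∑ q', ∑ p', κ'.mat g p p' * (star (κ.mat h q' b) * κ'.mat h p' a) *
            star (κ.mat g q q') ∂(haarProb G) := by
          rw [MeasureTheory.integral_finsetSum _ fun q' _ =>
            MeasureTheory.integrable_finsetSum _ fun p' _ =>
              ((hint p' q').const_mul _).mul_const _]
          refine Finset.sum_congr rfl fun q' _ => ?_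
          rw [MeasureTheory.integral_finsetSum _ fun p' _ =>
            ((hint p' q').const_mul _).mul_const _]
          refine Finset.sum_congr rfl fun p' _ => ?_
          rw [MeasureTheory.integral_mul_const, MeasureTheory.integral_const_mul]
          rfl
      _ = ∫ h, star (κ.mat (g * h) q b) * κ'.mat (g * h) p a ∂(haarProb G) := by
          refine MeasureTheory.integral_congr_ae (Filter.Eventually.of_forall fun h => ?_)
          simp only [mat_mul, Matrix.mul_apply, star_sum, star_mul', Finset.sum_mul_sum]
          exact Finset.sum_congr rfl fun q' _ => Finset.sum_congr rfl fun p' _ => by ring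
      _ = Y p q := MeasureTheory.integral_mul_left_eq_self
          (fun h => star (κ.mat h q b) * κ'.mat h p a) g
  calc κ'.mat g * Y = κ'.mat g * Y * (κ.mat g)ᴴ * κ.mat g := by
        rw [Matrix.mul_assoc (κ'.mat g * Y), conjTranspose_mat_mul, Matrix.mul_one]
    _ = Y * κ.mat g := by rw [hinv]

lemma integral_star_mat_mul_mat_of_ne {κ κ' : Irrep G} (hne : κ ≠ κ') (q b : Fin κ.dim)
    (p a : Fin κ'.dim) : ∫ h, star (κ.mat h q b) * κ'.mat h p a ∂(haarProb G) = 0 :=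
  congrFun (congrFun (eq_zero_of_intertwines hne _ (integral_mat_intertwines κ κ' a b)) p) q

lemma dim_mul_integral_star_mat_mul_mat (κ : Irrep G) (q b p a : Fin κ.dim) :
    (κ.dim : ℂ) * ∫ h, star (κ.mat h q b) * κ.mat h p a ∂(haarProb G) =
      if q = p ∧ b = a then 1 else 0 := by
  obtain ⟨c, hc⟩ := exists_eq_smul_one_of_commute κ _ (integral_mat_intertwines κ κ a b)
  have hc' : ∀ p q, ∫ h, star (κ.mat h q b) * κ.mat h p a ∂(haarProb G) =
      if p = q then c else 0 := by
    intro p q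
    have h := congrFun (congrFun hc p) q
    simpa [Matrix.one_apply] using h
  have htr : (κ.dim : ℂ) * c = if b = a then 1 else 0 := by
    calc (κ.dim : ℂ) * c = ∑ p, ∫ h, star (κ.mat h p b) * κ.mat h p a ∂(haarProb G) := by
          simp only [hc', if_true, Finset.sum_const, Finset.card_univ, Fintype.card_fin,
            nsmul_eq_mul]
      _ = ∫ h, ((κ.mat h)ᴴ * κ.mat h) b a ∂(haarProb G) := by
          simp only [Matrix.mul_apply, Matrix.conjTranspose_apply]
          exact (MeasureTheory.integral_finsetSum _ fun p _ => integrable_of_continuous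
            ((κ.continuous_mat_apply p b).star.mul (κ.continuous_mat_apply p a))).symm
      _ = if b = a then 1 else 0 := by
          simp only [conjTranspose_mat_mul, Matrix.one_apply]
          simp
  rw [hc']
  by_cases hqp : q = p
  · subst hqp
    simp [htr]
  · simp [hqp, Ne.symm hqp]

lemma integral_star_coeff_mul_coeff_of_ne {κ κ' : Irrep G} (hne : κ ≠ κ') (k l : Fin κ.dim)
    (k' l' : Fin κ'.dim) :
    ∫ h, star (κ.coeff k l h) * κ'.coeff k' l' h ∂(haarProb G) = 0 := by
  have h : ∀ h, star (κ.coeff k l h) * κ'.coeff k' l' h =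
      (star (Real.sqrt κ.dim : ℂ) * (Real.sqrt κ'.dim : ℂ)) *
        (star (κ.mat h l k) * κ'.mat h l' k') := fun h => by
    rw [coeff, coeff, star_mul']
    ring
  simp only [h]
  rw [MeasureTheory.integral_const_mul, integral_star_mat_mul_mat_of_ne hne, mul_zero]

lemma integral_star_coeff_mul_coeff (κ : Irrep G) (k l k' l' : Fin κ.dim) :
    ∫ h, star (κ.coeff k l h) * κ.coeff k' l' h ∂(haarProb G) =
      if k = k' ∧ l = l' then 1 else 0 := by
  have h : ∀ h, star (κ.coeff k l h) * κ.coeff k' l' h =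
      κ.dim * (star (κ.mat h l k) * κ.mat h l' k') := fun h => by
    have h1 : (Real.sqrt κ.dim : ℂ) * (Real.sqrt κ.dim : ℂ) = κ.dim := by
      rw [← Complex.ofReal_mul, Real.mul_self_sqrt (Nat.cast_nonneg _), Complex.ofReal_natCast]
    rw [coeff, coeff, star_mul', ← h1, Complex.star_def, Complex.conj_ofReal]
    ring
  simp only [h]
  rw [MeasureTheory.integral_const_mul, dim_mul_integral_star_mat_mul_mat]
  exact if_congr and_comm rfl rfl

/-- The normalized coefficient `κ.coeff k l` as an element of `L²(G)`. -/
noncomputable def coeffLp (q : Σ κ : Irrep G, Fin κ.dim × Fin κ.dim) :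
    MeasureTheory.Lp ℂ 2 (haarProb G) :=
  ContinuousMap.toLp 2 (haarProb G) ℂ ⟨q.1.coeff q.2.1 q.2.2, q.1.continuous_coeff _ _⟩

lemma inner_coeffLp_toLp (κ : Irrep G) (k l : Fin κ.dim) (f : C(G, ℂ)) :
    inner ℂ (coeffLp ⟨κ, (k, l)⟩) (ContinuousMap.toLp 2 (haarProb G) ℂ f) =
      ∫ h, star (κ.coeff k l h) * f h ∂(haarProb G) := by
  rw [coeffLp, MeasureTheory.ContinuousMap.inner_toLp]
  refine MeasureTheory.integral_congr_ae (Filter.Eventually.of_forall fun h => ?_)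
  exact mul_comm _ _

lemma orthonormal_coeffLp : Orthonormal ℂ (coeffLp (G := G)) := by
  classical
  rw [orthonormal_iff_ite]
  rintro ⟨κ, k, l⟩ ⟨κ', k', l'⟩
  have h := inner_coeffLp_toLp κ k l ⟨κ'.coeff k' l', κ'.continuous_coeff _ _⟩
  refine Eq.trans h ?_
  by_cases hκ : κ = κ'
  · subst hκ
    refine (integral_star_coeff_mul_coeff κ k l k' l').trans ?_
    simp
  · refine (integral_star_coeff_mul_coeff_of_ne hκ k l k' l').trans ?_
    rw [if_neg fun h => hκ (congrArg Sigma.fst h)]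

lemma norm_toLp_sq (f : C(G, ℂ)) : ‖ContinuousMap.toLp 2 (haarProb G) ℂ f‖ ^ 2 =
    ∫ h, ‖f h‖ ^ 2 ∂(haarProb G) := by
  have h := inner_self_eq_norm_sq_to_K (𝕜 := ℂ) (ContinuousMap.toLp 2 (haarProb G) ℂ f)
  rw [MeasureTheory.ContinuousMap.inner_toLp] at h
  have h2 : ∀ x, f x * (starRingEnd ℂ) (f x) = ((‖f x‖ ^ 2 : ℝ) : ℂ) := fun x => by
    rw [Complex.mul_conj, Complex.normSq_eq_norm_sq]
  simp only [h2] at h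
  rw [integral_complex_ofReal] at h
  exact Complex.ofReal_injective ((Complex.ofReal_pow _ 2).trans h.symm)

end Irrep

end Schur

/-- A scalar matrix that is a contraction on `ℂⁿ` is a contraction on `Eⁿ` for every inner product
space `E`: expand the vectors in an orthonormal basis of their span. -/
lemma sum_norm_sq_smul_le {E : Type*} [NormedAddCommGroup E] [InnerProductSpace ℂ E]
    {P ι : Type*} [Fintype ι] (F : Finset P) (w : P → ι → ℂ)
    (hw : ∀ c : ι → ℂ, ∑ ρ ∈ F, ‖∑ l, w ρ l * c l‖ ^ 2 ≤ ∑ l, ‖c l‖ ^ 2) (ξ : ι → E) :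
    ∑ ρ ∈ F, ‖∑ l, w ρ l • ξ l‖ ^ 2 ≤ ∑ l, ‖ξ l‖ ^ 2 := by
  let V := Submodule.span ℂ (Set.range ξ)
  have : FiniteDimensional ℂ V := FiniteDimensional.span_of_finite ℂ (Set.finite_range ξ)
  let b := stdOrthonormalBasis ℂ V
  let η : ι → V := fun l => ⟨ξ l, Submodule.subset_span ⟨l, rfl⟩⟩
  have h1 : ∀ ρ, ‖∑ l, w ρ l • ξ l‖ ^ 2 = ∑ k, ‖∑ l, w ρ l * inner ℂ (b k) (η l)‖ ^ 2 := by
    intro ρ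
    have h2 : ∑ l, w ρ l • ξ l = ((∑ l, w ρ l • η l : V) : E) := by simp [η]
    rw [h2, Submodule.norm_coe, ← b.sum_sq_norm_inner_right]
    simp only [inner_sum, inner_smul_right]
  have h3 : ∀ l, ‖ξ l‖ ^ 2 = ∑ k, ‖inner ℂ (b k) (η l)‖ ^ 2 := fun l =>
    (b.sum_sq_norm_inner_right (η l)).symm
  simp only [h1, h3]
  rw [Finset.sum_comm, Finset.sum_comm (s := Finset.univ (α := ι))]
  exact Finset.sum_le_sum fun k _ => hw fun l => inner ℂ (b k) (η l)

/-! ### Multiplication operators in terms of tensor product decompositions -/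

section Multiplication

variable {G : Type*} [Group G] [TopologicalSpace G]

namespace TensorDecomp

variable {σ τ : Irrep G} (δ : TensorDecomp σ τ)

open Classical in
/-- The component `V_σ ⊗ V_τ → V_κ` of the decomposition `δ` that belongs to its `r`-th summand; it
is zero unless that summand is `V_κ`. -/
noncomputable def block (r : Fin δ.num) (κ : Irrep G) :
    Matrix (Fin κ.dim) (Fin σ.dim × Fin τ.dim) ℂ :=
  if h : δ.comp r = κ then
    Matrix.of fun l x => δ.U ⟨r, Fin.cast (congrArg Irrep.dim h.symm) l⟩ x
  else 0

lemma block_self (r : Fin δ.num) (l : Fin (δ.comp r).dim) (x : Fin σ.dim × Fin τ.dim) :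
    δ.block r (δ.comp r) l x = δ.U ⟨r, l⟩ x := by
  rw [block, dif_pos rfl]
  rfl

lemma block_of_ne {r : Fin δ.num} {κ : Irrep G} (h : δ.comp r ≠ κ) : δ.block r κ = 0 :=
  dif_neg h

lemma block_mul_conjTranspose_of_ne {r r' : Fin δ.num} (hr : r ≠ r') (κ : Irrep G) :
    δ.block r κ * (δ.block r' κ)ᴴ = 0 := by
  by_cases h : δ.comp r = κ
  swap
  · rw [block_of_ne _ h, Matrix.zero_mul]
  by_cases h' : δ.comp r' = κ
  swap
  · rw [block_of_ne _ h', Matrix.conjTranspose_zero, Matrix.mul_zero]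
  ext l l'
  rw [block, block, dif_pos h, dif_pos h']
  have h1 := congrFun (congrFun δ.mul_conjTranspose_U
    ⟨r, Fin.cast (congrArg Irrep.dim h.symm) l⟩) ⟨r', Fin.cast (congrArg Irrep.dim h'.symm) l'⟩
  rw [Matrix.one_apply_ne fun h2 => hr (congrArg Sigma.fst h2)] at h1
  exact h1

lemma block_mul_conjTranspose_self (r : Fin δ.num) :
    δ.block r (δ.comp r) * (δ.block r (δ.comp r))ᴴ = 1 := by
  ext l l'
  have h1 := congrFun (congrFun δ.mul_conjTranspose_U ⟨r, l⟩) ⟨r, l'⟩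
  simp only [Matrix.mul_apply, Matrix.conjTranspose_apply, block_self] at h1 ⊢
  rw [h1]
  simp [Matrix.one_apply]

lemma mat_mul_mat (h : G) (i i' : Fin σ.dim) (j m : Fin τ.dim) :
    σ.mat h i i' * τ.mat h j m = ∑ r, ∑ p, ∑ p', star (δ.U ⟨r, p⟩ (i, j)) * δ.U ⟨r, p'⟩ (i', m) *
      (δ.comp r).mat h p p' := by
  have h1 : σ.mat h ⊗ₖ τ.mat h =
      δ.Uᴴ * (Matrix.blockDiagonal' (fun r => (δ.comp r).mat h) * δ.U) := by
    rw [← δ.intertwines, ← Matrix.mul_assoc, δ.conjTranspose_U_mul, Matrix.one_mul]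
  have h2 := congrFun (congrFun h1 (i, j)) (i', m)
  rw [Matrix.kroneckerMap_apply] at h2
  rw [h2, Matrix.mul_apply, Fintype.sum_sigma]
  refine Finset.sum_congr rfl fun r _ => Finset.sum_congr rfl fun p _ => ?_
  rw [Matrix.mul_apply, Fintype.sum_sigma, Finset.sum_eq_single r, Finset.mul_sum]
  · refine Finset.sum_congr rfl fun p' _ => ?_
    rw [Matrix.blockDiagonal'_apply_eq, Matrix.conjTranspose_apply]
    ring
  · intro s _ hs
    exact Finset.sum_eq_zero fun k _ => by
      rw [Matrix.blockDiagonal'_apply_ne _ _ _ hs.symm, zero_mul]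
  · simp

end TensorDecomp

variable [IsTopologicalGroup G] [CompactSpace G] [MeasurableSpace G] [BorelSpace G]

lemma Irrep.integral_star_coeff_mul_mat (κ : Irrep G) (k l p p' : Fin κ.dim) :
    ∫ h, star (κ.coeff k l h) * κ.mat h p p' ∂(haarProb G) =
      if k = p' ∧ l = p then (Real.sqrt κ.dim : ℂ)⁻¹ else 0 := by
  have hd : (Real.sqrt κ.dim : ℂ) ≠ 0 := by
    have : 0 < κ.dim := Fin.pos k
    exact_mod_cast (Real.sqrt_pos.2 (Nat.cast_pos.2 this)).ne'
  have h1 : ∀ h, star (κ.coeff k l h) * κ.mat h p p' =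
      (Real.sqrt κ.dim : ℂ)⁻¹ * (star (κ.coeff k l h) * κ.coeff p' p h) := fun h => by
    have h2 : κ.coeff p' p h = (Real.sqrt κ.dim : ℂ) * κ.mat h p p' := rfl
    rw [h2]
    field_simp
  simp only [h1]
  rw [MeasureTheory.integral_const_mul, integral_star_coeff_mul_coeff]
  split_ifs <;> simp

lemma Irrep.integral_star_coeff_mul_mat_of_ne {κ κ' : Irrep G} (hne : κ ≠ κ') (k l : Fin κ.dim)
    (p p' : Fin κ'.dim) :
    ∫ h, star (κ.coeff k l h) * κ'.mat h p p' ∂(haarProb G) = 0 := by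
  have h1 : ∀ h, star (κ.coeff k l h) * κ'.mat h p p' =
      star (Real.sqrt κ.dim : ℂ) * (star (κ.mat h l k) * κ'.mat h p p') := fun h => by
    rw [coeff, star_mul']
    ring
  simp only [h1]
  rw [MeasureTheory.integral_const_mul, integral_star_mat_mul_mat_of_ne hne, mul_zero]

/-- The matrix coefficients of the operator on `L²(G)` of multiplication by a coefficient of `σ`. -/
lemma TensorDecomp.integral_coeff_mul {σ τ : Irrep G} (δ : TensorDecomp σ τ) (i i' : Fin σ.dim)
    (j m : Fin τ.dim) (κ : Irrep G) (k l : Fin κ.dim) :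
    ∫ h, star (κ.coeff k l h) * τ.coeff m j h * σ.mat h i i' ∂(haarProb G) =
      ∑ r, ((Real.sqrt τ.dim / Real.sqrt κ.dim : ℝ) : ℂ) * star (δ.block r κ l (i, j)) *
        δ.block r κ k (i', m) := by
  have hint : ∀ r p p', MeasureTheory.Integrable (fun h => (Real.sqrt τ.dim : ℂ) *
      (star (δ.U ⟨r, p⟩ (i, j)) * δ.U ⟨r, p'⟩ (i', m)) *
      (star (κ.coeff k l h) * (δ.comp r).mat h p p')) (haarProb G) := fun r p p' =>
    Irrep.integrable_of_continuous (continuous_const.mul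
      ((κ.continuous_coeff k l).star.mul ((δ.comp r).continuous_mat_apply p p')))
  calc ∫ h, star (κ.coeff k l h) * τ.coeff m j h * σ.mat h i i' ∂(haarProb G)
      = ∫ h, ∑ r, ∑ p, ∑ p', (Real.sqrt τ.dim : ℂ) *
          (star (δ.U ⟨r, p⟩ (i, j)) * δ.U ⟨r, p'⟩ (i', m)) *
          (star (κ.coeff k l h) * (δ.comp r).mat h p p') ∂(haarProb G) := by
        refine MeasureTheory.integral_congr_ae (Filter.Eventually.of_forall fun h => ?_)
        have h1 : star (κ.coeff k l h) * τ.coeff m j h * σ.mat h i i' =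
            (Real.sqrt τ.dim : ℂ) * star (κ.coeff k l h) * (σ.mat h i i' * τ.mat h j m) := by
          rw [show τ.coeff m j h = (Real.sqrt τ.dim : ℂ) * τ.mat h j m from rfl]
          ring
        simp only [h1, δ.mat_mul_mat, Finset.mul_sum]
        exact Finset.sum_congr rfl fun r _ => Finset.sum_congr rfl fun p _ =>
          Finset.sum_congr rfl fun p' _ => by ring
    _ = ∑ r, ∑ p, ∑ p', (Real.sqrt τ.dim : ℂ) *
          (star (δ.U ⟨r, p⟩ (i, j)) * δ.U ⟨r, p'⟩ (i', m)) *
          ∫ h, star (κ.coeff k l h) * (δ.comp r).mat h p p' ∂(haarProb G) := by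
        rw [MeasureTheory.integral_finsetSum _ fun r _ => MeasureTheory.integrable_finsetSum _
          fun p _ => MeasureTheory.integrable_finsetSum _ fun p' _ => hint r p p']
        refine Finset.sum_congr rfl fun r _ => ?_
        rw [MeasureTheory.integral_finsetSum _ fun p _ => MeasureTheory.integrable_finsetSum _
          fun p' _ => hint r p p']
        refine Finset.sum_congr rfl fun p _ => ?_
        rw [MeasureTheory.integral_finsetSum _ fun p' _ => hint r p p']
        exact Finset.sum_congr rfl fun p' _ => MeasureTheory.integral_const_mul _ _
    _ = _ := by
        refine Finset.sum_congr rfl fun r _ => ?_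
        by_cases h : δ.comp r = κ
        · subst h
          simp only [Irrep.integral_star_coeff_mul_mat, TensorDecomp.block_self]
          rw [Finset.sum_eq_single l, Finset.sum_eq_single k]
          · rw [if_pos ⟨rfl, rfl⟩]
            push_cast
            ring
          · intro p' _ hp
            rw [if_neg fun h => hp h.1.symm, mul_zero]
          · simp
          · intro p _ hp
            exact Finset.sum_eq_zero fun p' _ => by rw [if_neg fun h => hp h.2.symm, mul_zero]
          · simp
        · simp only [δ.block_of_ne h, Irrep.integral_star_coeff_mul_mat_of_ne (Ne.symm h)]
          simp

/-- Bessel's inequality for the products `star (σ.mat · i i') * f`, where `f` is a combination of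
coefficients of `κ`. Summing over `i'` makes the right-hand side equal to `‖f‖²`, because the rows
of `σ.mat h` are unit vectors. -/
lemma sum_norm_sq_block_le {σ : Irrep G} (δ : ∀ τ, TensorDecomp σ τ) (i : Fin σ.dim) (κ : Irrep G)
    (F : Finset (Σ τ : Irrep G, Fin τ.dim)) (c : Fin κ.dim → ℂ) :
    ∑ q ∈ F, ∑ r, ‖∑ l, (((Real.sqrt q.1.dim / Real.sqrt κ.dim : ℝ) : ℂ) *
      (δ q.1).block r κ l (i, q.2)) * c l‖ ^ 2 ≤ ∑ l, ‖c l‖ ^ 2 := by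
  rcases isEmpty_or_nonempty (Fin κ.dim) with hκ | ⟨⟨k⟩⟩
  · simp
  let f : C(G, ℂ) := ⟨fun h => ∑ l, c l * κ.coeff k l h,
    continuous_finsetSum _ fun l _ => continuous_const.mul (κ.continuous_coeff k l)⟩
  let g : Fin σ.dim → C(G, ℂ) := fun i' => ⟨fun h => star (σ.mat h i i') * f h,
    (σ.continuous_mat_apply i i').star.mul f.continuous⟩
  let y : ∀ q : Σ τ : Irrep G, Fin τ.dim, Fin (δ q.1).num → ℂ := fun q r =>
    ∑ l, (((Real.sqrt q.1.dim / Real.sqrt κ.dim : ℝ) : ℂ) * (δ q.1).block r κ l (i, q.2)) * c l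
  change ∑ q ∈ F, ∑ r, ‖y q r‖ ^ 2 ≤ _
  have hy : ∀ q r, (δ q.1).comp r ≠ κ → y q r = 0 := fun q r h => by
    simp [y, (δ q.1).block_of_ne h]
  -- the coefficients of `g i'` in the orthonormal system
  have hinner : ∀ (q : Σ τ : Irrep G, Fin τ.dim) (m : Fin q.1.dim) (i' : Fin σ.dim),
      inner ℂ (Irrep.coeffLp ⟨q.1, (m, q.2)⟩) (ContinuousMap.toLp 2 (haarProb G) ℂ (g i')) =
        ∑ r, y q r * star ((δ q.1).block r κ k (i', m)) := by
    intro q m i'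
    rw [Irrep.inner_coeffLp_toLp]
    have hint : ∀ l, MeasureTheory.Integrable (fun h => c l *
        star (star (κ.coeff k l h) * q.1.coeff m q.2 h * σ.mat h i i')) (haarProb G) := fun l =>
      Irrep.integrable_of_continuous (continuous_const.mul
        (((κ.continuous_coeff k l).star.mul (q.1.continuous_coeff m q.2)).mul
          (σ.continuous_mat_apply i i')).star)
    calc ∫ h, star (q.1.coeff m q.2 h) * g i' h ∂(haarProb G)
        = ∫ h, ∑ l, c l * star (star (κ.coeff k l h) * q.1.coeff m q.2 h * σ.mat h i i')
            ∂(haarProb G) := by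
          refine MeasureTheory.integral_congr_ae (Filter.Eventually.of_forall fun h => ?_)
          change star (q.1.coeff m q.2 h) * (star (σ.mat h i i') * ∑ l, c l * κ.coeff k l h) = _
          simp only [Finset.mul_sum, star_mul', star_star]
          exact Finset.sum_congr rfl fun l _ => by ring
      _ = ∑ l, c l * star (∫ h, star (κ.coeff k l h) * q.1.coeff m q.2 h * σ.mat h i i'
            ∂(haarProb G)) := by
          rw [MeasureTheory.integral_finsetSum _ fun l _ => hint l]
          refine Finset.sum_congr rfl fun l _ => ?_
          rw [MeasureTheory.integral_const_mul]
          exact congrArg _ integral_conj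
      _ = _ := by
          simp only [(δ q.1).integral_coeff_mul, star_sum, star_mul', star_star, y]
          simp only [Finset.mul_sum, Finset.sum_mul, Complex.star_def, Complex.conj_ofReal]
          rw [Finset.sum_comm]
          exact Finset.sum_congr rfl fun r _ => Finset.sum_congr rfl fun l _ => by ring
  -- the rows of the blocks are orthonormal
  have hrow : ∀ q : Σ τ : Irrep G, Fin τ.dim,
      ∑ i', ∑ m, ‖∑ r, y q r * star ((δ q.1).block r κ k (i', m))‖ ^ 2 = ∑ r, ‖y q r‖ ^ 2 := by
    intro q
    apply Complex.ofReal_injective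
    push_cast
    simp only [← Complex.mul_conj', map_sum, map_mul, Complex.star_def, Complex.conj_conj,
      Finset.sum_mul_sum]
    have h1 : ∀ r r', ∑ i', ∑ m, (y q r * (starRingEnd ℂ) ((δ q.1).block r κ k (i', m))) *
        ((starRingEnd ℂ) (y q r') * (δ q.1).block r' κ k (i', m)) =
        y q r * (starRingEnd ℂ) (y q r') *
          ((δ q.1).block r' κ * ((δ q.1).block r κ)ᴴ) k k := by
      intro r r'
      rw [Matrix.mul_apply, Fintype.sum_prod_type, Finset.mul_sum]
      refine Finset.sum_congr rfl fun i' _ => ?_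
      rw [Finset.mul_sum]
      refine Finset.sum_congr rfl fun m _ => ?_
      rw [Matrix.conjTranspose_apply, Complex.star_def]
      ring
    calc _ = ∑ r, ∑ r', ∑ i', ∑ m, (y q r * (starRingEnd ℂ) ((δ q.1).block r κ k (i', m))) *
        ((starRingEnd ℂ) (y q r') * (δ q.1).block r' κ k (i', m)) := by
          rw [Finset.sum_congr rfl fun i' _ => Finset.sum_comm, Finset.sum_comm]
          refine Finset.sum_congr rfl fun r _ => ?_
          rw [Finset.sum_congr rfl fun i' _ => Finset.sum_comm, Finset.sum_comm]
      _ = _ := by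
          simp only [h1]
          refine Finset.sum_congr rfl fun r _ => ?_
          rw [Finset.sum_eq_single r]
          · by_cases h : (δ q.1).comp r = κ
            · have h2 : (δ q.1).block r κ * ((δ q.1).block r κ)ᴴ = 1 := by
                clear h1 hinner hy y g f
                subst h
                exact (δ q.1).block_mul_conjTranspose_self r
              rw [h2, Matrix.one_apply_eq, mul_one]
            · rw [hy q r h]
              simp
          · intro r' _ hr
            rw [(δ q.1).block_mul_conjTranspose_of_ne hr, Matrix.zero_apply, mul_zero]
          · simp
  have hbessel : ∀ i', ∑ q ∈ F, ∑ m, ‖∑ r, y q r * star ((δ q.1).block r κ k (i', m))‖ ^ 2 ≤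
      ∫ h, ‖g i' h‖ ^ 2 ∂(haarProb G) := by
    intro i'
    rw [← Irrep.norm_toLp_sq]
    let e : (Σ q : Σ τ : Irrep G, Fin τ.dim, Fin q.1.dim) →
        Σ κ : Irrep G, Fin κ.dim × Fin κ.dim := fun z => ⟨z.1.1, (z.2, z.1.2)⟩
    have he : Function.Injective e := by
      rintro ⟨⟨τ, j⟩, m⟩ ⟨⟨τ', j'⟩, m'⟩ h
      obtain rfl : τ = τ' := congrArg Sigma.fst h
      obtain ⟨rfl, rfl⟩ := Prod.mk.inj (eq_of_heq (Sigma.mk.inj h).2)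
      rfl
    have h1 := (Irrep.orthonormal_coeffLp.comp e he).sum_inner_products_le
      (s := F.sigma fun q => Finset.univ) (ContinuousMap.toLp 2 (haarProb G) ℂ (g i'))
    rw [Finset.sum_sigma] at h1
    simp only [Function.comp_apply, e, hinner] at h1
    exact h1
  calc ∑ q ∈ F, ∑ r, ‖y q r‖ ^ 2
      = ∑ i', ∑ q ∈ F, ∑ m, ‖∑ r, y q r * star ((δ q.1).block r κ k (i', m))‖ ^ 2 := by
        rw [Finset.sum_comm]
        exact Finset.sum_congr rfl fun q _ => (hrow q).symm
    _ ≤ ∑ i', ∫ h, ‖g i' h‖ ^ 2 ∂(haarProb G) := Finset.sum_le_sum fun i' _ => hbessel i'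
    _ = ∫ h, ‖f h‖ ^ 2 ∂(haarProb G) := by
        have hint : ∀ i', MeasureTheory.Integrable (fun h => ‖g i' h‖ ^ 2) (haarProb G) := fun i' =>
          ((g i').continuous.norm.pow 2).integrable_of_hasCompactSupport
            (HasCompactSupport.of_compactSpace _)
        rw [← MeasureTheory.integral_finsetSum _ fun i' _ => hint i']
        refine MeasureTheory.integral_congr_ae (Filter.Eventually.of_forall fun h => ?_)
        change ∑ i', ‖star (σ.mat h i i') * f h‖ ^ 2 = ‖f h‖ ^ 2
        have h1 : ∑ i', ‖σ.mat h i i'‖ ^ 2 = 1 := by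
          apply Complex.ofReal_injective
          have h2 := congrFun (congrFun (σ.mat_mul_conjTranspose h) i) i
          rw [Matrix.mul_apply, Matrix.one_apply_eq] at h2
          push_cast
          rw [← h2]
          exact Finset.sum_congr rfl fun i' _ => (Complex.mul_conj' _).symm
        simp only [norm_mul, norm_star, mul_pow]
        rw [← Finset.sum_mul, h1, one_mul]
    _ = ∑ l, ‖c l‖ ^ 2 := by
        rw [← Irrep.norm_toLp_sq]
        have h1 : ContinuousMap.toLp 2 (haarProb G) ℂ f =
            ∑ l, c l • Irrep.coeffLp ⟨κ, (k, l)⟩ := by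
          have h2 : f = ∑ l, c l • (⟨κ.coeff k l, κ.continuous_coeff k l⟩ : C(G, ℂ)) := by
            ext h
            simp [f]
          rw [h2, map_sum]
          exact Finset.sum_congr rfl fun l _ => map_smul _ _ _
        have ho : Orthonormal ℂ fun l : Fin κ.dim => Irrep.coeffLp (G := G) ⟨κ, (k, l)⟩ :=
          Irrep.orthonormal_coeffLp.comp (fun l : Fin κ.dim => ⟨κ, (k, l)⟩) fun l l' h =>
            (Prod.mk.inj (eq_of_heq (Sigma.mk.inj h).2)).2
        rw [h1]
        have h3 := ho.inner_sum c c Finset.univ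
        rw [inner_self_eq_norm_sq_to_K] at h3
        apply Complex.ofReal_injective
        push_cast
        refine h3.trans (Finset.sum_congr rfl fun l _ => ?_)
        rw [mul_comm]
        exact Complex.mul_conj' _

/-- The estimate of `sum_norm_sq_block_le` for vectors in inner product spaces `E κ` and for all `κ`
together: each pair `(q, r)` belongs to a single `κ`. -/
lemma sum_norm_sq_smul_U_le {σ : Irrep G} (δ : ∀ τ, TensorDecomp σ τ) (i : Fin σ.dim)
    {E : Irrep G → Type*} [∀ κ, NormedAddCommGroup (E κ)] [∀ κ, InnerProductSpace ℂ (E κ)]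
    (ξ : ∀ κ : Irrep G, Fin κ.dim → E κ) {M : ℝ}
    (hξ : ∀ K : Finset (Irrep G), ∑ κ ∈ K, ∑ l, ‖ξ κ l‖ ^ 2 ≤ M)
    (F : Finset (Σ τ : Irrep G, Fin τ.dim)) :
    ∑ q ∈ F, ∑ r, ‖∑ l, (((Real.sqrt q.1.dim / Real.sqrt ((δ q.1).comp r).dim : ℝ) : ℂ) *
      (δ q.1).U ⟨r, l⟩ (i, q.2)) • ξ ((δ q.1).comp r) l‖ ^ 2 ≤ M := by
  classical
  let K : Finset (Irrep G) := F.biUnion fun q => Finset.univ.image (δ q.1).comp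
  let t : ∀ (q : Σ τ : Irrep G, Fin τ.dim) (_ : Fin (δ q.1).num) (κ : Irrep G), ℝ := fun q r κ =>
    ‖∑ l, (((Real.sqrt q.1.dim / Real.sqrt κ.dim : ℝ) : ℂ) *
      (δ q.1).block r κ l (i, q.2)) • ξ κ l‖ ^ 2
  have ht : ∀ q ∈ F, ∀ r, ‖∑ l, (((Real.sqrt q.1.dim /
      Real.sqrt ((δ q.1).comp r).dim : ℝ) : ℂ) * (δ q.1).U ⟨r, l⟩ (i, q.2)) •
      ξ ((δ q.1).comp r) l‖ ^ 2 = ∑ κ ∈ K, t q r κ := by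
    intro q hq r
    rw [Finset.sum_eq_single ((δ q.1).comp r)]
    · simp only [t, TensorDecomp.block_self]
    · intro κ _ hκ
      simp [t, (δ q.1).block_of_ne hκ.symm]
    · intro h
      exact absurd (Finset.mem_biUnion.2
        ⟨q, hq, Finset.mem_image_of_mem _ (Finset.mem_univ r)⟩) h
  calc _ = ∑ q ∈ F, ∑ r, ∑ κ ∈ K, t q r κ :=
        Finset.sum_congr rfl fun q hq => Finset.sum_congr rfl fun r _ => ht q hq r
    _ = ∑ κ ∈ K, ∑ q ∈ F, ∑ r, t q r κ := by
        rw [Finset.sum_congr rfl fun q _ => Finset.sum_comm, Finset.sum_comm]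
    _ ≤ ∑ κ ∈ K, ∑ l, ‖ξ κ l‖ ^ 2 := by
        refine Finset.sum_le_sum fun κ _ => ?_
        have h1 := sum_norm_sq_smul_le (F.sigma fun q => (Finset.univ : Finset (Fin (δ q.1).num)))
          (fun z l => ((Real.sqrt z.1.1.dim / Real.sqrt κ.dim : ℝ) : ℂ) *
            (δ z.1.1).block z.2 κ l (i, z.1.2)) (fun c => by
              rw [Finset.sum_sigma]
              exact sum_norm_sq_block_le δ i κ F c) (ξ κ)
        rw [Finset.sum_sigma] at h1
        exact h1
    _ ≤ M := hξ K

end Multiplication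

/-! ### The factor system and the operator blocks -/

section FactorSystem

variable {G A : Type*} [Group G] [TopologicalSpace G] [CStarAlgebra A] {α : CStarSystem G A}

lemma conjTranspose_kronecker_one {I J L : Type*} [DecidableEq L] (X : Matrix I J A) :
    (X ⊗ₖ (1 : Matrix L L A))ᴴ = Xᴴ ⊗ₖ (1 : Matrix L L A) := by
  ext ⟨j, l⟩ ⟨i, l'⟩
  by_cases h : l = l'
  · subst h; simp
  · simp [h, Ne.symm h]

lemma conjTranspose_one_kronecker {I J L : Type*} [DecidableEq L] (X : Matrix I J A) :
    ((1 : Matrix L L A) ⊗ₖ X)ᴴ = (1 : Matrix L L A) ⊗ₖ Xᴴ := by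
  ext ⟨l, j⟩ ⟨l', i⟩
  by_cases h : l = l'
  · subst h; simp
  · simp [h, Ne.symm h]

lemma map_subtype_injective {I J : Type*} {M N : Matrix I J α.fixedAlg}
    (h : M.map (α.fixedAlg.subtype) = N.map (α.fixedAlg.subtype)) : M = N :=
  Matrix.map_injective Subtype.val_injective h

namespace IsometryFamily

variable (S : IsometryFamily α)

lemma coaction_map (σ : Irrep G) (b : α.fixedAlg) :
    (S.coaction σ b).map α.fixedAlg.subtype = S.coactionMat σ b := rfl

lemma conjTranspose_mul_coactionMat (σ : Irrep G) (b : A) :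
    (S.s σ)ᴴ * S.coactionMat σ b =
      (Matrix.diagonal (fun _ => b) : Matrix (Fin σ.dim) (Fin σ.dim) A) * (S.s σ)ᴴ := by
  rw [coactionMat, Matrix.mul_assoc, ← Matrix.mul_assoc, S.isometry, Matrix.one_mul]

lemma coactionMat_mul (σ : Irrep G) (b b' : A) :
    S.coactionMat σ (b * b') = S.coactionMat σ b * S.coactionMat σ b' := by
  conv_rhs => rw [coactionMat]
  rw [Matrix.mul_assoc, conjTranspose_mul_coactionMat, ← Matrix.mul_assoc,
    Matrix.mul_assoc (S.s σ), Matrix.diagonal_mul_diagonal]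
  rfl

lemma coactionMat_star (σ : Irrep G) (b : A) :
    S.coactionMat σ (star b) = (S.coactionMat σ b)ᴴ := by
  rw [coactionMat, coactionMat, Matrix.conjTranspose_mul, Matrix.conjTranspose_mul,
    Matrix.conjTranspose_conjTranspose, Matrix.diagonal_conjTranspose, Matrix.mul_assoc]
  rfl

lemma coaction_mul (σ : Irrep G) (b b' : α.fixedAlg) :
    S.coaction σ (b * b') = S.coaction σ b * S.coaction σ b' :=
  map_subtype_injective (by
    rw [Matrix.map_mul, coaction_map, coaction_map, coaction_map]
    exact S.coactionMat_mul σ b b')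

lemma coaction_star (σ : Irrep G) (b : α.fixedAlg) :
    S.coaction σ (star b) = (S.coaction σ b)ᴴ :=
  map_subtype_injective (S.coactionMat_star σ b)

lemma coaction_add (σ : Irrep G) (b b' : α.fixedAlg) :
    S.coaction σ (b + b') = S.coaction σ b + S.coaction σ b' := by
  refine map_subtype_injective ?_
  have h : (Matrix.diagonal (fun _ => (b : A) + b') : Matrix (Fin σ.dim) (Fin σ.dim) A) =
      Matrix.diagonal (fun _ => (b : A)) + Matrix.diagonal (fun _ => (b' : A)) :=
    (Matrix.diagonal_add _ _).symm
  change S.s σ * (Matrix.diagonal (fun _ => (b : A) + b') : Matrix (Fin σ.dim) (Fin σ.dim) A) *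
      (S.s σ)ᴴ =
    S.coactionMat σ b + S.coactionMat σ b'
  rw [h, Matrix.mul_add, Matrix.add_mul]
  rfl

lemma coaction_smul (σ : Irrep G) (c : ℂ) (b : α.fixedAlg) :
    S.coaction σ (c • b) = c • S.coaction σ b := by
  refine map_subtype_injective ?_
  have h : (Matrix.diagonal (fun _ => c • (b : A)) : Matrix (Fin σ.dim) (Fin σ.dim) A) =
      c • Matrix.diagonal (fun _ => (b : A)) :=
    Matrix.diagonal_smul c fun _ : Fin σ.dim => (b : A)
  change S.s σ * (Matrix.diagonal (fun _ => c • (b : A)) : Matrix (Fin σ.dim) (Fin σ.dim) A) *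
      (S.s σ)ᴴ = c • S.coactionMat σ b
  rw [h, Matrix.mul_smul, Matrix.smul_mul]
  rfl

lemma sTensor_mul_conjTranspose {σ τ : Irrep G} (δ : TensorDecomp σ τ) :
    S.sTensor δ * (S.sTensor δ)ᴴ =
      Matrix.blockDiagonal' fun r => S.coactionMat (δ.comp r) 1 := by
  rw [sTensor, Matrix.conjTranspose_mul, ← scalarMat_conjTranspose, Matrix.mul_assoc,
    ← Matrix.mul_assoc (scalarMat A δ.U), ← scalarMat_mul, δ.mul_conjTranspose_U, scalarMat_one,
    Matrix.one_mul, Matrix.blockDiagonal'_conjTranspose, ← Matrix.blockDiagonal'_mul]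
  congr 1
  funext r
  rw [coactionMat, Matrix.diagonal_one, Matrix.mul_one]

lemma blockDiagonal_mul_sTensor {σ τ : Irrep G} (δ : TensorDecomp σ τ) :
    (Matrix.blockDiagonal' fun r => S.coactionMat (δ.comp r) 1) * S.sTensor δ = S.sTensor δ := by
  rw [sTensor, ← Matrix.mul_assoc, ← Matrix.blockDiagonal'_mul]
  congr 2
  funext r
  rw [coactionMat, Matrix.diagonal_one, Matrix.mul_one, Matrix.mul_assoc, S.isometry,
    Matrix.mul_one]

/-- The final projection of `ω(σ, τ)` is the direct sum of the projections `p(κ)` over the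
components `κ` of `σ ⊗ τ`. -/
lemma cocycle_mul_conjTranspose {σ τ : Irrep G} (δ : TensorDecomp σ τ) :
    S.cocycle δ * (S.cocycle δ)ᴴ = Matrix.blockDiagonal' fun r => S.proj (δ.comp r) := by
  refine map_subtype_injective ?_
  rw [Matrix.map_mul, Matrix.blockDiagonal'_map _ _ (map_zero _)]
  change S.cocycleMat δ * (S.cocycleMat δ)ᴴ =
    Matrix.blockDiagonal' fun r => S.coactionMat (δ.comp r) 1
  have hR : ((S.s σ)ᴴ ⊗ₖ (1 : Matrix (Fin τ.dim) (Fin τ.dim) A)) *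
      (S.s σ ⊗ₖ (1 : Matrix (Fin τ.dim) (Fin τ.dim) A)) = 1 := by
    rw [← mul_kronecker_one, S.isometry]
    exact Matrix.kroneckerMap_one_one _ (by simp) (by simp) (by simp)
  have hV : ((1 : Matrix (Fin (S.mult σ)) (Fin (S.mult σ)) A) ⊗ₖ (S.s τ)ᴴ) *
      ((1 : Matrix (Fin (S.mult σ)) (Fin (S.mult σ)) A) ⊗ₖ S.s τ) = 1 := by
    rw [← one_kronecker_mul, S.isometry]
    exact Matrix.kroneckerMap_one_one _ (by simp) (by simp) (by simp)
  rw [← sTensor_mul_conjTranspose, cocycleMat, Matrix.conjTranspose_mul, Matrix.conjTranspose_mul,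
    conjTranspose_kronecker_one, conjTranspose_one_kronecker, Matrix.conjTranspose_conjTranspose,
    Matrix.conjTranspose_conjTranspose]
  generalize (S.s σ)ᴴ ⊗ₖ (1 : Matrix (Fin τ.dim) (Fin τ.dim) A) = R at hR ⊢
  generalize S.s σ ⊗ₖ (1 : Matrix (Fin τ.dim) (Fin τ.dim) A) = R' at hR ⊢
  generalize (1 : Matrix (Fin (S.mult σ)) (Fin (S.mult σ)) A) ⊗ₖ (S.s τ)ᴴ = V at hV ⊢
  generalize (1 : Matrix (Fin (S.mult σ)) (Fin (S.mult σ)) A) ⊗ₖ S.s τ = V' at hV ⊢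
  calc S.sTensor δ * R * V * (V' * (R' * (S.sTensor δ)ᴴ))
      = S.sTensor δ * (R * ((V * V') * R')) * (S.sTensor δ)ᴴ := by simp only [Matrix.mul_assoc]
    _ = S.sTensor δ * (S.sTensor δ)ᴴ := by rw [hV, Matrix.one_mul, hR, Matrix.mul_one]

lemma blockDiagonal_mul_cocycle {σ τ : Irrep G} (δ : TensorDecomp σ τ) :
    (Matrix.blockDiagonal' fun r => S.proj (δ.comp r)) * S.cocycle δ = S.cocycle δ := by
  refine map_subtype_injective ?_
  rw [Matrix.map_mul, Matrix.blockDiagonal'_map _ _ (map_zero _)]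
  change (Matrix.blockDiagonal' fun r => S.coactionMat (δ.comp r) 1) * S.cocycleMat δ =
    S.cocycleMat δ
  rw [cocycleMat, ← Matrix.mul_assoc, ← Matrix.mul_assoc, blockDiagonal_mul_sTensor]

/-- The matrix `ω(σ, τ) (e_a ⊗ γ_τ(b))`, which governs how `a_σ(b ⊗ e_a ⊗ v̄)` acts on the summand
of `H_p` belonging to `τ`. -/
noncomputable def shift {σ τ : Irrep G} (δ : TensorDecomp σ τ) (a : Fin (S.mult σ))
    (b : α.fixedAlg) : Matrix (Σ r, Fin (S.mult (δ.comp r))) (Fin (S.mult τ)) α.fixedAlg :=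
  (S.cocycle δ).submatrix id (fun e => (a, e)) * S.coaction τ b

/-- The matrix of `s(σ)* e_a ⊗ b s(τ)*`, from `H_τ` to `V_σ ⊗ V_τ`. -/
def legs (σ τ : Irrep G) (a : Fin (S.mult σ)) (b : A) :
    Matrix (Fin σ.dim × Fin τ.dim) (Fin (S.mult τ)) A :=
  Matrix.of fun x d => star (S.s σ a x.1) * (b * star (S.s τ d x.2))

lemma shift_map {σ τ : Irrep G} (δ : TensorDecomp σ τ) (a : Fin (S.mult σ)) (b : α.fixedAlg) :
    (S.shift δ a b).map α.fixedAlg.subtype = S.sTensor δ * S.legs σ τ a b := by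
  rw [shift, Matrix.map_mul, coaction_map]
  change (S.cocycleMat δ).submatrix id (fun e => (a, e)) * S.coactionMat τ b = _
  rw [cocycleMat, Matrix.mul_assoc]
  generalize S.sTensor δ = X
  have h1 : (X * (((S.s σ)ᴴ ⊗ₖ (1 : Matrix (Fin τ.dim) (Fin τ.dim) A)) *
      ((1 : Matrix (Fin (S.mult σ)) (Fin (S.mult σ)) A) ⊗ₖ (S.s τ)ᴴ))).submatrix id
      (fun e => (a, e)) = X * (((S.s σ)ᴴ ⊗ₖ (1 : Matrix (Fin τ.dim) (Fin τ.dim) A)) *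
      ((1 : Matrix (Fin (S.mult σ)) (Fin (S.mult σ)) A) ⊗ₖ (S.s τ)ᴴ)).submatrix id
      (fun e => (a, e)) := rfl
  rw [h1, Matrix.mul_assoc]
  congr 1
  ext ⟨i', m⟩ d
  have h2 : ∀ e, (((S.s σ)ᴴ ⊗ₖ (1 : Matrix (Fin τ.dim) (Fin τ.dim) A)) *
      ((1 : Matrix (Fin (S.mult σ)) (Fin (S.mult σ)) A) ⊗ₖ (S.s τ)ᴴ)) (i', m) (a, e) =
      star (S.s σ a i') * (S.s τ)ᴴ m e := by
    intro e
    rw [Matrix.mul_apply, Fintype.sum_prod_type, Finset.sum_eq_single a, Finset.sum_eq_single m]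
    · simp
    · intro m' _ hm
      simp [Ne.symm hm]
    · simp
    · intro a' _ ha
      simp [ha]
    · simp
  rw [Matrix.mul_apply]
  simp only [Matrix.submatrix_apply, id, h2, mul_assoc]
  rw [← Finset.mul_sum, ← Matrix.mul_apply, conjTranspose_mul_coactionMat, Matrix.diagonal_mul]
  rfl

open Classical in
/-- The rows of `shift` that belong to the `r`-th component of `σ ⊗ τ`, or zero if this component
is not `κ`. -/
noncomputable def shiftRow {σ τ : Irrep G} (δ : TensorDecomp σ τ) (a : Fin (S.mult σ))
    (b : α.fixedAlg) (r : Fin δ.num) (κ : Irrep G) :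
    Matrix (Fin (S.mult κ)) (Fin (S.mult τ)) α.fixedAlg :=
  if h : δ.comp r = κ then
    Matrix.of fun c d => S.shift δ a b ⟨r, Fin.cast (congrArg S.mult h.symm) c⟩ d
  else 0

lemma shiftRow_self {σ τ : Irrep G} (δ : TensorDecomp σ τ) (a : Fin (S.mult σ))
    (b : α.fixedAlg) (r : Fin δ.num) (c : Fin (S.mult (δ.comp r))) (d : Fin (S.mult τ)) :
    S.shiftRow δ a b r (δ.comp r) c d = S.shift δ a b ⟨r, c⟩ d := by
  rw [shiftRow, dif_pos rfl]
  rfl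

lemma shiftRow_of_ne {σ τ : Irrep G} (δ : TensorDecomp σ τ) (a : Fin (S.mult σ))
    (b : α.fixedAlg) {r : Fin δ.num} {κ : Irrep G} (h : δ.comp r ≠ κ) :
    S.shiftRow δ a b r κ = 0 := dif_neg h

lemma shiftRow_map {σ τ : Irrep G} (δ : TensorDecomp σ τ) (a : Fin (S.mult σ))
    (b : α.fixedAlg) (r : Fin δ.num) (κ : Irrep G) :
    (S.shiftRow δ a b r κ).map α.fixedAlg.subtype =
      S.s κ * (scalarMat A (δ.block r κ) * S.legs σ τ a b) := by
  by_cases h : δ.comp r = κ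
  · subst h
    ext c d
    have h1 := congrFun (congrFun (S.shift_map δ a b) ⟨r, c⟩) d
    rw [sTensor, Matrix.mul_assoc, Matrix.mul_apply, Fintype.sum_sigma,
      Finset.sum_eq_single r] at h1
    · rw [Matrix.map_apply, shiftRow_self]
      refine h1.trans ?_
      rw [Matrix.mul_apply]
      refine Finset.sum_congr rfl fun k _ => ?_
      rw [Matrix.blockDiagonal'_apply_eq]
      congr 1
      rw [Matrix.mul_apply, Matrix.mul_apply]
      refine Finset.sum_congr rfl fun x _ => ?_
      rw [scalarMat, scalarMat, Matrix.map_apply, Matrix.map_apply, δ.block_self]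
    · intro r' _ hr
      exact Finset.sum_eq_zero fun k _ => by
        rw [Matrix.blockDiagonal'_apply_ne _ _ _ hr.symm, zero_mul]
    · simp
  · rw [shiftRow_of_ne _ _ _ _ h, δ.block_of_ne h]
    ext c d
    simp [scalarMat]

lemma act_star_mul_apply (σ : Irrep G) (a : Fin (S.mult σ)) (i : Fin σ.dim) (b : α.fixedAlg)
    (h : G) : α.act h⁻¹ (star (S.s σ a i) * b) =
      ∑ i', σ.mat h i i' • (star (S.s σ a i') * (b : A)) := by
  have h1 : α.act h⁻¹ (S.s σ a i) = ∑ i', S.s σ a i' * algebraMap ℂ A (σ.mat h⁻¹ i' i) :=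
    congrFun (congrFun (S.equivariant σ h⁻¹) a) i
  have h2 : ∀ i', σ.mat h⁻¹ i' i = star (σ.mat h i i') := by
    intro i'
    have : σ.mat h⁻¹ = (σ.mat h)ᴴ := by
      calc σ.mat h⁻¹ = σ.mat h⁻¹ * (σ.mat h * (σ.mat h)ᴴ) := by
            rw [σ.mat_mul_conjTranspose, Matrix.mul_one]
        _ = (σ.mat h)ᴴ := by
            rw [← Matrix.mul_assoc, ← σ.mat_mul, inv_mul_cancel, σ.mat_one, Matrix.one_mul]
    rw [this]
    rfl
  rw [map_mul, map_star, b.2 h⁻¹, h1, star_sum, Finset.sum_mul]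
  refine Finset.sum_congr rfl fun i' _ => ?_
  rw [h2, star_mul, algebraMap_star_comm, star_star, ← Algebra.smul_def, smul_mul_assoc]

variable [IsTopologicalGroup G] [CompactSpace G] [MeasurableSpace G] [BorelSpace G]

lemma multBlock_star_mul {σ τ : Irrep G} (δ : TensorDecomp σ τ) (a : Fin (S.mult σ))
    (i : Fin σ.dim) (b : α.fixedAlg) (κ : Irrep G) (l : Fin κ.dim) (j : Fin τ.dim)
    (k : Fin κ.dim) (m : Fin τ.dim) :
    multBlock α (star (S.s σ a i) * b) κ l τ j k m =
      ∑ r, ((((Real.sqrt τ.dim / Real.sqrt κ.dim : ℝ) : ℂ) * star (δ.block r κ l (i, j))) •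
        ∑ i', δ.block r κ k (i', m) • (star (S.s σ a i') * (b : A))) := by
  have hint : ∀ i', MeasureTheory.Integrable (fun h => (star (κ.coeff k l h) * τ.coeff m j h *
      σ.mat h i i') • (star (S.s σ a i') * (b : A))) (haarProb G) := fun i' =>
    (Irrep.integrable_of_continuous (((κ.continuous_coeff k l).star.mul
      (τ.continuous_coeff m j)).mul (σ.continuous_mat_apply i i'))).smul_const _
  rw [multBlock, Matrix.of_apply]
  simp only [act_star_mul_apply, Finset.smul_sum, smul_smul]
  rw [MeasureTheory.integral_finsetSum _ fun i' _ => hint i', Finset.sum_comm]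
  refine Finset.sum_congr rfl fun i' _ => ?_
  rw [integral_smul_const, δ.integral_coeff_mul, Finset.sum_smul]

lemma repBlock_star_mul {σ τ : Irrep G} (δ : TensorDecomp σ τ) (a : Fin (S.mult σ))
    (i : Fin σ.dim) (b : α.fixedAlg) (κ : Irrep G) (l : Fin κ.dim) (j : Fin τ.dim) :
    S.repBlock (star (S.s σ a i) * b) κ l τ j =
      ∑ r, (((Real.sqrt τ.dim / Real.sqrt κ.dim : ℝ) : ℂ) * star (δ.block r κ l (i, j))) •
        S.shiftRow δ a b r κ := by
  let Y : Matrix (Fin σ.dim × Fin τ.dim) (Fin τ.dim) A := Matrix.of fun x m =>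
    if x.2 = m then star (S.s σ a x.1) * (b : A) else 0
  have hM : multBlock α (star (S.s σ a i) * (b : A)) κ l τ j =
      ∑ r, (((Real.sqrt τ.dim / Real.sqrt κ.dim : ℝ) : ℂ) * star (δ.block r κ l (i, j))) •
        (scalarMat A (δ.block r κ) * Y) := by
    ext k m
    rw [S.multBlock_star_mul δ, Matrix.sum_apply]
    refine Finset.sum_congr rfl fun r _ => ?_
    rw [Matrix.smul_apply, Matrix.mul_apply, Fintype.sum_prod_type]
    congr 1
    refine Finset.sum_congr rfl fun i' _ => ?_
    rw [Finset.sum_eq_single m]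
    · simp [Y, scalarMat, Algebra.smul_def]
    · intro m' _ hm
      simp [Y, hm]
    · simp
  have hY : Y * (S.s τ)ᴴ = S.legs σ τ a b := by
    ext ⟨i', m⟩ d
    rw [Matrix.mul_apply, Finset.sum_eq_single m]
    · simp [Y, legs, mul_assoc]
    · intro m' _ hm
      simp [Y, Ne.symm hm]
    · simp
  refine map_subtype_injective ?_
  change S.repBlockMat (star (S.s σ a i) * b) κ l τ j = _
  have hR : (∑ r, (((Real.sqrt τ.dim / Real.sqrt κ.dim : ℝ) : ℂ) *
      star (δ.block r κ l (i, j))) • S.shiftRow δ a b r κ).map α.fixedAlg.subtype =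
      ∑ r, (((Real.sqrt τ.dim / Real.sqrt κ.dim : ℝ) : ℂ) * star (δ.block r κ l (i, j))) •
        (S.shiftRow δ a b r κ).map α.fixedAlg.subtype := by
    ext c d
    simp [Matrix.sum_apply]
  rw [hR, repBlockMat, hM, Matrix.mul_sum, Matrix.sum_mul]
  refine Finset.sum_congr rfl fun r _ => ?_
  rw [shiftRow_map, Matrix.mul_smul, Matrix.smul_mul, Matrix.mul_assoc, Matrix.mul_assoc, hY]

lemma proj_mul_repBlock (x : A) (κ : Irrep G) (l : Fin κ.dim) (τ : Irrep G) (j : Fin τ.dim) :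
    S.proj κ * S.repBlock x κ l τ j = S.repBlock x κ l τ j := by
  refine map_subtype_injective ?_
  rw [Matrix.map_mul]
  change S.coactionMat κ 1 * S.repBlockMat x κ l τ j = S.repBlockMat x κ l τ j
  rw [coactionMat, Matrix.diagonal_one, Matrix.mul_one, repBlockMat, Matrix.mul_assoc (S.s κ),
    Matrix.mul_assoc (S.s κ), ← Matrix.mul_assoc (S.s κ)ᴴ, S.isometry, Matrix.one_mul]

lemma repBlock_add (x y : A) (κ : Irrep G) (l : Fin κ.dim) (τ : Irrep G) (j : Fin τ.dim) :
    S.repBlock (x + y) κ l τ j = S.repBlock x κ l τ j + S.repBlock y κ l τ j := by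
  refine map_subtype_injective ?_
  have h : multBlock α (x + y) κ l τ j = multBlock α x κ l τ j + multBlock α y κ l τ j := by
    ext k m
    simp only [multBlock, Matrix.of_apply, Matrix.add_apply, map_add, smul_add]
    exact MeasureTheory.integral_add (integrable_multBlock α x κ k l τ m j)
      (integrable_multBlock α y κ k l τ m j)
  change S.repBlockMat (x + y) κ l τ j = S.repBlockMat x κ l τ j + S.repBlockMat y κ l τ j
  rw [repBlockMat, h, Matrix.mul_add, Matrix.add_mul]
  rfl

lemma repBlock_smul (c : ℂ) (x : A) (κ : Irrep G) (l : Fin κ.dim) (τ : Irrep G)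
    (j : Fin τ.dim) : S.repBlock (c • x) κ l τ j = c • S.repBlock x κ l τ j := by
  refine map_subtype_injective ?_
  have h : multBlock α (c • x) κ l τ j = c • multBlock α x κ l τ j := by
    ext k m
    simp only [multBlock, Matrix.of_apply, Matrix.smul_apply, map_smul]
    rw [← MeasureTheory.integral_smul]
    simp only [smul_comm c]
  change S.repBlockMat (c • x) κ l τ j = c • S.repBlockMat x κ l τ j
  rw [repBlockMat, h, Matrix.mul_smul, Matrix.smul_mul]
  rfl

end IsometryFamily

end FactorSystem

/-! ### Matrices over a represented C*-algebra as operators -/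

section MatrixOperators

lemma norm_comp_injective_le {H : Type*} [NormedAddCommGroup H] {I K : Type*} [Fintype I]
    [Fintype K] {f : K → I} (hf : Function.Injective f) (v : PiLp 2 fun _ : I => H)
    (u : PiLp 2 fun _ : K => H) (hu : ∀ k, u k = v (f k)) : ‖u‖ ≤ ‖v‖ := by
  classical
  refine (sq_le_sq₀ (norm_nonneg _) (norm_nonneg _)).1 ?_
  rw [PiLp.norm_sq_eq_of_L2, PiLp.norm_sq_eq_of_L2]
  simp only [hu]
  rw [← Finset.sum_image (f := fun i => ‖v i‖ ^ 2) fun x _ y _ h => hf h]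
  exact Finset.sum_le_sum_of_subset_of_nonneg (Finset.subset_univ _) fun _ _ _ => by positivity

open scoped InnerProductSpace

variable {B H : Type*} [CStarAlgebra B] [NormedAddCommGroup H] [InnerProductSpace ℂ H]
  [CompleteSpace H] (π : B →⋆ₐ[ℂ] (H →L[ℂ] H)) {I J K : Type*} [Fintype I] [Fintype J] [Fintype K]

lemma matOp_apply (M : Matrix I J B) (ξ : PiLp 2 fun _ : J => H) (i : I) :
    matOp π M ξ i = ∑ j, π (M i j) (ξ j) := by
  simp [matOp]

lemma matOp_mul (M : Matrix I J B) (N : Matrix J K B) :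
    matOp π (M * N) = matOp π M ∘L matOp π N := by
  ext ξ i
  rw [ContinuousLinearMap.comp_apply, matOp_apply, matOp_apply]
  simp only [matOp_apply, Matrix.mul_apply, map_sum, map_mul, _root_.sum_apply,
    mul_apply_eq_comp]
  exact Finset.sum_comm

lemma matOp_add (M N : Matrix I J B) : matOp π (M + N) = matOp π M + matOp π N := by
  ext ξ i
  rw [_root_.add_apply, PiLp.add_apply, matOp_apply, matOp_apply, matOp_apply]
  simp [Finset.sum_add_distrib]

lemma matOp_smul (c : ℂ) (M : Matrix I J B) : matOp π (c • M) = c • matOp π M := by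
  ext ξ i
  rw [_root_.smul_apply, PiLp.smul_apply, matOp_apply, matOp_apply]
  simp [Finset.smul_sum]

lemma matOp_zero : matOp π (0 : Matrix I J B) = 0 := by
  ext ξ i
  rw [matOp_apply]
  simp

lemma matOp_sum {R : Type*} (s : Finset R) (M : R → Matrix I J B) :
    matOp π (∑ r ∈ s, M r) = ∑ r ∈ s, matOp π (M r) := by
  classical
  induction s using Finset.induction_on with
  | empty => simp [matOp_zero]
  | insert r s hr ih => rw [Finset.sum_insert hr, Finset.sum_insert hr, matOp_add, ih]

lemma adjoint_matOp (M : Matrix I J B) :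
    ContinuousLinearMap.adjoint (matOp π M) = matOp π Mᴴ := by
  symm
  rw [ContinuousLinearMap.eq_adjoint_iff]
  intro ξ η
  simp only [PiLp.inner_apply, matOp_apply, sum_inner, inner_sum, Matrix.conjTranspose_apply,
    map_star, ContinuousLinearMap.star_eq_adjoint, ContinuousLinearMap.adjoint_inner_left]
  exact Finset.sum_comm

/-- A matrix `M` with `M Mᴴ M = M` acts as a partial isometry. -/
lemma norm_matOp_le_one {M : Matrix I J B} (hM : M * Mᴴ * M = M) : ‖matOp π M‖ ≤ 1 := by
  refine ContinuousLinearMap.opNorm_le_bound _ zero_le_one fun ξ => ?_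
  rw [one_mul]
  have h1 : matOp π M (matOp π Mᴴ (matOp π M ξ)) = matOp π M ξ := by
    conv_rhs => rw [← hM, matOp_mul, matOp_mul]
    rfl
  have h2 : ‖matOp π M ξ‖ ^ 2 = RCLike.re ⟪matOp π Mᴴ (matOp π M ξ), ξ⟫_ℂ := by
    rw [← adjoint_matOp, ContinuousLinearMap.adjoint_inner_left, inner_self_eq_norm_sq]
  have h3 : ‖matOp π Mᴴ (matOp π M ξ)‖ ^ 2 = ‖matOp π M ξ‖ ^ 2 := by
    rw [← inner_self_eq_norm_sq (𝕜 := ℂ), ← inner_self_eq_norm_sq (𝕜 := ℂ)]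
    conv_lhs => rw [← adjoint_matOp, ContinuousLinearMap.adjoint_inner_left, adjoint_matOp, h1]
  have h4 : ‖matOp π Mᴴ (matOp π M ξ)‖ = ‖matOp π M ξ‖ :=
    (sq_eq_sq₀ (norm_nonneg _) (norm_nonneg _)).1 h3
  have h5 : ‖matOp π M ξ‖ ^ 2 ≤ ‖matOp π M ξ‖ * ‖ξ‖ := by
    rw [h2, ← h4]
    exact re_inner_le_norm _ _
  rcases (norm_nonneg (matOp π M ξ)).eq_or_lt with h | h
  · rw [← h]; positivity
  · rw [sq] at h5
    exact le_of_mul_le_mul_left h5 h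

lemma norm_matOp_submatrix_le (M : Matrix I J B) {f : K → I} (hf : Function.Injective f) :
    ‖matOp π (M.submatrix f id)‖ ≤ ‖matOp π M‖ :=
  ContinuousLinearMap.opNorm_le_bound _ (ContinuousLinearMap.opNorm_nonneg _) fun ξ =>
    (norm_comp_injective_le hf (matOp π M ξ) _ fun k => by
      rw [matOp_apply, matOp_apply]; rfl).trans (ContinuousLinearMap.le_opNorm _ _)

lemma CommutatorBound.submatrix {D : H →ₗ.[ℂ] H} {M : Matrix I J B} {C : ℝ}
    (h : CommutatorBound (ampl D J) (ampl D I) (matOp π M) C) {f : K → I}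
    (hf : Function.Injective f) :
    CommutatorBound (ampl D J) (ampl D K) (matOp π (M.submatrix f id)) C := by
  intro ξ
  obtain ⟨h1, h2⟩ := h ξ
  have h3 : ∀ (η : PiLp 2 fun _ : J => H) k,
      matOp π (M.submatrix f id) η k = matOp π M η (f k) := fun η k => by
    rw [matOp_apply, matOp_apply]; rfl
  have hmem : matOp π (M.submatrix f id) ξ ∈ (ampl D K).domain := fun k => by
    rw [h3]
    exact h1 (f k)
  refine ⟨hmem, (norm_comp_injective_le hf _ _ fun k => ?_).trans h2⟩
  rw [PiLp.sub_apply, PiLp.sub_apply, h3]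
  congr 1

end MatrixOperators

/-! ### Operators into Hilbert space direct sums -/

section DirectSums

variable {ι : Type*} {X : ι → Type*} [∀ i, NormedAddCommGroup (X i)]
  [∀ i, InnerProductSpace ℂ (X i)]

lemma exists_clm_lp {E : Type*} [NormedAddCommGroup E] [InnerProductSpace ℂ E]
    (L : ∀ i, E →ₗ[ℂ] X i) {C : ℝ} (hC : 0 ≤ C)
    (hL : ∀ ξ (F : Finset ι), ∑ i ∈ F, ‖L i ξ‖ ^ 2 ≤ (C * ‖ξ‖) ^ 2) :
    ∃ T : E →L[ℂ] lp X 2, ∀ ξ i, T ξ i = L i ξ := by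
  refine ⟨LinearMap.mkContinuous
    { toFun := fun ξ => ⟨fun i => L i ξ, memℓp_two_of_sum_sq_le (hL ξ)⟩
      map_add' := fun ξ η => lp.ext (funext fun i => map_add (L i) ξ η)
      map_smul' := fun c ξ => lp.ext (funext fun i => map_smul (L i) c ξ) } C fun ξ =>
    lp_norm_le_of_sum_sq_le (by positivity) (hL ξ), fun _ _ => rfl⟩

lemma commutatorBound_directSumOp {E : Type*} [NormedAddCommGroup E] [InnerProductSpace ℂ E]
    {D : E →ₗ.[ℂ] E} {T : ∀ i, X i →ₗ.[ℂ] X i} (L : E →L[ℂ] lp X 2) {C : ℝ} (hC : 0 ≤ C)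
    (h : ∀ ξ : D.domain, ∃ h : ∀ i, L ξ i ∈ (T i).domain,
      ∀ F : Finset ι, ∑ i ∈ F, ‖T i ⟨L ξ i, h i⟩ - L (D ξ) i‖ ^ 2 ≤ (C * ‖(ξ : E)‖) ^ 2) :
    CommutatorBound D (directSumOp T) L C := by
  intro ξ
  obtain ⟨h1, h2⟩ := h ξ
  have h3 : Memℓp (fun i => T i ⟨L ξ i, h1 i⟩) 2 := by
    convert (memℓp_two_of_sum_sq_le h2).add (lp.memℓp (L (D ξ))) using 1
    funext i
    exact (sub_add_cancel _ _).symm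
  exact ⟨⟨h1, h3⟩, lp_norm_le_of_sum_sq_le (by positivity) h2⟩

end DirectSums

/-! ### The fibers of the horizontal lift -/

section Fibers

open scoped InnerProductSpace

variable {G A H : Type*} [Group G] [TopologicalSpace G] [CStarAlgebra A]
  [NormedAddCommGroup H] [InnerProductSpace ℂ H] [CompleteSpace H]
  {α : CStarSystem G A} (S : IsometryFamily α) (𝒟 : SpectralTriple α.fixedAlg H)

/-- The representation of `B` on `H_B ⊗ H_σ` given by the coaction `γ_σ`; it is not unital. -/
noncomputable def coactionRep (σ : Irrep G) : α.fixedAlg →⋆ₙₐ[ℂ]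
    (PiLp 2 (fun _ : Fin (S.mult σ) => H) →L[ℂ] PiLp 2 (fun _ : Fin (S.mult σ) => H)) where
  toFun b := matOp 𝒟.π (S.coaction σ b)
  map_smul' c b := by rw [S.coaction_smul, matOp_smul]; rfl
  map_zero' := by
    have h := S.coaction_smul σ 0 0
    rw [zero_smul, zero_smul] at h
    rw [h, matOp_zero]
  map_add' b b' := by rw [S.coaction_add, matOp_add]
  map_mul' b b' := by rw [S.coaction_mul, matOp_mul]; rfl
  map_star' b := by
    rw [S.coaction_star, ← adjoint_matOp]
    rfl

lemma norm_matOp_coaction_le (σ : Irrep G) (b : α.fixedAlg) :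
    ‖matOp 𝒟.π (S.coaction σ b)‖ ≤ ‖b‖ :=
  NonUnitalStarAlgHom.norm_apply_le (coactionRep S 𝒟 σ) b

lemma proj_apply_proj (σ : Irrep G) (x : PiLp 2 fun _ : Fin (S.mult σ) => H) :
    matOp 𝒟.π (S.proj σ) (matOp 𝒟.π (S.proj σ) x) = matOp 𝒟.π (S.proj σ) x := by
  have h : S.proj σ * S.proj σ = S.proj σ := by
    rw [IsometryFamily.proj, ← S.coaction_mul, mul_one]
  conv_rhs => rw [← h, matOp_mul]
  rfl

lemma adjoint_matOp_proj (σ : Irrep G) :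
    ContinuousLinearMap.adjoint (matOp 𝒟.π (S.proj σ)) = matOp 𝒟.π (S.proj σ) := by
  rw [adjoint_matOp, IsometryFamily.proj, ← S.coaction_star, star_one]

lemma inner_proj_left (σ : Irrep G) (x y : PiLp 2 fun _ : Fin (S.mult σ) => H) :
    ⟪matOp 𝒟.π (S.proj σ) x, y⟫_ℂ = ⟪x, matOp 𝒟.π (S.proj σ) y⟫_ℂ := by
  conv_lhs => rw [← adjoint_matOp_proj, ContinuousLinearMap.adjoint_inner_left]

lemma norm_proj_apply_le (σ : Irrep G) (x : PiLp 2 fun _ : Fin (S.mult σ) => H) :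
    ‖matOp 𝒟.π (S.proj σ) x‖ ≤ ‖x‖ := by
  refine (ContinuousLinearMap.le_of_opNorm_le _ (norm_matOp_le_one 𝒟.π ?_) x).trans_eq (one_mul _)
  rw [IsometryFamily.proj, ← S.coaction_star, ← S.coaction_mul, ← S.coaction_mul, star_one,
    mul_one, mul_one]

lemma proj_apply_coe (σ : Irrep G) (x : fiber S 𝒟 σ) :
    matOp 𝒟.π (S.proj σ) (x : PiLp 2 fun _ : Fin (S.mult σ) => H) = x := by
  obtain ⟨_, ⟨y, rfl⟩⟩ := x
  exact proj_apply_proj S 𝒟 σ y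

instance completeSpace_fiber (σ : Irrep G) : CompleteSpace (fiber S 𝒟 σ) := by
  have h : (fiber S 𝒟 σ : Set (PiLp 2 fun _ : Fin (S.mult σ) => H)) =
      {x | matOp 𝒟.π (S.proj σ) x = x} := by
    ext x
    exact ⟨fun hx => proj_apply_coe S 𝒟 σ ⟨x, hx⟩, fun hx => ⟨x, hx⟩⟩
  have h' : IsClosed (fiber S 𝒟 σ : Set (PiLp 2 fun _ : Fin (S.mult σ) => H)) := by
    rw [h]
    exact isClosed_eq (ContinuousLinearMap.continuous _) continuous_id
  exact h'.completeSpace_coe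

lemma selfAdjointGraph_horizontalDirac
    (h : ∀ σ, ∃ C : ℝ, 0 ≤ C ∧ CommutatorBound (ampl 𝒟.D (Fin (S.mult σ)))
      (ampl 𝒟.D (Fin (S.mult σ))) (matOp 𝒟.π (S.proj σ)) C) :
    SelfAdjointGraph (horizontalDirac S 𝒟) := by
  refine SelfAdjointGraph.directSumOp fun q => ?_
  obtain ⟨C, hC, hCb⟩ := h q.1
  exact ((SelfAdjointGraph.of_isSelfAdjoint 𝒟.selfAdjoint).ampl _).compress
    (proj_apply_proj S 𝒟 q.1) (inner_proj_left S 𝒟 q.1) hC hCb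

end Fibers

/-! ### The representation of the generators -/

section Generators

open scoped InnerProductSpace

lemma linearPMap_apply_sum {E F ι : Type*} [AddCommGroup E] [Module ℂ E] [AddCommGroup F]
    [Module ℂ F] [Fintype ι] (D : E →ₗ.[ℂ] F) (c : ι → ℂ) (x : ι → D.domain) {v : E}
    (hv : v ∈ D.domain) (h : v = ∑ l, c l • (x l : E)) : D ⟨v, hv⟩ = ∑ l, c l • D (x l) := by
  have h1 : (⟨v, hv⟩ : D.domain) = ∑ l, c l • x l := Subtype.ext (by simp [h])
  rw [h1]
  exact (map_sum D.toFun _ _).trans (Finset.sum_congr rfl fun l _ => map_smul D.toFun _ _)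

variable {G A H : Type*} [Group G] [TopologicalSpace G] [CStarAlgebra A]
  [NormedAddCommGroup H] [InnerProductSpace ℂ H] [CompleteSpace H]
  {α : CStarSystem G A} (S : IsometryFamily α) (𝒟 : SpectralTriple α.fixedAlg H)
  {σ : Irrep G} (δ : ∀ τ, TensorDecomp σ τ)

/-- The scalar part of the adjoint of `π_A(s(σ)*_{ia} b)`. Multiplication by coefficients
`σ.mat · i i'` sends the vector `ē_j` of `V̄_τ` to `∑ l, star (w_{r,l}) ē_l` in `V̄_{κ r}`, for each
component `κ r` of `σ ⊗ τ`; accordingly the part of `spread` for `q = (τ, j)` takes `ξ ∈ H_p` to the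
family, indexed by `r`, of the vectors `∑ l, w_{r,l} ξ_{(κ r, l)}`. -/
noncomputable def spread (i : Fin σ.dim) (q : Σ τ : Irrep G, Fin τ.dim) :
    LiftSpace S 𝒟 →ₗ[ℂ] PiLp 2 fun _ : Σ r, Fin (S.mult ((δ q.1).comp r)) => H where
  toFun ξ := WithLp.toLp 2 fun z => ∑ l,
    (((Real.sqrt q.1.dim / Real.sqrt ((δ q.1).comp z.1).dim : ℝ) : ℂ) *
      (δ q.1).U ⟨z.1, l⟩ (i, q.2)) •
        (ξ ⟨(δ q.1).comp z.1, l⟩ : PiLp 2 fun _ : Fin (S.mult ((δ q.1).comp z.1)) => H) z.2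
  map_add' ξ η := by
    ext z
    simp [smul_add, Finset.sum_add_distrib]
  map_smul' c ξ := by
    ext z
    simp [Finset.smul_sum, smul_smul, mul_comm]

lemma spread_apply (i : Fin σ.dim) (q : Σ τ : Irrep G, Fin τ.dim) (ξ : LiftSpace S 𝒟)
    (z : Σ r, Fin (S.mult ((δ q.1).comp r))) :
    spread S 𝒟 δ i q ξ z = ∑ l,
      (((Real.sqrt q.1.dim / Real.sqrt ((δ q.1).comp z.1).dim : ℝ) : ℂ) *
        (δ q.1).U ⟨z.1, l⟩ (i, q.2)) •
          (ξ ⟨(δ q.1).comp z.1, l⟩ : PiLp 2 fun _ : Fin (S.mult ((δ q.1).comp z.1)) => H) z.2 :=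
  rfl

lemma matOp_conjTranspose_shift_mem {τ : Irrep G} (δ : TensorDecomp σ τ) (a : Fin (S.mult σ))
    (b : α.fixedAlg) (u : PiLp 2 fun _ : Σ r, Fin (S.mult (δ.comp r)) => H) :
    matOp 𝒟.π (S.shift δ a b)ᴴ u ∈ fiber S 𝒟 τ := by
  have h : (S.shift δ a b)ᴴ = S.proj τ * (S.shift δ a b)ᴴ := by
    rw [IsometryFamily.shift, Matrix.conjTranspose_mul, ← S.coaction_star, ← Matrix.mul_assoc,
      IsometryFamily.proj, ← S.coaction_mul, one_mul]
  rw [h, matOp_mul]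
  exact ⟨_, rfl⟩

lemma conjTranspose_shift {τ : Irrep G} (δ : TensorDecomp σ τ) (a : Fin (S.mult σ))
    (b : α.fixedAlg) : (S.shift δ a b)ᴴ =
      S.coaction τ (star b) * (S.cocycle δ)ᴴ.submatrix (fun e => (a, e)) id := by
  rw [IsometryFamily.shift, Matrix.conjTranspose_mul, ← S.coaction_star]
  rfl

lemma cocycle_mul_conjTranspose_mul {τ : Irrep G} (δ : TensorDecomp σ τ) :
    (S.cocycle δ)ᴴ * (S.cocycle δ)ᴴᴴ * (S.cocycle δ)ᴴ = (S.cocycle δ)ᴴ := by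
  have h := congrArg Matrix.conjTranspose (S.blockDiagonal_mul_cocycle δ)
  rw [← S.cocycle_mul_conjTranspose, Matrix.conjTranspose_mul, Matrix.conjTranspose_mul] at h
  rw [Matrix.mul_assoc]
  exact h

lemma norm_matOp_cocycle_submatrix_le {τ : Irrep G} (δ : TensorDecomp σ τ)
    (a : Fin (S.mult σ)) : ‖matOp 𝒟.π ((S.cocycle δ)ᴴ.submatrix (fun e => (a, e)) id)‖ ≤ 1 :=
  (norm_matOp_submatrix_le 𝒟.π _ fun _ _ h => (Prod.mk.inj h).2).trans
    (norm_matOp_le_one 𝒟.π (cocycle_mul_conjTranspose_mul S δ))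

lemma norm_matOp_conjTranspose_shift_le {τ : Irrep G} (δ : TensorDecomp σ τ)
    (a : Fin (S.mult σ)) (b : α.fixedAlg)
    (u : PiLp 2 fun _ : Σ r, Fin (S.mult (δ.comp r)) => H) :
    ‖matOp 𝒟.π (S.shift δ a b)ᴴ u‖ ≤ ‖b‖ * ‖u‖ := by
  rw [conjTranspose_shift, matOp_mul]
  refine (ContinuousLinearMap.le_of_opNorm_le _ (norm_matOp_coaction_le S 𝒟 τ (star b)) _).trans ?_
  rw [norm_star]
  gcongr
  exact (ContinuousLinearMap.le_of_opNorm_le _ (norm_matOp_cocycle_submatrix_le S 𝒟 δ a) u).trans_eq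
    (one_mul _)

lemma conjTranspose_shift_mul_blockDiagonal {τ : Irrep G} (δ : TensorDecomp σ τ)
    (a : Fin (S.mult σ)) (b : α.fixedAlg) :
    (S.shift δ a b)ᴴ * (Matrix.blockDiagonal' fun r => S.proj (δ.comp r)) =
      (S.shift δ a b)ᴴ := by
  have h : (Matrix.blockDiagonal' fun r => S.proj (δ.comp r)) * S.shift δ a b =
      S.shift δ a b := by
    rw [IsometryFamily.shift, ← Matrix.mul_assoc]
    congr 1
    exact congrArg (fun M => M.submatrix id fun e => (a, e)) (S.blockDiagonal_mul_cocycle δ)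
  have h' := congrArg Matrix.conjTranspose h
  rw [Matrix.conjTranspose_mul, Matrix.blockDiagonal'_conjTranspose] at h'
  simpa only [IsometryFamily.proj, ← S.coaction_star, star_one] using h'

lemma matOp_blockDiagonal_apply {τ : Irrep G} (δ : TensorDecomp σ τ)
    (u : PiLp 2 fun _ : Σ r, Fin (S.mult (δ.comp r)) => H) (r : Fin δ.num)
    (c : Fin (S.mult (δ.comp r))) :
    matOp 𝒟.π (Matrix.blockDiagonal' fun r => S.proj (δ.comp r)) u ⟨r, c⟩ =
      matOp 𝒟.π (S.proj (δ.comp r)) (WithLp.toLp 2 fun c' => u ⟨r, c'⟩) c := by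
  rw [matOp_apply, matOp_apply, Fintype.sum_sigma, Finset.sum_eq_single r]
  · simp only [Matrix.blockDiagonal'_apply_eq]
  · intro r' _ hr
    exact Finset.sum_eq_zero fun k _ => by
      rw [Matrix.blockDiagonal'_apply_ne _ _ _ hr.symm, map_zero]
      rfl
  · simp

lemma horizontalDirac_domain (ξ : (horizontalDirac S 𝒟).domain) (q : Σ κ : Irrep G, Fin κ.dim) :
    (((ξ : LiftSpace S 𝒟) q : fiber S 𝒟 q.1) : PiLp 2 fun _ : Fin (S.mult q.1) => H) ∈
      (ampl 𝒟.D (Fin (S.mult q.1))).domain :=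
  ξ.2.1 q

lemma coe_horizontalDirac_apply (ξ : (horizontalDirac S 𝒟).domain)
    (q : Σ κ : Irrep G, Fin κ.dim) :
    ((horizontalDirac S 𝒟 ξ q : fiber S 𝒟 q.1) : PiLp 2 fun _ : Fin (S.mult q.1) => H) =
      matOp 𝒟.π (S.proj q.1) (ampl 𝒟.D _ ⟨_, horizontalDirac_domain S 𝒟 ξ q⟩) :=
  rfl

lemma spread_mem_domain (i : Fin σ.dim) (q : Σ τ : Irrep G, Fin τ.dim)
    (ξ : (horizontalDirac S 𝒟).domain) :
    spread S 𝒟 δ i q (ξ : LiftSpace S 𝒟) ∈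
      (ampl 𝒟.D (Σ r, Fin (S.mult ((δ q.1).comp r)))).domain := by
  intro z
  rw [spread_apply]
  exact Submodule.sum_mem _ fun l _ => 𝒟.D.domain.smul_mem _
    (horizontalDirac_domain S 𝒟 ξ ⟨(δ q.1).comp z.1, l⟩ z.2)

/-- The operator `spread` intertwines `D_h` with `D_B ⊗ 1` up to the projections `p(κ)`. -/
lemma spread_horizontalDirac (i : Fin σ.dim) (q : Σ τ : Irrep G, Fin τ.dim)
    (ξ : (horizontalDirac S 𝒟).domain) :
    spread S 𝒟 δ i q (horizontalDirac S 𝒟 ξ) =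
      matOp 𝒟.π (Matrix.blockDiagonal' fun r => S.proj ((δ q.1).comp r))
        (ampl 𝒟.D _ ⟨spread S 𝒟 δ i q (ξ : LiftSpace S 𝒟), spread_mem_domain S 𝒟 δ i q ξ⟩) := by
  ext ⟨r, c⟩
  rw [matOp_blockDiagonal_apply, spread_apply]
  have h1 : (WithLp.toLp 2 fun c' => ampl 𝒟.D (Σ r, Fin (S.mult ((δ q.1).comp r)))
      ⟨spread S 𝒟 δ i q (ξ : LiftSpace S 𝒟), spread_mem_domain S 𝒟 δ i q ξ⟩ ⟨r, c'⟩ :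
        PiLp 2 fun _ : Fin (S.mult ((δ q.1).comp r)) => H) =
      ∑ l, (((Real.sqrt q.1.dim / Real.sqrt ((δ q.1).comp r).dim : ℝ) : ℂ) *
        (δ q.1).U ⟨r, l⟩ (i, q.2)) • ampl 𝒟.D (Fin (S.mult ((δ q.1).comp r)))
          ⟨_, horizontalDirac_domain S 𝒟 ξ ⟨(δ q.1).comp r, l⟩⟩ := by
    ext c'
    refine (linearPMap_apply_sum 𝒟.D (fun l : Fin ((δ q.1).comp r).dim =>
      ((Real.sqrt q.1.dim / Real.sqrt ((δ q.1).comp r).dim : ℝ) : ℂ) *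
        (δ q.1).U ⟨r, l⟩ (i, q.2))
      (fun l => ⟨_, horizontalDirac_domain S 𝒟 ξ ⟨(δ q.1).comp r, l⟩ c'⟩)
      (spread_mem_domain S 𝒟 δ i q ξ ⟨r, c'⟩) (spread_apply S 𝒟 δ i q ξ ⟨r, c'⟩)).trans ?_
    simp only [WithLp.ofLp_sum, Finset.sum_apply, PiLp.smul_apply]
    rfl
  rw [h1, map_sum]
  simp only [map_smul, WithLp.ofLp_sum, Finset.sum_apply, PiLp.smul_apply,
    coe_horizontalDirac_apply]

/-- The commutator estimate in a single fiber: the projections in the definitions of `fiberDirac`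
and `horizontalDirac` are absorbed by `shift`. -/
lemma norm_fiberDirac_sub_le {τ : Irrep G} (δ : TensorDecomp σ τ) (a : Fin (S.mult σ))
    (b : α.fixedAlg) {C : ℝ}
    (h : CommutatorBound (ampl 𝒟.D (Σ r, Fin (S.mult (δ.comp r))))
      (ampl 𝒟.D (Fin (S.mult τ))) (matOp 𝒟.π (S.shift δ a b)ᴴ) C)
    (u : (ampl 𝒟.D (Σ r, Fin (S.mult (δ.comp r)))).domain) (w w' : fiber S 𝒟 τ)
    (hw : (w : PiLp 2 fun _ : Fin (S.mult τ) => H) = matOp 𝒟.π (S.shift δ a b)ᴴ u)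
    (hw' : (w' : PiLp 2 fun _ : Fin (S.mult τ) => H) = matOp 𝒟.π (S.shift δ a b)ᴴ
      (matOp 𝒟.π (Matrix.blockDiagonal' fun r => S.proj (δ.comp r)) (ampl 𝒟.D _ u))) :
    ∃ hmem : w ∈ (fiberDirac S 𝒟 τ).domain,
      ‖fiberDirac S 𝒟 τ ⟨w, hmem⟩ - w'‖ ≤ C * ‖(u : PiLp 2 fun _ : Σ r, Fin (S.mult (δ.comp r)) => H)‖ := by
  obtain ⟨h1, h2⟩ := h u
  have hmem : (w : PiLp 2 fun _ : Fin (S.mult τ) => H) ∈ (ampl 𝒟.D (Fin (S.mult τ))).domain :=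
    hw ▸ h1
  refine ⟨hmem, ?_⟩
  have h4 : ampl 𝒟.D (Fin (S.mult τ)) ⟨w, hmem⟩ = ampl 𝒟.D (Fin (S.mult τ)) ⟨_, h1⟩ :=
    congrArg _ (Subtype.ext hw)
  have h5 : (w' : PiLp 2 fun _ : Fin (S.mult τ) => H) =
      matOp 𝒟.π (S.proj τ) (matOp 𝒟.π (S.shift δ a b)ᴴ (ampl 𝒟.D _ u)) := by
    rw [← proj_apply_coe, hw', ← ContinuousLinearMap.comp_apply (matOp 𝒟.π _ᴴ), ← matOp_mul,
      conjTranspose_shift_mul_blockDiagonal]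
  have h3 : ((fiberDirac S 𝒟 τ ⟨w, hmem⟩ - w' : fiber S 𝒟 τ) :
      PiLp 2 fun _ : Fin (S.mult τ) => H) = matOp 𝒟.π (S.proj τ)
        (ampl 𝒟.D _ ⟨_, h1⟩ - matOp 𝒟.π (S.shift δ a b)ᴴ (ampl 𝒟.D _ u)) := by
    rw [map_sub, ← h5, ← h4]
    rfl
  rw [← Submodule.norm_coe, h3]
  exact (norm_proj_apply_le S 𝒟 τ _).trans h2

variable [IsTopologicalGroup G] [CompactSpace G] [MeasurableSpace G] [BorelSpace G]

lemma sum_norm_sq_spread_le (i : Fin σ.dim) (ξ : LiftSpace S 𝒟)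
    (F : Finset (Σ τ : Irrep G, Fin τ.dim)) :
    ∑ q ∈ F, ‖spread S 𝒟 δ i q ξ‖ ^ 2 ≤ ‖ξ‖ ^ 2 := by
  have h := sum_norm_sq_smul_U_le δ i
    (E := fun κ => PiLp 2 fun _ : Fin (S.mult κ) => H) (fun κ l => ξ ⟨κ, l⟩) (M := ‖ξ‖ ^ 2)
    (fun K => by
      have h1 := lp_sum_sq_le ξ (K.sigma fun κ => (Finset.univ : Finset (Fin κ.dim)))
      rw [Finset.sum_sigma] at h1
      exact h1) F
  refine le_trans (Finset.sum_le_sum fun q _ => le_of_eq ?_) h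
  rw [PiLp.norm_sq_eq_of_L2, Fintype.sum_sigma]
  refine Finset.sum_congr rfl fun r _ => ?_
  rw [PiLp.norm_sq_eq_of_L2]
  refine Finset.sum_congr rfl fun c _ => ?_
  rw [spread_apply]
  simp

/-- The adjoint of the operator `π_A(x)` for `x = s(σ)*_{ia} b`. -/
lemma exists_adjoint_liftedOp (i : Fin σ.dim) (a : Fin (S.mult σ)) (b : α.fixedAlg) :
    ∃ T : LiftSpace S 𝒟 →L[ℂ] LiftSpace S 𝒟, ∀ ξ q,
      ((T ξ q : fiber S 𝒟 q.1) : PiLp 2 fun _ : Fin (S.mult q.1) => H) =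
        matOp 𝒟.π (S.shift (δ q.1) a b)ᴴ (spread S 𝒟 δ i q ξ) := by
  obtain ⟨T, hT⟩ := exists_clm_lp (X := fun q : Σ τ : Irrep G, Fin τ.dim => fiber S 𝒟 q.1)
    (fun q => ((matOp 𝒟.π (S.shift (δ q.1) a b)ᴴ).toLinearMap ∘ₗ spread S 𝒟 δ i q).codRestrict
      (fiber S 𝒟 q.1) fun ξ => matOp_conjTranspose_shift_mem S 𝒟 (δ q.1) a b _)
    (norm_nonneg b) fun ξ F => by
      calc _ ≤ ∑ q ∈ F, (‖b‖ * ‖spread S 𝒟 δ i q ξ‖) ^ 2 :=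
            Finset.sum_le_sum fun q _ => by
              gcongr
              exact norm_matOp_conjTranspose_shift_le S 𝒟 (δ q.1) a b _
        _ = ‖b‖ ^ 2 * ∑ q ∈ F, ‖spread S 𝒟 δ i q ξ‖ ^ 2 := by
            rw [Finset.mul_sum]
            exact Finset.sum_congr rfl fun q _ => mul_pow _ _ _
        _ ≤ ‖b‖ ^ 2 * ‖ξ‖ ^ 2 := by
            gcongr
            exact sum_norm_sq_spread_le S 𝒟 δ i ξ F
        _ = _ := (mul_pow _ _ _).symm
  exact ⟨T, fun ξ q => congrArg Subtype.val (hT ξ q)⟩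

lemma commutatorBound_adjoint_liftedOp (i : Fin σ.dim) (a : Fin (S.mult σ)) (b : α.fixedAlg)
    {C : ℝ} (hC : 0 ≤ C)
    (h : ∀ τ, CommutatorBound (ampl 𝒟.D (Σ r, Fin (S.mult ((δ τ).comp r))))
      (ampl 𝒟.D (Fin (S.mult τ))) (matOp 𝒟.π (S.shift (δ τ) a b)ᴴ) C)
    {T : LiftSpace S 𝒟 →L[ℂ] LiftSpace S 𝒟} (hT : ∀ ξ q,
      ((T ξ q : fiber S 𝒟 q.1) : PiLp 2 fun _ : Fin (S.mult q.1) => H) =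
        matOp 𝒟.π (S.shift (δ q.1) a b)ᴴ (spread S 𝒟 δ i q ξ)) :
    CommutatorBound (horizontalDirac S 𝒟) (horizontalDirac S 𝒟) T C := by
  refine commutatorBound_directSumOp T hC fun ξ => ?_
  have key := fun q : Σ τ : Irrep G, Fin τ.dim => norm_fiberDirac_sub_le S 𝒟 (δ q.1) a b (h q.1)
    ⟨_, spread_mem_domain S 𝒟 δ i q ξ⟩ (T ξ q) (T (horizontalDirac S 𝒟 ξ) q) (hT _ q) (by
      rw [hT, spread_horizontalDirac])
  choose hmem' hle using key
  refine ⟨hmem', fun F => ?_⟩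
  calc _ ≤ ∑ q ∈ F, (C * ‖spread S 𝒟 δ i q (ξ : LiftSpace S 𝒟)‖) ^ 2 :=
        Finset.sum_le_sum fun q _ => by
          gcongr
          exact hle q
    _ = C ^ 2 * ∑ q ∈ F, ‖spread S 𝒟 δ i q (ξ : LiftSpace S 𝒟)‖ ^ 2 := by
        rw [Finset.mul_sum]
        exact Finset.sum_congr rfl fun q _ => mul_pow _ _ _
    _ ≤ C ^ 2 * ‖(ξ : LiftSpace S 𝒟)‖ ^ 2 := by
        gcongr
        exact sum_norm_sq_spread_le S 𝒟 δ i ξ F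
    _ = _ := (mul_pow _ _ _).symm

open Classical in
lemma isLiftedOp_adjoint (i : Fin σ.dim) (a : Fin (S.mult σ)) (b : α.fixedAlg)
    {T : LiftSpace S 𝒟 →L[ℂ] LiftSpace S 𝒟} (hT : ∀ ξ q,
      ((T ξ q : fiber S 𝒟 q.1) : PiLp 2 fun _ : Fin (S.mult q.1) => H) =
        matOp 𝒟.π (S.shift (δ q.1) a b)ᴴ (spread S 𝒟 δ i q ξ)) :
    IsLiftedOp S 𝒟 (star (S.s σ a i) * b) (ContinuousLinearMap.adjoint T) := by
  rintro ⟨τ, j⟩ ⟨κ, l⟩ ξ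
  refine ext_inner_left ℂ fun v => ?_
  have hproj : matOp 𝒟.π (S.proj κ) (matOp 𝒟.π (S.repBlock (star (S.s σ a i) * b) κ l τ j) ξ) =
      matOp 𝒟.π (S.repBlock (star (S.s σ a i) * b) κ l τ j) ξ := by
    conv_rhs => rw [← S.proj_mul_repBlock, matOp_mul]
    rfl
  -- it suffices to test against vectors `η` of the fiber
  have hv : ∀ w : fiber S 𝒟 κ, ⟪v, (w : PiLp 2 fun _ : Fin (S.mult κ) => H)⟫_ℂ =
      ⟪matOp 𝒟.π (S.proj κ) v, (w : PiLp 2 fun _ : Fin (S.mult κ) => H)⟫_ℂ := fun w => by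
    rw [inner_proj_left, proj_apply_coe]
  rw [← hproj, ← inner_proj_left]
  refine (hv _).trans ?_
  obtain ⟨η, hη⟩ : ∃ η : fiber S 𝒟 κ, (η : PiLp 2 fun _ : Fin (S.mult κ) => H) =
    matOp 𝒟.π (S.proj κ) v := ⟨⟨_, ⟨v, rfl⟩⟩, rfl⟩
  rw [← hη]
  have h1 : ⟪(η : PiLp 2 fun _ : Fin (S.mult κ) => H),
      ((ContinuousLinearMap.adjoint T (lp.single 2 ⟨τ, j⟩ ξ) ⟨κ, l⟩ : fiber S 𝒟 κ) :
        PiLp 2 fun _ : Fin (S.mult κ) => H)⟫_ℂ =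
      ⟪matOp 𝒟.π (S.shift (δ τ) a b)ᴴ (spread S 𝒟 δ i ⟨τ, j⟩ (lp.single 2 ⟨κ, l⟩ η)),
        (ξ : PiLp 2 fun _ : Fin (S.mult τ) => H)⟫_ℂ := by
    have h2 := lp.inner_single_left (𝕜 := ℂ)
      (G := fun q : Σ τ : Irrep G, Fin τ.dim => fiber S 𝒟 q.1) ⟨κ, l⟩ η
      (ContinuousLinearMap.adjoint T (lp.single 2 ⟨τ, j⟩ ξ))
    have h3 := lp.inner_single_right (𝕜 := ℂ)
      (G := fun q : Σ τ : Irrep G, Fin τ.dim => fiber S 𝒟 q.1) ⟨τ, j⟩ ξ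
      (T (lp.single 2 ⟨κ, l⟩ η))
    rw [ContinuousLinearMap.adjoint_inner_right] at h2
    rw [← hT _ ⟨τ, j⟩]
    exact h2.symm.trans h3
  rw [h1, ← adjoint_matOp, ContinuousLinearMap.adjoint_inner_left, S.repBlock_star_mul (δ τ),
    matOp_sum, _root_.sum_apply, inner_sum, PiLp.inner_apply, Fintype.sum_sigma]
  refine Finset.sum_congr rfl fun r _ => ?_
  rw [matOp_smul, _root_.smul_apply, inner_smul_right]
  by_cases hr : (δ τ).comp r = κ
  · subst hr
    rw [PiLp.inner_apply, Finset.mul_sum]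
    refine Finset.sum_congr rfl fun c _ => ?_
    have h4 : spread S 𝒟 δ i ⟨τ, j⟩ (lp.single 2 ⟨(δ τ).comp r, l⟩ η) ⟨r, c⟩ =
        (((Real.sqrt τ.dim / Real.sqrt ((δ τ).comp r).dim : ℝ) : ℂ) *
          (δ τ).U ⟨r, l⟩ (i, j)) • (η : PiLp 2 fun _ : Fin (S.mult ((δ τ).comp r)) => H) c := by
      rw [spread_apply, Finset.sum_eq_single l]
      · rw [lp.single_apply_self]
      · intro l' _ hl
        have hne : (⟨(δ τ).comp r, l'⟩ : Σ κ : Irrep G, Fin κ.dim) ≠ ⟨(δ τ).comp r, l⟩ := fun h =>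
          hl (eq_of_heq (Sigma.mk.inj h).2)
        rw [lp.single_apply_ne _ _ _ hne]
        simp
      · simp
    have h5 : matOp 𝒟.π (S.shiftRow (δ τ) a b r ((δ τ).comp r)) ξ c =
        matOp 𝒟.π (S.shift (δ τ) a b) ξ ⟨r, c⟩ := by
      rw [matOp_apply, matOp_apply]
      simp only [S.shiftRow_self]
    rw [h4, h5, inner_smul_left, map_mul, Complex.conj_ofReal, TensorDecomp.block_self]
    rfl
  · rw [S.shiftRow_of_ne _ _ _ hr, matOp_zero]
    rw [Finset.sum_eq_zero]
    · simp
    · intro c _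
      have h4 : spread S 𝒟 δ i ⟨τ, j⟩ (lp.single 2 ⟨κ, l⟩ η) ⟨r, c⟩ = 0 := by
        rw [spread_apply]
        refine Finset.sum_eq_zero fun l' _ => ?_
        rw [lp.single_apply_ne _ _ _ fun h => hr (congrArg Sigma.fst h)]
        simp
      rw [h4, inner_zero_left]

end Generators

/-! ### Linear combinations -/

section Combinations

variable {G A H : Type*} [Group G] [TopologicalSpace G] [CStarAlgebra A]
  [NormedAddCommGroup H] [InnerProductSpace ℂ H] [CompleteSpace H]
  {α : CStarSystem G A} {S : IsometryFamily α} {𝒟 : SpectralTriple α.fixedAlg H}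
  [IsTopologicalGroup G] [CompactSpace G] [MeasurableSpace G] [BorelSpace G]

lemma IsLiftedOp.add {x y : A} {T T' : LiftSpace S 𝒟 →L[ℂ] LiftSpace S 𝒟}
    (h : IsLiftedOp S 𝒟 x T) (h' : IsLiftedOp S 𝒟 y T') : IsLiftedOp S 𝒟 (x + y) (T + T') :=
  fun q r ξ => by
    rw [S.repBlock_add, matOp_add, _root_.add_apply, _root_.add_apply, ← h q r ξ, ← h' q r ξ]
    rfl

lemma IsLiftedOp.smul {x : A} {T : LiftSpace S 𝒟 →L[ℂ] LiftSpace S 𝒟}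
    (h : IsLiftedOp S 𝒟 x T) (c : ℂ) : IsLiftedOp S 𝒟 (c • x) (c • T) :=
  fun q r ξ => by
    rw [S.repBlock_smul, matOp_smul, _root_.smul_apply, _root_.smul_apply, ← h q r ξ]
    rfl

/-- The elements of `A` that act on `H_p` by operators with bounded commutators with `D_h`. -/
def boundedCommutatorSubmodule (S : IsometryFamily α) (𝒟 : SpectralTriple α.fixedAlg H) :
    Submodule ℂ A where
  carrier := {x | ∃ T : LiftSpace S 𝒟 →L[ℂ] LiftSpace S 𝒟,
    IsLiftedOp S 𝒟 x T ∧ HasBoundedCommutator (horizontalDirac S 𝒟) T}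
  add_mem' := by
    rintro x y ⟨T, h1, h2⟩ ⟨T', h1', h2'⟩
    exact ⟨T + T', h1.add h1', h2.add h2'⟩
  zero_mem' := by
    refine ⟨0, fun q r ξ => ?_, HasBoundedCommutator.zero _⟩
    have h : S.repBlock (0 : A) r.1 r.2 q.1 q.2 = 0 := by
      have := S.repBlock_smul 0 0 r.1 r.2 q.1 q.2
      rwa [zero_smul, zero_smul] at this
    rw [h, matOp_zero]
    rfl
  smul_mem' := by
    rintro c x ⟨T, h1, h2⟩
    exact ⟨c • T, h1.smul c, h2.smul c⟩

end Combinations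

end HorizontalLift

theorem theorem5p4
    {n : ℕ} {G : Type*} [Group G] [TopologicalSpace G] [CompactSpace G] [T2Space G]
    [ChartedSpace (EuclideanSpace ℝ (Fin n)) G] [LieGroup (𝓡 n) ∞ G] [IsTopologicalGroup G]
    [MeasurableSpace G] [BorelSpace G]
    {A : Type*} [CStarAlgebra A]
    {H : Type*} [NormedAddCommGroup H] [InnerProductSpace ℂ H] [CompleteSpace H]
    (α : CStarSystem G A) (hfree : α.IsFree)
    (S : IsometryFamily α)
    (𝒟 : SpectralTriple α.fixedAlg H)
    (δ : ∀ σ τ : Irrep G, TensorDecomp σ τ)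
    (hγ₀ : ∀ σ, ∀ b ∈ 𝒟.alg, ∀ a c, S.coaction σ b a c ∈ 𝒟.alg)
    (hω₀ : ∀ σ τ a c, S.cocycle (δ σ τ) a c ∈ 𝒟.alg)
    (hγ : ∀ b ∈ 𝒟.alg, ∃ C : ℝ, ∀ τ,
      CommutatorBound (ampl 𝒟.D (Fin (S.mult τ))) (ampl 𝒟.D (Fin (S.mult τ)))
        (matOp 𝒟.π (S.coaction τ b)) C)
    (hω : ∀ σ, ∃ C : ℝ, ∀ τ,
      CommutatorBound (ampl 𝒟.D (Fin (S.mult σ) × Fin (S.mult τ)))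
        (ampl 𝒟.D (Σ r, Fin (S.mult ((δ σ τ).comp r))))
        (matOp 𝒟.π (S.cocycle (δ σ τ))) C) :
    ∀ x ∈ S.smoothAlg 𝒟.alg, ∃ T : LiftSpace S 𝒟 →L[ℂ] LiftSpace S 𝒟,
      IsLiftedOp S 𝒟 x T ∧ HasBoundedCommutator (horizontalDirac S 𝒟) T := by
  have hγ' : ∀ b ∈ 𝒟.alg, ∃ C : ℝ, 0 ≤ C ∧ ∀ τ,
      CommutatorBound (ampl 𝒟.D (Fin (S.mult τ))) (ampl 𝒟.D (Fin (S.mult τ)))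
        (matOp 𝒟.π (S.coaction τ b)) C := fun b hb => by
    obtain ⟨C, hC⟩ := hγ b hb
    exact ⟨|C|, abs_nonneg C, fun τ => (hC τ).mono (le_abs_self C)⟩
  have hD := SelfAdjointGraph.of_isSelfAdjoint 𝒟.selfAdjoint
  have hDh : SelfAdjointGraph (horizontalDirac S 𝒟) := by
    obtain ⟨C, hC0, hC⟩ := hγ' 1 𝒟.alg.one_mem
    exact selfAdjointGraph_horizontalDirac S 𝒟 fun σ => ⟨C, hC0, hC σ⟩
  suffices h : S.smoothAlg 𝒟.alg ≤ boundedCommutatorSubmodule S 𝒟 from fun x hx => h hx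
  refine Submodule.span_le.2 ?_
  rintro _ ⟨σ, y, hy, rfl⟩
  refine Submodule.sum_mem _ fun i _ => Submodule.sum_mem _ fun a _ => ?_
  obtain ⟨C₁, hC₁0, hC₁⟩ := hγ' (star (y a i)) (star_mem (hy a i))
  obtain ⟨C₂, hC₂⟩ := hω σ
  obtain ⟨T, hT⟩ := exists_adjoint_liftedOp S 𝒟 (δ σ) i a (y a i)
  have hbound : ∀ τ, CommutatorBound (ampl 𝒟.D (Σ r, Fin (S.mult ((δ σ τ).comp r))))
      (ampl 𝒟.D (Fin (S.mult τ))) (matOp 𝒟.π (S.shift (δ σ τ) a (y a i))ᴴ)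
      (C₁ * 1 + ‖y a i‖ * |C₂|) := by
    intro τ
    have h1 := ((hC₂ τ).mono (le_abs_self C₂)).adjoint (hD.ampl _) (hD.ampl _) (abs_nonneg C₂)
    rw [adjoint_matOp] at h1
    have h2 := (hC₁ τ).comp (h1.submatrix 𝒟.π (f := fun e => (a, e))
      fun _ _ h => (Prod.mk.inj h).2) hC₁0
    rw [← matOp_mul, ← conjTranspose_shift] at h2
    refine h2.mono (add_le_add ?_ ?_)
    · exact mul_le_mul_of_nonneg_left (norm_matOp_cocycle_submatrix_le S 𝒟 (δ σ τ) a) hC₁0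
    · refine mul_le_mul_of_nonneg_right ?_ (abs_nonneg C₂)
      exact (norm_matOp_coaction_le S 𝒟 τ _).trans_eq (norm_star _)
  have hC0 : 0 ≤ C₁ * 1 + ‖y a i‖ * |C₂| := by positivity
  exact ⟨ContinuousLinearMap.adjoint T, isLiftedOp_adjoint S 𝒟 (δ σ) i a (y a i) hT,
    _, (commutatorBound_adjoint_liftedOp S 𝒟 (δ σ) i a (y a i) hC0 hbound hT).adjoint hDh hDh hC0⟩
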